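/- Let $G=(V,E)$ be a finite simple connected graph, let $1<p<\infty$ and let $f_0:V\to[0,1]$. Given update vertices $v_1,v_2,\dots\in V$, the $\ell^p$-energy minimization dynamics are defined for $t\ge 1$ by $$f_t(v)=\operatorname{argmin}_{y\in\mathbb R}\sum_{w\sim v}|f_{t-1}(w)-y|^p\ \text{ if } v=v_t,\qquad f_t(v)=f_{t-1}(v)\ \text{ if } v\ne v_t .$$ Let $\mathcal E_p(f)=\sum_{\{u,w\}\in E}|f(u)-f(w)|^p$, $\operatorname{osc}(f)=\max_V f-\min_V f$, and $\tau_p(\epsilon)=\min\{t\ge 0:\operatorname{osc}(f_t)\le\epsilon\}$ (equal to $\infty$ if there is no such $t$). Let $D_G=\frac1{|V|}\sum_{v\in V}\deg(v)$ be the average degree. Put $\beta_p=\max\{\frac{2p}{p-1},3\}$, put $\theta_p=\frac1{p-1}$ if $1<p\le 2$ and $\theta_p=\max\{\frac{3-p}{p-1},0\}$ if $p\ge 2$, and let $$F(n,p,D)=n^{-\beta_p}(D/n)^{-\theta_p}.$$ Theorem. Fix $1<p<\infty$. There are constants $c_p,C_p>0$, depending only on $p$, such that for all $n\ge2$, for every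 connected graph $G=(V,E)$ with $|V|=n$ and for every $f_0:V\to[0,1]$, the dynamics with independent update vertices $v_1,v_2,\dots$, each uniformly distributed on $V$, satisfy (a) $\mathbb E[\mathcal E_p(f_t)]\le \mathcal E_p(f_0)\exp(-c_pF(n,p,D_G)\,t)$ for all integers $t\ge0$; (b) $\mathbb E[\tau_p(\epsilon)]\le \dfrac{C_p\log(n/\epsilon)}{F(n,p,D_G)}$ for all $\epsilon\in(0,1/2]$. Conversely, there are $\tilde c_p>0$ and $N_0=N_0(p)$ such that for every integer $N\ge N_0$ and every real $D$ with $2\le D\le N$ there are a connected graph $G=(V,E)$ with $|V|\le N$ and $D_G\le D$, and an initial profile $f_0:V\to[0,1]$, such that $$\tau_p(1/2)\ge\frac{\tilde c_p}{F(N,p,D)}$$ for every sequence of update vertices. -/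

import Mathlib

open MeasureTheory ProbabilityTheory
open scoped ENNReal

namespace LpConsensus

noncomputable section

/-- The local energy `∑_{w ∼ v} |f w - y|^p` at the vertex `v`, as a function of the value `y`. -/
def localEnergy {V : Type*} [Fintype V] (G : SimpleGraph V) (p : ℝ) (f : V → ℝ) (v : V)
    (y : ℝ) : ℝ :=
  open Classical in ∑ w ∈ G.neighborFinset v, |f w - y| ^ p

/-- The minimizer `argmin_y ∑_{w ∼ v} |f w - y|^p`. For `1 < p` and `v` not isolated it exists and
is unique, see `isMinimizer_iff_eq_argminValue`. -/
def argminValue {V : Type*} [Fintype V] (G : SimpleGraph V) (p : ℝ) (f : V → ℝ) (v : V) : ℝ :=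
  Classical.epsilon fun y : ℝ => ∀ z : ℝ, localEnergy G p f v y ≤ localEnergy G p f v z

/-- One step of the dynamics: the value at `v` becomes the minimizer, the others stay. -/
def updateAt {V : Type*} [Fintype V] (G : SimpleGraph V) (p : ℝ) (f : V → ℝ) (v : V) : V → ℝ :=
  open Classical in Function.update f v (argminValue G p f v)

/-- The opinion profile `f_t` started from `f₀`, when `v t` is the vertex updated at step `t + 1`,
so that the vertices used at the steps `1, 2, 3, …` are `v 0, v 1, v 2, …`. -/
def opinion {V : Type*} [Fintype V] (G : SimpleGraph V) (p : ℝ) (f₀ : V → ℝ) (v : ℕ → V) :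
    ℕ → V → ℝ
  | 0 => f₀
  | t + 1 => updateAt G p (opinion G p f₀ v t) (v t)

/-- The oscillation `max f - min f`. -/
def osc {V : Type*} (f : V → ℝ) : ℝ := (⨆ v, f v) - ⨅ v, f v

/-- The `ℓ^p` energy `∑_{ {u,w} ∈ E } |f u - f w|^p`, each undirected edge counted once. -/
def energy {V : Type*} [Fintype V] (G : SimpleGraph V) (p : ℝ) (f : V → ℝ) : ℝ :=
  open Classical in
  ∑ e ∈ G.edgeFinset,
    Sym2.lift ⟨fun u w => |f u - f w| ^ p, fun u w => by
      simp only [abs_sub_comm]⟩ e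

/-- The `ε`-consensus time `min {t ≥ 0 : osc f_t ≤ ε}`, equal to `⊤` if there is no such `t`. -/
def consensusTime {V : Type*} [Fintype V] (G : SimpleGraph V) (p : ℝ) (f₀ : V → ℝ)
    (v : ℕ → V) (ε : ℝ) : ℕ∞ :=
  ⨅ (t : ℕ) (_ : osc (opinion G p f₀ v t) ≤ ε), (t : ℕ∞)

/-- The average degree of a finite graph. -/
def avgDegree {V : Type*} [Fintype V] (G : SimpleGraph V) : ℝ :=
  open Classical in (∑ v, (G.degree v : ℝ)) / (Fintype.card V : ℝ)

/-- `β_p = max (2p/(p-1), 3)`. -/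
def betaExp (p : ℝ) : ℝ := max (2 * p / (p - 1)) 3

/-- `θ_p = 1/(p-1)` for `p ≤ 2` and `θ_p = max ((3-p)/(p-1), 0)` for `p > 2`. -/
def thetaExp (p : ℝ) : ℝ := if p ≤ 2 then 1 / (p - 1) else max ((3 - p) / (p - 1)) 0

/-- `F(n,p,D) = n^{-β_p} (D/n)^{-θ_p}`. -/
def rateF (n : ℕ) (p D : ℝ) : ℝ := (n : ℝ) ^ (-betaExp p) * (D / n) ^ (-thetaExp p)

/-- The random vertices `v t` are independent and uniformly distributed on `V`. -/
structure IsUniformSelection {V Ω : Type*} [Fintype V] [MeasurableSpace V] [MeasurableSpace Ω]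
    (μ : Measure Ω) (v : ℕ → Ω → V) : Prop where
  measurable : ∀ t, Measurable (v t)
  indep : iIndepFun v μ
  uniform : ∀ t x, μ {ω | v t ω = x} = (Fintype.card V : ℝ≥0∞)⁻¹

theorem exists_minimizer {V : Type*} [Fintype V] (G : SimpleGraph V) {p : ℝ} (hp : 1 < p)
    (f : V → ℝ) {v : V} (hv : ∃ w, G.Adj v w) :
    ∃ y : ℝ, ∀ z : ℝ, localEnergy G p f v y ≤ localEnergy G p f v z := by
  classical
  obtain ⟨w, hw⟩ := hv
  have hp0 : 0 < p := by linarith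
  apply Continuous.exists_forall_le
  · unfold localEnergy
    refine continuous_finsetSum _ fun u _ => ?_
    exact (by fun_prop : Continuous fun y : ℝ => |f u - y|).rpow_const fun _ => Or.inr hp0.le
  · have h1 : Filter.Tendsto (fun y : ℝ => |f w - y| ^ p) (Filter.cocompact ℝ) Filter.atTop := by
      refine (tendsto_rpow_atTop hp0).comp ?_
      have h2 : Filter.Tendsto (fun y : ℝ => ‖y‖ - |f w|) (Filter.cocompact ℝ) Filter.atTop :=
        Filter.tendsto_atTop_add_const_right _ _ (tendsto_norm_cocompact_atTop (E := ℝ))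
      refine Filter.tendsto_atTop_mono (fun y => ?_) h2
      rw [Real.norm_eq_abs, abs_sub_comm]
      exact abs_sub_abs_le_abs_sub _ _
    refine Filter.tendsto_atTop_mono (fun y => ?_) h1
    unfold localEnergy
    refine Finset.single_le_sum (f := fun u => |f u - y| ^ p)
      (fun u _ => Real.rpow_nonneg (abs_nonneg _) _) ?_
    simpa using hw

theorem abs_rpow_midpoint_lt {p : ℝ} (hp : 1 < p) (a : ℝ) {x y : ℝ} (hxy : x ≠ y) :
    |a - (x + y) / 2| ^ p < (|a - x| ^ p + |a - y| ^ p) / 2 := by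
  have hp0 : 0 < p := by linarith
  have habs : |a - (x + y) / 2| ≤ (|a - x| + |a - y|) / 2 := by
    have h := abs_add_le (a - x) (a - y)
    have h' : a - (x + y) / 2 = (a - x + (a - y)) / 2 := by ring
    rw [h', abs_div, abs_two]
    linarith
  by_cases hne : |a - x| = |a - y|
  · have hmid : a - (x + y) / 2 = 0 := by
      rcases abs_eq_abs.mp hne with h | h
      · exact absurd (by linarith) hxy
      · linarith
    have hpos : 0 < |a - x| := by
      rw [abs_pos]
      intro h0
      rw [h0, abs_zero, eq_comm, abs_eq_zero] at hne
      exact hxy (by linarith)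
    rw [hmid, abs_zero, Real.zero_rpow hp0.ne', ← hne]
    have := Real.rpow_pos_of_pos hpos p
    linarith
  · have h := (strictConvexOn_rpow hp).2 (Set.mem_Ici.2 (abs_nonneg (a - x)))
      (Set.mem_Ici.2 (abs_nonneg (a - y))) hne (by norm_num : (0 : ℝ) < 1 / 2)
      (by norm_num : (0 : ℝ) < 1 / 2) (by norm_num)
    simp only [smul_eq_mul] at h
    have h2 : |a - (x + y) / 2| ^ p ≤ (1 / 2 * |a - x| + 1 / 2 * |a - y|) ^ p :=
      Real.rpow_le_rpow (abs_nonneg _) (by linarith) hp0.le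
    linarith

theorem isMinimizer_iff_eq_argminValue {V : Type*} [Fintype V] (G : SimpleGraph V) {p : ℝ}
    (hp : 1 < p) (f : V → ℝ) {v : V} (hv : ∃ w, G.Adj v w) (y : ℝ) :
    (∀ z : ℝ, localEnergy G p f v y ≤ localEnergy G p f v z) ↔ y = argminValue G p f v := by
  classical
  have hspec : ∀ z : ℝ, localEnergy G p f v (argminValue G p f v) ≤ localEnergy G p f v z :=
    Classical.epsilon_spec (exists_minimizer G hp f hv)
  refine ⟨fun hy => ?_, fun h => h ▸ hspec⟩
  by_contra hne
  obtain ⟨w, hw⟩ := hv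
  set x := argminValue G p f v
  have hlt : localEnergy G p f v ((y + x) / 2) <
      (localEnergy G p f v y + localEnergy G p f v x) / 2 := by
    unfold localEnergy
    rw [← Finset.sum_add_distrib, Finset.sum_div]
    exact Finset.sum_lt_sum_of_nonempty ⟨w, by simpa using hw⟩
      fun u _ => abs_rpow_midpoint_lt hp (f u) hne
  linarith [hy ((y + x) / 2), hspec ((y + x) / 2)]

end

end LpConsensus

open LpConsensus

/-! Upper bounds. Let `Λ` be the `ℓ¹`-norm of the `p`-Laplacian of `f`. Summing the `p`-Laplacian
over a sublevel set shows that the flux of `|∇f|^(p-1)` through every level is at most `Λ`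
(`cut_flux_le`). So every edge difference is at most `Λ^(1/(p-1))`, the oscillation is at most `n
Λ^(1/(p-1))`, and summation by parts gives `E ≤ n Λ^(p/(p-1))` (`energy_le_of_connected`). On the
other hand, an exact update releases at least as much energy as moving the vertex by a trial
distance `τ` in the direction of its `p`-Laplacian. With the same `τ` at all vertices, the releases
add up to at least `p τ (Λ - remainder)` (`le_sum_energy_sub`). If `τ` is of order `Λ^(1/(p-1)) / K`
and the remainder is at most `Λ/2`, the sum is of order `E/(nK)`; averaging over the updated vertex
gives the rate `1/(n² K)`, which is `rateF` up to a constant.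

It remains to find `K`. For `p ≤ 2` the derivative of `|z|^p` is Hölder continuous of exponent `p -
1`, the remainder is of order `n D τ^(p-1)`, and `K = (nD)^(1/(p-1))`. For `p > 2` the remainder
also contains `τ ∑ |∇f|^(p-2)`. The main point is `sum_rpow_half_le`: the sum of `|∇f|^((p-1)/2)`
over all edges is at most `2 n √Λ`, whatever the number of edges. Interpolating with the trivial
exponent `0` (for `p ≤ 3`) or with the maximal gradient (for `p ≥ 3`) yields
`sum_abs_rpow_sub_two_le` and `K = n D^θ`. Iterating the one-step bound gives (a); Markov's
inequality and a geometric series give (b).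

Lower bounds. The graphs consist of layers, consecutive ones completely joined: two mirror-image
wide ends connected by a long path, with a ramp from `0` to `1` along the path as initial profile.
Since `f ↦ 1 - f` commutes with the dynamics, oscillation at most `1/2` forces one of the two ends
to leave the vicinity of its initial value (`osc_ramp_le_half`).

To show that this takes long, the profile is dominated by barriers: a common value for each layer,
and an individual value for each vertex of certain slow layers. The barriers live on a weighted
chain, chosen so that the update rule of a common barrier does not increase the energy `J` of the
chain, while raising a slow vertex by `δ` lowers `J` by a multiple of `δ^s`. As `δ ≤ η + η^(1-s)
δ^s`, the potential (sum of slow barriers) `+ A J` grows by at most `η` per step (`exists_barrier`).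
Initially it is only the small energy of the ramp, so many steps are needed before all slow vertices
exceed `1/4`.

For `p ≤ 2` the only slow layer is a large one at the end, and `s = p` (`le_time_of_le_two`). For `p
> 2` the slow layers are the odd layers of a chain of complete bipartite pieces, and `s = 2`
(`le_time_of_two_le`). The nonlinear minimizer is compared with a linear average by
`sum_signedPow_lag_le`: vertices that lag behind the common value of their layer pull the minimizer
down at least as much as a small linear weight on their lags does. -/

namespace LpConsensus

/-! ### Signed powers -/

/-- The signed power `sign z * |z| ^ (p - 1)`, i.e. the derivative of `|z| ^ p / p`. -/
noncomputable def signedPow (p z : ℝ) : ℝ := if 0 ≤ z then z ^ (p - 1) else -(-z) ^ (p - 1)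

theorem signedPow_of_nonneg {p z : ℝ} (hz : 0 ≤ z) : signedPow p z = z ^ (p - 1) := if_pos hz

theorem signedPow_of_nonpos {p z : ℝ} (hp : 1 < p) (hz : z ≤ 0) :
    signedPow p z = -(-z) ^ (p - 1) := by
  rcases hz.eq_or_lt with rfl | h
  · simp [signedPow, Real.zero_rpow (by linarith : p - 1 ≠ 0)]
  · exact if_neg (not_le.2 h)

theorem signedPow_zero {p : ℝ} (hp : 1 < p) : signedPow p 0 = 0 := by
  rw [signedPow_of_nonneg le_rfl, Real.zero_rpow (by linarith)]

theorem signedPow_neg {p : ℝ} (hp : 1 < p) (z : ℝ) : signedPow p (-z) = -signedPow p z := by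
  rcases le_total 0 z with h | h
  · rw [signedPow_of_nonpos hp (by linarith), signedPow_of_nonneg h, neg_neg]
  · rw [signedPow_of_nonneg (by linarith), signedPow_of_nonpos hp h, neg_neg]

theorem signedPow_nonneg {p z : ℝ} (hz : 0 ≤ z) : 0 ≤ signedPow p z := by
  rw [signedPow_of_nonneg hz]; exact Real.rpow_nonneg hz _

theorem signedPow_mono {p : ℝ} (hp : 1 < p) : Monotone (signedPow p) := by
  intro a b hab
  rcases le_total 0 a with ha | ha
  · rw [signedPow_of_nonneg ha, signedPow_of_nonneg (ha.trans hab)]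
    exact Real.rpow_le_rpow ha hab (by linarith)
  · rcases le_total 0 b with hb | hb
    · have := signedPow_nonneg (p := p) hb
      have h2 := Real.rpow_nonneg (by linarith : 0 ≤ -a) (p - 1)
      rw [signedPow_of_nonpos hp ha]; linarith
    · rw [signedPow_of_nonpos hp ha, signedPow_of_nonpos hp hb]
      have := Real.rpow_le_rpow (by linarith : 0 ≤ -b) (by linarith : -b ≤ -a)
        (by linarith : 0 ≤ p - 1)
      linarith

theorem abs_signedPow {p : ℝ} (hp : 1 < p) (z : ℝ) : |signedPow p z| = |z| ^ (p - 1) := by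
  rcases le_total 0 z with h | h
  · rw [abs_of_nonneg (signedPow_nonneg h), signedPow_of_nonneg h, abs_of_nonneg h]
  · rw [signedPow_of_nonpos hp h, abs_neg, abs_of_nonpos h,
      abs_of_nonneg (Real.rpow_nonneg (by linarith) _)]

theorem rpow_sub_one_mul_self {p z : ℝ} (hp : 1 < p) (hz : 0 ≤ z) : z ^ (p - 1) * z = z ^ p := by
  rcases hz.eq_or_lt with rfl | h
  · simp [Real.zero_rpow (by linarith : p ≠ 0)]
  · rw [← Real.rpow_add_one h.ne']; ring_nf

theorem signedPow_mul_self {p : ℝ} (hp : 1 < p) (z : ℝ) : signedPow p z * z = |z| ^ p := by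
  rcases le_total 0 z with h | h
  · rw [signedPow_of_nonneg h, abs_of_nonneg h, rpow_sub_one_mul_self hp h]
  · rw [signedPow_of_nonpos hp h, abs_of_nonpos h, ← rpow_sub_one_mul_self hp (by linarith)]
    ring

theorem continuous_signedPow {p : ℝ} (hp : 1 < p) : Continuous (signedPow p) := by
  unfold signedPow
  refine Continuous.if_le ?_ ?_ continuous_const continuous_id ?_
  · exact continuous_id.rpow_const fun _ => Or.inr (by linarith)
  · exact (continuous_neg.rpow_const fun _ => Or.inr (by linarith)).neg
  · rintro x rfl
    simp [Real.zero_rpow (by linarith : p - 1 ≠ 0)]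

theorem signedPow_mul {p t : ℝ} (hp : 1 < p) (ht : 0 ≤ t) (z : ℝ) :
    signedPow p (t * z) = t ^ (p - 1) * signedPow p z := by
  rcases le_total 0 z with h | h
  · rw [signedPow_of_nonneg h, signedPow_of_nonneg (mul_nonneg ht h), Real.mul_rpow ht h]
  · rw [signedPow_of_nonpos hp h, signedPow_of_nonpos hp (mul_nonpos_of_nonneg_of_nonpos ht h),
      ← mul_neg, Real.mul_rpow ht (by linarith)]
    ring

theorem signedPow_two (z : ℝ) : signedPow 2 z = z := by
  rcases le_total 0 z with h | h
  · rw [signedPow_of_nonneg h]; norm_num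
  · rw [signedPow_of_nonpos one_lt_two h]; norm_num

/-- The tangent line inequality for `|·| ^ p`. -/
theorem abs_rpow_tangent_le {p : ℝ} (hp : 1 < p) (u v : ℝ) :
    |u| ^ p + p * signedPow p u * (v - u) ≤ |v| ^ p := by
  have hq := Real.HolderConjugate.conjExponent hp
  have hp0 : 0 < p := by linarith
  have h1 := Real.young_inequality_of_nonneg (abs_nonneg v)
    (Real.rpow_nonneg (abs_nonneg u) (p - 1)) hq
  have h2 : (|u| ^ (p - 1)) ^ (p.conjExponent) = |u| ^ p := by
    rw [← Real.rpow_mul (abs_nonneg u)]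
    congr 1
    have := hq.mul_eq_add
    linarith
  rw [h2] at h1
  have h3 : signedPow p u * v ≤ |v| * |u| ^ (p - 1) := by
    rw [← abs_signedPow hp u, mul_comm |v|, ← abs_mul]
    exact le_abs_self _
  have h4 : 1 / p.conjExponent = (p - 1) / p := by
    have := hq.inv_add_inv_eq_one
    field_simp at this ⊢
    have h5 := hq.mul_eq_add
    linarith
  have h6 : p * (|v| ^ p / p + |u| ^ p / p.conjExponent) = |v| ^ p + (p - 1) * |u| ^ p := by
    rw [div_eq_mul_one_div (|u| ^ p), h4]; field_simp
  have h7 := mul_le_mul_of_nonneg_left (h3.trans h1) hp0.le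
  rw [h6] at h7
  have h8 := signedPow_mul_self hp u
  nlinarith

theorem rpow_sub_rpow_le {m a b : ℝ} (hm : 1 ≤ m) (hb : 0 ≤ b) (hab : b ≤ a) :
    a ^ m - b ^ m ≤ m * a ^ (m - 1) * (a - b) := by
  rcases hm.eq_or_lt with rfl | hm
  · simp
  · have h := abs_rpow_tangent_le hm a b
    rw [signedPow_of_nonneg (hb.trans hab), abs_of_nonneg (hb.trans hab), abs_of_nonneg hb] at h
    linarith

/-- Powers with exponent in `(0, 1]` are subadditive; the factor `2` pays for an interval that
straddles `0`. -/
theorem signedPow_sub_le_of_le_two {p a b : ℝ} (hp : 1 < p) (hp2 : p ≤ 2) (hab : b ≤ a) :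
    signedPow p a - signedPow p b ≤ 2 * (a - b) ^ (p - 1) := by
  have key : ∀ x y : ℝ, 0 ≤ y → y ≤ x → x ^ (p - 1) - y ^ (p - 1) ≤ (x - y) ^ (p - 1) := by
    intro x y hy hxy
    have := Real.rpow_add_le_add_rpow (sub_nonneg.2 hxy) hy (by linarith : 0 ≤ p - 1)
      (by linarith)
    simp only [sub_add_cancel] at this
    linarith
  have hpos := Real.rpow_nonneg (sub_nonneg.2 hab) (p - 1)
  rcases le_total 0 b with hb | hb
  · rw [signedPow_of_nonneg hb, signedPow_of_nonneg (hb.trans hab)]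
    linarith [key a b hb hab]
  · rcases le_total 0 a with ha | ha
    · rw [signedPow_of_nonneg ha, signedPow_of_nonpos hp hb]
      have h1 := Real.rpow_le_rpow ha (by linarith : a ≤ a - b) (by linarith : 0 ≤ p - 1)
      have h2 := Real.rpow_le_rpow (by linarith : 0 ≤ -b) (by linarith : -b ≤ a - b)
        (by linarith : 0 ≤ p - 1)
      linarith
    · rw [signedPow_of_nonpos hp ha, signedPow_of_nonpos hp hb]
      have := key (-b) (-a) (by linarith) (by linarith)
      rw [show -b - -a = a - b by ring] at this
      linarith

theorem signedPow_sub_le_of_two_le {p a b : ℝ} (hp : 2 ≤ p) (hab : b ≤ a) :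
    signedPow p a - signedPow p b ≤ (p - 1) * (max |a| |b|) ^ (p - 2) * (a - b) := by
  have hp1 : 1 < p := by linarith
  have e : p - 1 - 1 = p - 2 := by ring
  have hM : 0 ≤ max |a| |b| := (abs_nonneg a).trans (le_max_left _ _)
  have hmono : ∀ x : ℝ, 0 ≤ x → x ≤ max |a| |b| → x ^ (p - 2) ≤ (max |a| |b|) ^ (p - 2) :=
    fun x h0 h1 => Real.rpow_le_rpow h0 h1 (by linarith)
  have hfac : 0 ≤ p - 1 := by linarith
  rcases le_total 0 b with hb | hb
  · rw [signedPow_of_nonneg hb, signedPow_of_nonneg (hb.trans hab)]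
    refine (rpow_sub_rpow_le (by linarith) hb hab).trans ?_
    rw [e]
    have := hmono a (hb.trans hab) ((le_abs_self a).trans (le_max_left _ _))
    have h2 := sub_nonneg.2 hab
    gcongr
  · rcases le_total 0 a with ha | ha
    · rw [signedPow_of_nonneg ha, signedPow_of_nonpos hp1 hb]
      have key : ∀ x : ℝ, 0 ≤ x → x ≤ max |a| |b| →
          x ^ (p - 1) ≤ (p - 1) * (max |a| |b|) ^ (p - 2) * x := by
        intro x hx hx'
        have h1 := rpow_sub_rpow_le (m := p - 1) (by linarith) le_rfl hx
        rw [e, Real.zero_rpow (by linarith), sub_zero, sub_zero] at h1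
        refine h1.trans ?_
        have := hmono x hx hx'
        gcongr
      have h1 := key a ha ((le_abs_self a).trans (le_max_left _ _))
      have h2 := key (-b) (by linarith) ((neg_le_abs b).trans (le_max_right _ _))
      nlinarith
    · rw [signedPow_of_nonpos hp1 ha, signedPow_of_nonpos hp1 hb]
      have h1 := rpow_sub_rpow_le (m := p - 1) (by linarith) (by linarith : 0 ≤ -a)
        (by linarith : -a ≤ -b)
      rw [e] at h1
      have := hmono (-b) (by linarith) ((neg_le_abs b).trans (le_max_right _ _))
      have h2 := sub_nonneg.2 hab
      have h3 : (p - 1) * (-b) ^ (p - 2) * (a - b) ≤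
        (p - 1) * (max |a| |b|) ^ (p - 2) * (a - b) := by gcongr
      rw [show -b - -a = a - b by ring] at h1
      linarith

/-- If `x` and `x - s` have the same sign, powers with exponent at least `1` are superadditive;
otherwise one of them has absolute value at least `s / 2`. -/
theorem half_rpow_le_signedPow_sub {p s : ℝ} (hp : 2 ≤ p) (hs : 0 ≤ s) (x : ℝ) :
    (s / 2) ^ (p - 1) ≤ signedPow p x - signedPow p (x - s) := by
  have hp1 : 1 < p := by linarith
  have hm : 0 ≤ p - 1 := by linarith
  have hhalf : (s / 2) ^ (p - 1) ≤ s ^ (p - 1) :=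
    Real.rpow_le_rpow (by linarith) (by linarith) hm
  have sup : ∀ y : ℝ, 0 ≤ y → s ^ (p - 1) + y ^ (p - 1) ≤ (s + y) ^ (p - 1) := fun y hy =>
    Real.add_rpow_le_rpow_add hs hy (by linarith)
  rcases le_total 0 x with hx | hx
  · rcases le_total 0 (x - s) with hxs | hxs
    · rw [signedPow_of_nonneg hx, signedPow_of_nonneg hxs]
      have := sup (x - s) hxs
      rw [show s + (x - s) = x by ring] at this
      linarith
    · rw [signedPow_of_nonneg hx, signedPow_of_nonpos hp1 hxs]
      have h1 := Real.rpow_nonneg hx (p - 1)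
      have h2 := Real.rpow_nonneg (by linarith : 0 ≤ -(x - s)) (p - 1)
      rcases le_total (s / 2) x with h | h
      · have := Real.rpow_le_rpow (by linarith) h hm
        linarith
      · have := Real.rpow_le_rpow (by linarith) (by linarith : s / 2 ≤ -(x - s)) hm
        linarith
  · rw [signedPow_of_nonpos hp1 hx, signedPow_of_nonpos hp1 (by linarith)]
    have := sup (-x) (by linarith)
    rw [show s + -x = -(x - s) by ring] at this
    linarith

/-- The linear counterpart of `half_rpow_le_signedPow_sub`, stronger when `s` is small compared with
`|x|`. -/
theorem half_abs_rpow_mul_le_signedPow_sub {p s : ℝ} (hp : 2 ≤ p) (hs : 0 ≤ s) (x : ℝ) :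
    |x| ^ (p - 2) * s / 2 ≤ signedPow p x - signedPow p (x - s) := by
  have hp1 : 1 < p := by linarith
  have e : ∀ y : ℝ, 0 ≤ y → y ^ (p - 1) = y ^ (p - 2) * y := by
    intro y hy
    rcases hy.eq_or_lt with rfl | h
    · simp [Real.zero_rpow (by linarith : p - 1 ≠ 0)]
    · rw [← Real.rpow_add_one h.ne']; ring_nf
  have mono : ∀ y z : ℝ, 0 ≤ y → y ≤ z → y ^ (p - 2) ≤ z ^ (p - 2) := fun y z h1 h2 =>
    Real.rpow_le_rpow h1 h2 (by linarith)
  have hpos := Real.rpow_nonneg (abs_nonneg x) (p - 2)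
  rcases le_total 0 x with hx | hx
  · rw [abs_of_nonneg hx] at hpos ⊢
    rcases le_total 0 (x - s) with hxs | hxs
    · rw [signedPow_of_nonneg hx, signedPow_of_nonneg hxs, e x hx, e _ hxs]
      have := mono (x - s) x hxs (by linarith)
      nlinarith
    · rw [signedPow_of_nonneg hx, signedPow_of_nonpos hp1 hxs, e x hx,
        e _ (by linarith : 0 ≤ -(x - s))]
      have hpos2 := Real.rpow_nonneg (by linarith : 0 ≤ -(x - s)) (p - 2)
      rcases le_total (s / 2) x with h | h
      · nlinarith
      · have := mono x (-(x - s)) hx (by linarith)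
        nlinarith
  · rw [signedPow_of_nonpos hp1 hx, signedPow_of_nonpos hp1 (by linarith), abs_of_nonpos hx,
      e _ (by linarith : 0 ≤ -x), e _ (by linarith : 0 ≤ -(x - s))]
    rw [abs_of_nonpos hx] at hpos
    have := mono (-x) (-(x - s)) (by linarith) (by linarith)
    nlinarith

/-- Every minimizer of the local energy lies below a point at which its derivative is
nonnegative. -/
theorem argminValue_le {V : Type*} [Fintype V] (G : SimpleGraph V) {p : ℝ} (hp : 1 < p)
    (f : V → ℝ) {v : V} (hv : ∃ w, G.Adj v w) (Y : ℝ)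
    (hY : open Classical in ∑ w ∈ G.neighborFinset v, signedPow p (f w - Y) ≤ 0) :
    argminValue G p f v ≤ Y := by
  classical
  by_contra! hlt
  have hspec : ∀ z : ℝ, localEnergy G p f v (argminValue G p f v) ≤ localEnergy G p f v z :=
    Classical.epsilon_spec (exists_minimizer G hp f hv)
  set y := argminValue G p f v with hy
  have h1 : localEnergy G p f v Y ≤ localEnergy G p f v y := by
    unfold localEnergy
    have : ∀ w ∈ G.neighborFinset v,
        |f w - Y| ^ p + p * (Y - y) * signedPow p (f w - Y) ≤ |f w - y| ^ p := by
      intro w _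
      have := abs_rpow_tangent_le hp (f w - Y) (f w - y)
      nlinarith
    have h2 := Finset.sum_le_sum this
    rw [Finset.sum_add_distrib, ← Finset.mul_sum] at h2
    have h3 : 0 ≤ p * (Y - y) * ∑ w ∈ G.neighborFinset v, signedPow p (f w - Y) := by
      refine mul_nonneg_of_nonpos_of_nonpos ?_ (by convert hY)
      nlinarith
    linarith
  have h2 : Y = y :=
    (isMinimizer_iff_eq_argminValue G hp f hv Y).1 fun z => h1.trans (hspec z)
  linarith

/-! ### Energies of weighted networks -/

/-- The `s`-energy of `g` with respect to the weights `W`, summed over ordered pairs. -/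
noncomputable def pairEnergy {X : Type*} [Fintype X] (W : X → X → ℝ) (s : ℝ) (g : X → ℝ) : ℝ :=
  ∑ x, ∑ y, W x y * |g x - g y| ^ s

theorem pairEnergy_nonneg {X : Type*} [Fintype X] {W : X → X → ℝ} (hW : ∀ x y, 0 ≤ W x y)
    (s : ℝ) (g : X → ℝ) : 0 ≤ pairEnergy W s g :=
  Finset.sum_nonneg fun x _ => Finset.sum_nonneg fun y _ =>
    mul_nonneg (hW x y) (Real.rpow_nonneg (abs_nonneg _) _)

/-- Only pairs containing `m` change. Each occurs in both orders, hence the factor `2`. -/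
theorem pairEnergy_update {X : Type*} [Fintype X] [DecidableEq X] {W : X → X → ℝ}
    (hsymm : ∀ x y, W x y = W y x) (hdiag : ∀ x, W x x = 0) (s : ℝ) (g : X → ℝ) (m : X) (Y : ℝ) :
    pairEnergy W s g - pairEnergy W s (Function.update g m Y) =
      2 * ∑ y, W m y * (|g y - g m| ^ s - |g y - Y| ^ s) := by
  unfold pairEnergy
  set g' := Function.update g m Y with hg'
  have hm : g' m = Y := by simp [hg']
  have ho : ∀ x, x ≠ m → g' x = g x := fun x hx => by simp [hg', hx]
  set d : X → ℝ := fun y => W m y * (|g y - g m| ^ s - |g y - Y| ^ s) with hd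
  have hterm : ∀ x y, W x y * |g x - g y| ^ s - W x y * |g' x - g' y| ^ s =
      (if x = m then d y else 0) + (if y = m then d x else 0) := by
    intro x y
    by_cases hx : x = m
    · by_cases hy : y = m
      · subst hx; subst hy; simp [hd, hdiag]
      · subst hx
        rw [hm, ho y hy]
        simp only [hd, if_true, hy, if_false, add_zero]
        rw [abs_sub_comm (g x) (g y), abs_sub_comm Y]; ring
    · by_cases hy : y = m
      · subst hy
        rw [hm, ho x hx]
        simp only [hd, hx, if_true, if_false, zero_add]
        rw [hsymm x y]; ring
      · rw [ho x hx, ho y hy]; simp [hx, hy]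
  rw [← Finset.sum_sub_distrib]
  simp_rw [← Finset.sum_sub_distrib, hterm, Finset.sum_add_distrib]
  simp
  ring

/-- Raising one coordinate to a point where the derivative of the energy is still nonpositive does
not increase the energy. -/
theorem pairEnergy_update_le {X : Type*} [Fintype X] [DecidableEq X] {W : X → X → ℝ}
    (hsymm : ∀ x y, W x y = W y x) (hdiag : ∀ x, W x x = 0) {s : ℝ} (hs : 1 < s)
    (g : X → ℝ) (m : X) (Y : ℝ) (hY : g m ≤ Y)
    (hd : 0 ≤ ∑ y, W m y * signedPow s (g y - Y)) (hW : ∀ x y, 0 ≤ W x y) :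
    pairEnergy W s (Function.update g m Y) ≤ pairEnergy W s g := by
  have h := pairEnergy_update hsymm hdiag s g m Y
  have h1 : s * (Y - g m) * ∑ y, W m y * signedPow s (g y - Y) ≤
      ∑ y, W m y * (|g y - g m| ^ s - |g y - Y| ^ s) := by
    rw [Finset.mul_sum]
    refine Finset.sum_le_sum fun y _ => ?_
    have := abs_rpow_tangent_le hs (g y - Y) (g y - g m)
    have h2 := mul_le_mul_of_nonneg_left
      (by linarith : s * signedPow s (g y - Y) * (g y - g m - (g y - Y)) ≤
        |g y - g m| ^ s - |g y - Y| ^ s) (hW m y)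
    refine le_trans (le_of_eq ?_) h2
    ring
  have h2 : 0 ≤ s * (Y - g m) * ∑ y, W m y * signedPow s (g y - Y) :=
    mul_nonneg (mul_nonneg (by linarith) (by linarith)) hd
  linarith

/-! ### Graph energies as network energies -/

section Graph

variable {V : Type*} (G : SimpleGraph V)

/-- The real adjacency matrix of a graph. -/
noncomputable def adjWeight (x y : V) : ℝ := open Classical in if G.Adj x y then 1 else 0

theorem adjWeight_comm (x y : V) : adjWeight G x y = adjWeight G y x := by
  by_cases h : G.Adj x y
  · simp [adjWeight, h, h.symm]
  · have h' : ¬ G.Adj y x := fun h' => h h'.symm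
    simp [adjWeight, h, h']

theorem adjWeight_self (x : V) : adjWeight G x x = 0 := by simp [adjWeight]

theorem adjWeight_nonneg (x y : V) : 0 ≤ adjWeight G x y := by
  unfold adjWeight; split_ifs <;> norm_num

theorem adjWeight_le_one (x y : V) : adjWeight G x y ≤ 1 := by
  unfold adjWeight; split_ifs <;> norm_num

theorem adjWeight_of_adj {x y : V} (h : G.Adj x y) : adjWeight G x y = 1 := by
  simp [adjWeight, h]

variable [Fintype V]

theorem sum_neighborFinset_eq [DecidableRel G.Adj] (F : V → ℝ) (v : V) :
    ∑ w ∈ G.neighborFinset v, F w = ∑ w, adjWeight G v w * F w := by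
  classical
  simp only [adjWeight, ite_mul, one_mul, zero_mul]
  rw [← Finset.sum_filter]
  refine Finset.sum_congr ?_ fun _ _ => rfl
  ext w; simp

theorem localEnergy_eq (p : ℝ) (f : V → ℝ) (v : V) (y : ℝ) :
    localEnergy G p f v y = ∑ w, adjWeight G v w * |f w - y| ^ p := by
  classical
  unfold localEnergy
  exact sum_neighborFinset_eq G _ v

theorem two_mul_energy (p : ℝ) (f : V → ℝ) :
    2 * energy G p f = pairEnergy (adjWeight G) p f := by
  classical
  have h1 : pairEnergy (adjWeight G) p f =
      ∑ q ∈ (Finset.univ : Finset (V × V)).filter (fun q => G.Adj q.1 q.2),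
        |f q.1 - f q.2| ^ p := by
    unfold pairEnergy adjWeight
    rw [← Fintype.sum_prod_type' (f := fun x y => (if G.Adj x y then (1 : ℝ) else 0) *
      |f x - f y| ^ p), Finset.sum_filter]
    simp
  have h2 := Finset.sum_fiberwise_of_maps_to
    (s := (Finset.univ : Finset (V × V)).filter (fun q => G.Adj q.1 q.2))
    (t := G.edgeFinset) (g := fun q : V × V => s(q.1, q.2))
    (by intro q hq; simpa using hq) (fun q : V × V => |f q.1 - f q.2| ^ p)
  rw [h1, ← h2]
  unfold energy
  rw [Finset.mul_sum]
  refine Finset.sum_congr (by ext; simp) fun e he => ?_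
  induction e using Sym2.ind with
  | _ a b =>
    have hab : G.Adj a b := by simpa using he
    have hset : ((Finset.univ : Finset (V × V)).filter (fun q => G.Adj q.1 q.2)).filter
        (fun q => s(q.1, q.2) = s(a, b)) = {(a, b), (b, a)} := by
      ext ⟨x, y⟩
      simp only [Finset.mem_filter, Finset.mem_univ, true_and, Finset.mem_insert,
        Finset.mem_singleton, Prod.mk.injEq, Sym2.eq_iff]
      constructor
      · exact fun h => h.2
      · rintro (⟨rfl, rfl⟩ | ⟨rfl, rfl⟩)
        · exact ⟨hab, Or.inl ⟨rfl, rfl⟩⟩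
        · exact ⟨hab.symm, Or.inr ⟨rfl, rfl⟩⟩
    rw [hset, Finset.sum_pair (by simp [hab.ne])]
    simp only [Sym2.lift_mk]
    rw [abs_sub_comm (f b)]; ring

theorem energy_nonneg (p : ℝ) (f : V → ℝ) : 0 ≤ energy G p f := by
  have := pairEnergy_nonneg (adjWeight_nonneg G) p f
  rw [← two_mul_energy] at this
  linarith

theorem energy_sub_energy_updateAt (p : ℝ) (f : V → ℝ) (v : V) :
    energy G p f - energy G p (updateAt G p f v) =
      localEnergy G p f v (f v) - localEnergy G p f v (argminValue G p f v) := by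
  classical
  have h := pairEnergy_update (adjWeight_comm G) (adjWeight_self G) p f v (argminValue G p f v)
  rw [← two_mul_energy, ← two_mul_energy] at h
  simp_rw [mul_sub, Finset.sum_sub_distrib, ← localEnergy_eq] at h
  have e : updateAt G p f v = Function.update f v (argminValue G p f v) := by
    unfold updateAt; congr!
  rw [e]; linarith

/-- The `p`-Laplacian of `f`. -/
noncomputable def pLaplacian (p : ℝ) (f : V → ℝ) (v : V) : ℝ :=
  ∑ w, adjWeight G v w * signedPow p (f w - f v)

/-- The `ℓ¹`-norm of the `p`-Laplacian. -/
noncomputable def laplacianNorm (p : ℝ) (f : V → ℝ) : ℝ := ∑ v, |pLaplacian G p f v|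

theorem laplacianNorm_nonneg (p : ℝ) (f : V → ℝ) : 0 ≤ laplacianNorm G p f :=
  Finset.sum_nonneg fun _ _ => abs_nonneg _

variable {G}

/-- A lower bound for the energy released by one update, from a trial displacement `τ`. -/
theorem le_energy_sub_energy_updateAt {p : ℝ} (hp : 1 < p) (f : V → ℝ) {v : V}
    (hv : ∃ w, G.Adj v w) {τ : ℝ} (hτ : 0 ≤ τ) (R : ℝ → ℝ)
    (hR₁ : ∀ a, signedPow p a - signedPow p (a - τ) ≤ R a)
    (hR₂ : ∀ a, signedPow p (a + τ) - signedPow p a ≤ R a) :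
    p * τ * (|pLaplacian G p f v| - ∑ w, adjWeight G v w * R (f w - f v)) ≤
      energy G p f - energy G p (updateAt G p f v) := by
  classical
  have hspec : ∀ z : ℝ, localEnergy G p f v (argminValue G p f v) ≤ localEnergy G p f v z :=
    Classical.epsilon_spec (exists_minimizer G hp f hv)
  rw [energy_sub_energy_updateAt]
  have hpτ : 0 ≤ p * τ := mul_nonneg (by linarith) hτ
  rcases le_total 0 (pLaplacian G p f v) with hL | hL
  · refine le_trans ?_ (sub_le_sub_left (hspec (f v + τ)) _)
    rw [abs_of_nonneg hL, localEnergy_eq, localEnergy_eq, pLaplacian, ← Finset.sum_sub_distrib,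
      ← Finset.sum_sub_distrib, Finset.mul_sum]
    refine Finset.sum_le_sum fun w _ => ?_
    have h1 := abs_rpow_tangent_le hp (f w - (f v + τ)) (f w - f v)
    have h2 := hR₁ (f w - f v)
    rw [show f w - f v - τ = f w - (f v + τ) by ring] at h2
    have h3 : p * τ * (signedPow p (f w - f v) - R (f w - f v)) ≤
        |f w - f v| ^ p - |f w - (f v + τ)| ^ p := by nlinarith
    have := mul_le_mul_of_nonneg_left h3 (adjWeight_nonneg G v w)
    linarith
  · refine le_trans ?_ (sub_le_sub_left (hspec (f v - τ)) _)
    rw [abs_of_nonpos hL, localEnergy_eq, localEnergy_eq, pLaplacian, ← Finset.sum_neg_distrib,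
      ← Finset.sum_sub_distrib, ← Finset.sum_sub_distrib, Finset.mul_sum]
    refine Finset.sum_le_sum fun w _ => ?_
    have h1 := abs_rpow_tangent_le hp (f w - (f v - τ)) (f w - f v)
    have h2 := hR₂ (f w - f v)
    rw [show f w - f v + τ = f w - (f v - τ) by ring] at h2
    have h3 : p * τ * (-signedPow p (f w - f v) - R (f w - f v)) ≤
        |f w - f v| ^ p - |f w - (f v - τ)| ^ p := by nlinarith
    have := mul_le_mul_of_nonneg_left h3 (adjWeight_nonneg G v w)
    linarith

theorem sum_sum_antisymm_eq_zero {F : V → V → ℝ} (hF : ∀ x y, F x y = -F y x) :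
    ∑ x, ∑ y, F x y = 0 := by
  have h : ∑ x, ∑ y, F x y = -∑ x, ∑ y, F x y := by
    conv_lhs => rw [Finset.sum_comm]
    simp_rw [← Finset.sum_neg_distrib]
    exact Finset.sum_congr rfl fun x _ => Finset.sum_congr rfl fun y _ => hF y x
  linarith

theorem signedPow_sub_comm {p : ℝ} (hp : 1 < p) (a b : ℝ) :
    signedPow p (a - b) = -signedPow p (b - a) := by
  rw [← signedPow_neg hp, neg_sub]

/-- Summation by parts. -/
theorem energy_le_mul_laplacianNorm {p : ℝ} (hp : 1 < p) (f : V → ℝ) {B : ℝ}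
    (hB : ∀ u v, |f u - f v| ≤ B) : energy G p f ≤ B * laplacianNorm G p f := by
  classical
  rcases isEmpty_or_nonempty V with hV | ⟨⟨z⟩⟩
  · have h := two_mul_energy G p f
    simp [pairEnergy] at h
    simp [laplacianNorm, h]
  have h1 : pairEnergy (adjWeight G) p f =
      -2 * ∑ x, (f x - f z) * pLaplacian G p f x := by
    -- Weighting the flow by the sum of both endpoint values, taken relative to `z`, makes the
    -- summand antisymmetric; this summand is exactly the sum of the two terms to be compared.
    have h2 := sum_sum_antisymm_eq_zero (V := V)
      (F := fun x y => adjWeight G x y * signedPow p (f y - f x) * ((f x - f z) + (f y - f z)))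
      (fun x y => by rw [adjWeight_comm, signedPow_sub_comm hp]; ring)
    have h3 : pairEnergy (adjWeight G) p f + 2 * ∑ x, (f x - f z) * pLaplacian G p f x =
        ∑ x, ∑ y, adjWeight G x y * signedPow p (f y - f x) * ((f x - f z) + (f y - f z)) := by
      unfold pairEnergy pLaplacian
      simp_rw [Finset.mul_sum, ← Finset.sum_add_distrib]
      refine Finset.sum_congr rfl fun x _ => Finset.sum_congr rfl fun y _ => ?_
      rw [abs_sub_comm, ← signedPow_mul_self hp]; ring
    linarith
  have h4 : -∑ x, (f x - f z) * pLaplacian G p f x ≤ B * laplacianNorm G p f := by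
    unfold laplacianNorm
    rw [← Finset.sum_neg_distrib, Finset.mul_sum]
    refine Finset.sum_le_sum fun x _ => ?_
    refine (neg_le_abs _).trans ?_
    rw [abs_mul]
    exact mul_le_mul_of_nonneg_right (hB _ _) (abs_nonneg _)
  have := two_mul_energy G p f
  linarith

/-- The flux through a level is at most the `ℓ¹`-norm of the `p`-Laplacian. -/
theorem cut_flux_le {p : ℝ} (hp : 1 < p) (f : V → ℝ) (t : ℝ) :
    ∑ x, ∑ y, (if f x < t ∧ t ≤ f y then adjWeight G x y * |f y - f x| ^ (p - 1) else 0) ≤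
      laplacianNorm G p f := by
  classical
  -- Flows inside `{f < t}` cancel in pairs, so the `p`-Laplacian summed over this set is the flux
  -- across the level `t`.
  have h2 := sum_sum_antisymm_eq_zero (V := V)
    (F := fun x y => if f x < t ∧ f y < t then adjWeight G x y * signedPow p (f y - f x) else 0)
    (fun x y => by
      rw [adjWeight_comm, signedPow_sub_comm hp]
      by_cases h1 : f x < t <;> by_cases h2 : f y < t <;> simp [h1, h2])
  have h3 : ∑ x, (if f x < t then pLaplacian G p f x else 0) =
      ∑ x, ∑ y, (if f x < t ∧ t ≤ f y then adjWeight G x y * |f y - f x| ^ (p - 1) else 0) := by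
    refine Eq.trans ?_ (add_zero _)
    refine Eq.trans ?_ (congrArg _ h2)
    rw [← Finset.sum_add_distrib]
    refine Finset.sum_congr rfl fun x _ => ?_
    rw [← Finset.sum_add_distrib]
    by_cases hx : f x < t
    · rw [if_pos hx, pLaplacian]
      refine Finset.sum_congr rfl fun y _ => ?_
      by_cases hy : f y < t
      · simp [hx, hy, not_le.2 hy]
      · have : 0 ≤ f y - f x := by linarith
        simp [hx, hy, not_lt.1 hy, signedPow_of_nonneg this, abs_of_nonneg this]
    · simp [hx]
  rw [← h3]
  refine Finset.sum_le_sum fun x _ => ?_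
  split_ifs
  · exact le_abs_self _
  · exact abs_nonneg _

/-- The edge is one nonnegative term of the flux through the level of its upper endpoint. -/
theorem abs_sub_le_of_adj {p : ℝ} (hp : 1 < p) (f : V → ℝ) {x y : V} (h : G.Adj x y) :
    |f x - f y| ≤ laplacianNorm G p f ^ (1 / (p - 1)) := by
  classical
  wlog hxy : f x < f y generalizing x y
  · rcases (not_lt.1 hxy).eq_or_lt with h' | h'
    · rw [h', sub_self, abs_zero]
      exact Real.rpow_nonneg (laplacianNorm_nonneg G p f) _
    · rw [abs_sub_comm]; exact this h.symm h'
  have hnn : ∀ a b, 0 ≤ (if f a < f y ∧ f y ≤ f b then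
      adjWeight G a b * |f b - f a| ^ (p - 1) else 0) := fun a b => by
    split_ifs
    · exact mul_nonneg (adjWeight_nonneg _ _ _) (Real.rpow_nonneg (abs_nonneg _) _)
    · exact le_rfl
  have h1 : |f y - f x| ^ (p - 1) ≤ laplacianNorm G p f := by
    refine le_trans ?_ (cut_flux_le hp f (f y))
    refine le_trans ?_ (Finset.single_le_sum
      (f := fun x => ∑ b, (if f x < f y ∧ f y ≤ f b then
        adjWeight G x b * |f b - f x| ^ (p - 1) else 0))
      (fun a _ => Finset.sum_nonneg fun b _ => hnn a b) (Finset.mem_univ x))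
    refine le_trans ?_ (Finset.single_le_sum (fun b _ => hnn x b) (Finset.mem_univ y))
    simp [hxy, adjWeight_of_adj G h]
  rw [abs_sub_comm]
  have h2 := Real.rpow_le_rpow (Real.rpow_nonneg (abs_nonneg _) _) h1
    (by apply one_div_nonneg.2; linarith : 0 ≤ 1 / (p - 1))
  rwa [← Real.rpow_mul (abs_nonneg _), mul_one_div_cancel (by linarith), Real.rpow_one] at h2

theorem abs_sub_le_card_mul (hG : G.Connected) (f : V → ℝ) {b : ℝ} (hb : 0 ≤ b)
    (h : ∀ x y, G.Adj x y → |f x - f y| ≤ b) (u v : V) : |f u - f v| ≤ Fintype.card V * b := by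
  classical
  have key : ∀ {u v : V} (q : G.Walk u v), |f u - f v| ≤ q.length * b := by
    intro u v q
    induction q with
    | nil => simp
    | cons hadj q ih =>
      rename_i a c d
      have := abs_sub_le (f a) (f c) (f d)
      have := h _ _ hadj
      simp only [SimpleGraph.Walk.length_cons, Nat.cast_add, Nat.cast_one]
      linarith
  obtain ⟨q⟩ := hG.preconnected u v
  have h1 := key (q.toPath : G.Walk u v)
  have h2 : ((q.toPath : G.Walk u v).length : ℝ) ≤ Fintype.card V := by
    exact_mod_cast (q.toPath.2.length_lt).le
  exact h1.trans (mul_le_mul_of_nonneg_right h2 hb)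

/-- If every level carries flux at most `Λ`, then the sum of `|∇f| ^ ((p - 1) / 2)` over the edges
is at most `2 n √Λ`, whatever the number of edges. -/
theorem sum_rpow_half_le {p : ℝ} (hp : 1 < p) (f : V → ℝ) (hΛ : 0 < laplacianNorm G p f) :
    ∑ x, ∑ y, (if f x < f y then adjWeight G x y * |f y - f x| ^ ((p - 1) / 2) else 0) ≤
      2 * Fintype.card V * laplacianNorm G p f ^ (1 / 2 : ℝ) := by
  classical
  set Λ := laplacianNorm G p f with hΛdef
  set s := (p - 1) / 2 with hs
  have hspos : 0 < s := by rw [hs]; linarith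
  set r := Λ ^ (1 / 2 : ℝ) with hr
  have hrpos : 0 < r := Real.rpow_pos_of_pos hΛ _
  have hrr : r * r = Λ := by rw [hr, ← Real.rpow_add hΛ]; norm_num
  -- `k x y` counts the vertices spanned by the edge, the upper endpoint included. An edge is short
  -- if `|∇f|^s * k ≤ r`; since `r * r = Λ`, short and long edges each contribute at most `n r`.
  let k : V → V → ℝ := fun x y => ((Finset.univ.filter fun z => f x < f z ∧ f z ≤ f y).card : ℝ)
  have hkdef : ∀ x y, k x y = ((Finset.univ.filter fun z => f x < f z ∧ f z ≤ f y).card : ℝ) :=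
    fun x y => rfl
  have hk1 : ∀ x y, f x < f y → 1 ≤ k x y := by
    intro x y h
    rw [hkdef]
    have : 0 < (Finset.univ.filter fun z => f x < f z ∧ f z ≤ f y).card :=
      Finset.card_pos.2 ⟨y, by simp [h]⟩
    exact_mod_cast this
  have hl : ∀ x y, 0 ≤ |f y - f x| ^ s := fun x y => Real.rpow_nonneg (abs_nonneg _) _
  have hA := adjWeight_nonneg G
  -- edges that are short compared with the number of vertices they span
  have hshort : ∀ x, ∑ y, (if f x < f y ∧ |f y - f x| ^ s * k x y ≤ r then
      adjWeight G x y * |f y - f x| ^ s else 0) ≤ r := by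
    intro x
    rw [← Finset.sum_filter]
    set Y := Finset.univ.filter fun y => f x < f y ∧ |f y - f x| ^ s * k x y ≤ r with hY
    rcases Y.eq_empty_or_nonempty with h0 | h0
    · rw [h0]; simpa using hrpos.le
    -- All short edges going up from `x` end within the span of the longest of them, so their number
    -- is at most `k x ym`, and shortness of that single edge bounds the whole sum.
    obtain ⟨ym, hym, hmax⟩ := Y.exists_max_image f h0
    have hym' := (Finset.mem_filter.1 hym).2
    have hle : ∀ y ∈ Y, adjWeight G x y * |f y - f x| ^ s ≤ |f ym - f x| ^ s := by
      intro y hy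
      have hy' := (Finset.mem_filter.1 hy).2
      have h1 : |f y - f x| ^ s ≤ |f ym - f x| ^ s := by
        refine Real.rpow_le_rpow (abs_nonneg _) ?_ hspos.le
        rw [abs_of_pos (by linarith), abs_of_pos (by linarith)]
        linarith [hmax y hy]
      have := adjWeight_le_one G x y
      nlinarith [hl x y, hA x y]
    have hcard : (Y.card : ℝ) ≤ k x ym := by
      rw [hkdef]
      have : Y ⊆ Finset.univ.filter fun z => f x < f z ∧ f z ≤ f ym := by
        intro y hy
        have hy' := (Finset.mem_filter.1 hy).2
        simpa using ⟨hy'.1, hmax y hy⟩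
      exact_mod_cast Finset.card_le_card this
    calc _ ≤ Y.card • |f ym - f x| ^ s := Finset.sum_le_card_nsmul _ _ _ hle
      _ = |f ym - f x| ^ s * Y.card := by rw [nsmul_eq_mul, mul_comm]
      _ ≤ |f ym - f x| ^ s * k x ym := mul_le_mul_of_nonneg_left hcard (hl _ _)
      _ ≤ r := hym'.2
  -- long edges are charged to the vertices that they span
  have hlong : ∀ x y, (if f x < f y ∧ ¬ |f y - f x| ^ s * k x y ≤ r then
      adjWeight G x y * |f y - f x| ^ s else 0) ≤
      ∑ z, (if f x < f z ∧ f z ≤ f y then adjWeight G x y * |f y - f x| ^ (p - 1) else 0) / r := by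
    intro x y
    have hR : ∑ z, (if f x < f z ∧ f z ≤ f y then
        adjWeight G x y * |f y - f x| ^ (p - 1) else 0) / r =
        k x y * (adjWeight G x y * |f y - f x| ^ (p - 1) / r) := by
      rw [← Finset.sum_div, ← Finset.sum_filter, Finset.sum_const, nsmul_eq_mul]; ring
    rw [hR]
    have hnn : 0 ≤ adjWeight G x y * |f y - f x| ^ (p - 1) / r :=
      div_nonneg (mul_nonneg (hA _ _) (Real.rpow_nonneg (abs_nonneg _) _)) hrpos.le
    split_ifs with h
    · have hpow : |f y - f x| ^ (p - 1) = |f y - f x| ^ s * |f y - f x| ^ s := by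
        rw [← Real.rpow_add (abs_pos.2 (by linarith [h.1]))]; congr 1; rw [hs]; ring
      have h1 : 1 ≤ |f y - f x| ^ s * k x y / r := by
        rw [le_div_iff₀ hrpos]; linarith [not_le.1 h.2]
      have h2 := mul_le_mul_of_nonneg_left h1 (mul_nonneg (hA x y) (hl x y))
      rw [hpow]
      calc _ = adjWeight G x y * |f y - f x| ^ s * 1 := by ring
        _ ≤ _ := h2
        _ = _ := by ring
    · exact mul_nonneg (by rw [hkdef]; positivity) hnn
  have hsplit : ∀ x y, (if f x < f y then adjWeight G x y * |f y - f x| ^ s else 0) =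
      (if f x < f y ∧ |f y - f x| ^ s * k x y ≤ r then adjWeight G x y * |f y - f x| ^ s else 0) +
      (if f x < f y ∧ ¬ |f y - f x| ^ s * k x y ≤ r then
        adjWeight G x y * |f y - f x| ^ s else 0) := by
    intro x y
    by_cases h1 : f x < f y <;> by_cases h2 : |f y - f x| ^ s * k x y ≤ r <;> simp [h1, h2]
  simp_rw [hsplit, Finset.sum_add_distrib]
  have hS : ∑ x, ∑ y, (if f x < f y ∧ |f y - f x| ^ s * k x y ≤ r then
      adjWeight G x y * |f y - f x| ^ s else 0) ≤ Fintype.card V * r := by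
    refine (Finset.sum_le_sum fun x _ => hshort x).trans ?_
    simp
  have hLg : ∑ x, ∑ y, (if f x < f y ∧ ¬ |f y - f x| ^ s * k x y ≤ r then
      adjWeight G x y * |f y - f x| ^ s else 0) ≤ Fintype.card V * r := by
    refine (Finset.sum_le_sum fun x _ => Finset.sum_le_sum fun y _ => hlong x y).trans ?_
    -- After the exchange of summation, `z` is charged the flux through its own level divided by
    -- `r`, which is at most `Λ / r = r`.
    have hsw : ∑ x, ∑ y, ∑ z, (if f x < f z ∧ f z ≤ f y then
        adjWeight G x y * |f y - f x| ^ (p - 1) else 0) / r =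
        ∑ z, (∑ x, ∑ y, (if f x < f z ∧ f z ≤ f y then
        adjWeight G x y * |f y - f x| ^ (p - 1) else 0)) / r := by
      simp_rw [Finset.sum_div]
      exact (Finset.sum_congr rfl fun x _ => Finset.sum_comm).trans Finset.sum_comm
    rw [hsw]
    have : ∀ z ∈ (Finset.univ : Finset V), (∑ x, ∑ y, (if f x < f z ∧ f z ≤ f y then
        adjWeight G x y * |f y - f x| ^ (p - 1) else 0)) / r ≤ r := by
      intro z _
      rw [div_le_iff₀ hrpos, hrr]
      exact cut_flux_le hp f (f z)
    refine (Finset.sum_le_sum this).trans ?_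
    simp
  calc _ ≤ Fintype.card V * r + Fintype.card V * r := add_le_add hS hLg
    _ = _ := by ring

end Graph

/-! ### One-step decay of the energy, averaged over the updated vertex -/

section OneStep

variable {V : Type*} [Fintype V] {G : SimpleGraph V}

theorem sum_adjWeight_eq (v : V) : ∑ w, adjWeight G v w =
    open Classical in (G.degree v : ℝ) := by
  classical
  have := sum_neighborFinset_eq G (fun _ => 1) v
  simp only [mul_one, Finset.sum_const, nsmul_eq_mul, SimpleGraph.card_neighborFinset_eq_degree]
    at this
  rw [← this]

theorem sum_sum_adjWeight (hn : 0 < Fintype.card V) :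
    ∑ v, ∑ w, adjWeight G v w = Fintype.card V * avgDegree G := by
  classical
  have hn' : (Fintype.card V : ℝ) ≠ 0 := by exact_mod_cast hn.ne'
  unfold avgDegree
  rw [mul_div_cancel₀ _ hn']
  exact Finset.sum_congr rfl fun v _ => sum_adjWeight_eq v

theorem exists_adj (hG : G.Connected) (hn : 2 ≤ Fintype.card V) (v : V) : ∃ w, G.Adj v w := by
  classical
  have : Nontrivial V := Fintype.one_lt_card_iff_nontrivial.1 (by omega)
  obtain ⟨w, hw⟩ := exists_ne v
  obtain ⟨q⟩ := hG.preconnected v w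
  cases q with
  | nil => exact absurd rfl hw
  | cons h _ => exact ⟨_, h⟩

theorem one_le_avgDegree (hG : G.Connected) (hn : 2 ≤ Fintype.card V) : 1 ≤ avgDegree G := by
  have hn' : (0 : ℝ) < Fintype.card V := by exact_mod_cast (by omega : 0 < Fintype.card V)
  have h := sum_sum_adjWeight (G := G) (by omega)
  have h1 : (Fintype.card V : ℝ) ≤ ∑ v, ∑ w, adjWeight G v w := by
    have : ∀ v ∈ (Finset.univ : Finset V), (1 : ℝ) ≤ ∑ w, adjWeight G v w := by
      intro v _
      obtain ⟨w, hw⟩ := exists_adj hG hn v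
      rw [← adjWeight_of_adj G hw]
      exact Finset.single_le_sum (fun u _ => adjWeight_nonneg G v u) (Finset.mem_univ w)
    simpa using Finset.sum_le_sum this
  rw [h] at h1
  by_contra! hlt
  nlinarith

theorem avgDegree_le_card (hn : 0 < Fintype.card V) : avgDegree G ≤ Fintype.card V := by
  have hn' : (0 : ℝ) < Fintype.card V := by exact_mod_cast hn
  have h := sum_sum_adjWeight (G := G) hn
  have h1 : ∑ v, ∑ w, adjWeight G v w ≤ Fintype.card V * Fintype.card V := by
    have := Finset.sum_le_sum fun v (_ : v ∈ (Finset.univ : Finset V)) =>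
      Finset.sum_le_sum fun w (_ : w ∈ (Finset.univ : Finset V)) => adjWeight_le_one G v w
    simpa using this
  rw [h] at h1
  exact le_of_mul_le_mul_left h1 hn'

/-- Sum of the lower bounds of `le_energy_sub_energy_updateAt` over all vertices. -/
theorem le_sum_energy_sub {p : ℝ} (hp : 1 < p) (hG : G.Connected) (hn : 2 ≤ Fintype.card V)
    (f : V → ℝ) {τ : ℝ} (hτ : 0 ≤ τ) (R : ℝ → ℝ)
    (hR₁ : ∀ a, signedPow p a - signedPow p (a - τ) ≤ R a)
    (hR₂ : ∀ a, signedPow p (a + τ) - signedPow p a ≤ R a) :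
    p * τ * (laplacianNorm G p f - ∑ v, ∑ w, adjWeight G v w * R (f w - f v)) ≤
      ∑ v, (energy G p f - energy G p (updateAt G p f v)) := by
  unfold laplacianNorm
  rw [← Finset.sum_sub_distrib, Finset.mul_sum]
  exact Finset.sum_le_sum fun v _ =>
    le_energy_sub_energy_updateAt hp f (exists_adj hG hn v) hτ R hR₁ hR₂

/-- A path meets at most `n` vertices, so the edge bound controls the oscillation. This turns a
release of order `τ Λ` into a fraction of the energy. -/
theorem energy_le_of_connected {p : ℝ} (hp : 1 < p) (hG : G.Connected) (f : V → ℝ) :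
    energy G p f ≤ Fintype.card V * laplacianNorm G p f ^ (1 / (p - 1)) * laplacianNorm G p f :=
  energy_le_mul_laplacianNorm hp f <| abs_sub_le_card_mul hG f
    (Real.rpow_nonneg (laplacianNorm_nonneg G p f) _) fun _ _ h => abs_sub_le_of_adj hp f h

/-- The scale `K` with `rateF n p D = 1 / (n² K)`. -/
noncomputable def rateScale (p n D : ℝ) : ℝ :=
  if p ≤ 2 then (n * D) ^ (1 / (p - 1)) else n * D ^ thetaExp p

theorem betaExp_of_le_two {p : ℝ} (hp : 1 < p) (hp2 : p ≤ 2) : betaExp p = 2 * p / (p - 1) := by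
  refine max_eq_left ?_
  rw [le_div_iff₀ (by linarith)]; linarith

theorem betaExp_of_two_le {p : ℝ} (hp2 : 2 < p) : betaExp p = 3 + thetaExp p := by
  unfold betaExp thetaExp
  rw [if_neg (not_le.2 hp2)]
  have h : 2 * p / (p - 1) = 3 + (3 - p) / (p - 1) := by
    have : p - 1 ≠ 0 := by linarith
    field_simp; ring
  rw [h]
  have h3 : ((3 : ℝ)) = 3 + 0 := by ring
  conv_lhs => rw [show max (3 + (3 - p) / (p - 1)) 3 = max (3 + (3 - p) / (p - 1)) (3 + 0) by simp]
  rw [max_add_add_left]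

theorem thetaExp_nonneg {p : ℝ} (hp : 1 < p) : 0 ≤ thetaExp p := by
  unfold thetaExp
  split_ifs
  · exact one_div_nonneg.2 (by linarith)
  · exact le_max_right _ _

/-- In this form one factor `n` comes from the random choice of the vertex, the other from the
oscillation bound, and `rateScale` from the trial displacement. -/
theorem rateF_eq {p : ℝ} (hp : 1 < p) {n : ℕ} (hn : 0 < n) {D : ℝ} (hD : 0 < D) :
    rateF n p D = 1 / ((n : ℝ) ^ 2 * rateScale p n D) := by
  have hn' : (0 : ℝ) < n := by exact_mod_cast hn
  have e : rateF n p D = (n : ℝ) ^ (thetaExp p - betaExp p) * D ^ (-thetaExp p) := by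
    unfold rateF
    rw [Real.div_rpow hD.le hn'.le, Real.rpow_neg hn'.le (thetaExp p), div_inv_eq_mul,
      sub_eq_neg_add, Real.rpow_add hn']
    ring
  rw [e, one_div, mul_inv, ← Real.rpow_natCast, ← Real.rpow_neg hn'.le, rateScale]
  split_ifs with h
  · rw [betaExp_of_le_two hp h, thetaExp, if_pos h, Real.mul_rpow hn'.le hD.le, mul_inv,
      ← mul_assoc, ← Real.rpow_neg hn'.le, ← Real.rpow_neg hD.le, ← Real.rpow_add hn']
    congr 2
    have : p - 1 ≠ 0 := by linarith
    field_simp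
    push_cast
    ring
  · rw [betaExp_of_two_le (not_le.1 h), mul_inv, ← mul_assoc, ← Real.rpow_neg hD.le]
    congr 1
    rw [← Real.rpow_neg_one (n : ℝ), ← Real.rpow_add hn']
    congr 1
    push_cast
    ring

theorem rateScale_pos (p : ℝ) {n D : ℝ} (hn : 0 < n) (hD : 0 < D) : 0 < rateScale p n D := by
  unfold rateScale
  split_ifs
  · exact Real.rpow_pos_of_pos (mul_pos hn hD) _
  · exact mul_pos hn (Real.rpow_pos_of_pos hD _)

theorem one_le_rateScale {p : ℝ} (hp : 1 < p) {n D : ℝ} (hn : 1 ≤ n) (hD : 1 ≤ D) :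
    1 ≤ rateScale p n D := by
  unfold rateScale
  split_ifs
  · exact Real.one_le_rpow (by nlinarith) (one_div_nonneg.2 (by linarith))
  · nlinarith [Real.one_le_rpow hD (thetaExp_nonneg hp)]

theorem sum_energy_sub_ge_of_le_two {p : ℝ} (hp : 1 < p) (hp2 : p ≤ 2) (hG : G.Connected)
    (hn : 2 ≤ Fintype.card V) (f : V → ℝ) :
    p / 2 * (1 / 4) ^ (1 / (p - 1)) * energy G p f /
        (Fintype.card V * rateScale p (Fintype.card V) (avgDegree G)) ≤
      ∑ v, (energy G p f - energy G p (updateAt G p f v)) := by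
  have hn' : (0 : ℝ) < Fintype.card V := by exact_mod_cast (by omega : 0 < Fintype.card V)
  have hD := one_le_avgDegree hG hn
  have hDn := sum_sum_adjWeight (G := G) (by omega)
  have hE := energy_le_of_connected hp hG f
  set n : ℝ := ((Fintype.card V : ℕ) : ℝ)
  set D := avgDegree G
  set Λ := laplacianNorm G p f with hΛdef
  have hΛ : 0 ≤ Λ := laplacianNorm_nonneg G p f
  have hq : 0 ≤ 1 / (p - 1) := one_div_nonneg.2 (by linarith)
  have hnD : 0 < n * D := by nlinarith
  have hK := rateScale_pos p hn' (by linarith : 0 < D)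
  have hKe : rateScale p n D = (n * D) ^ (1 / (p - 1)) := if_pos hp2
  set K := rateScale p n D
  -- With this choice the total remainder `n D * 2 τ^(p-1)` is exactly `Λ / 2`.
  set τ := (Λ * (1 / 4) / (n * D)) ^ (1 / (p - 1)) with hτ
  have hτ0 : 0 ≤ τ := Real.rpow_nonneg (by positivity) _
  have hτp : τ ^ (p - 1) = Λ * (1 / 4) / (n * D) := by
    rw [hτ, ← Real.rpow_mul (by positivity), one_div_mul_cancel (by linarith), Real.rpow_one]
  have hτe : τ = Λ ^ (1 / (p - 1)) * (1 / 4) ^ (1 / (p - 1)) / K := by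
    rw [hτ, hKe, Real.div_rpow (by positivity) hnD.le, Real.mul_rpow hΛ (by norm_num)]
  have h := le_sum_energy_sub hp hG hn f hτ0 (fun _ => 2 * τ ^ (p - 1))
    (fun a => by
      have := signedPow_sub_le_of_le_two hp hp2 (by linarith : a - τ ≤ a)
      simpa using this)
    (fun a => by
      have := signedPow_sub_le_of_le_two hp hp2 (by linarith : a ≤ a + τ)
      simpa using this)
  simp_rw [← Finset.sum_mul] at h
  rw [hDn, hτp] at h
  refine le_trans ?_ h
  have e1 : n * D * (2 * (Λ * (1 / 4) / (n * D))) = Λ / 2 := by field_simp; ring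
  rw [e1, div_le_iff₀ (by positivity), hτe]
  have h4 : 0 ≤ p / 2 * (1 / 4 : ℝ) ^ (1 / (p - 1)) :=
    mul_nonneg (by linarith) (Real.rpow_nonneg (by norm_num) _)
  calc _ ≤ p / 2 * (1 / 4 : ℝ) ^ (1 / (p - 1)) * (n * Λ ^ (1 / (p - 1)) * Λ) :=
        mul_le_mul_of_nonneg_left hE h4
    _ = _ := by field_simp; ring

/-- Needed so that the part `n D τ^(p-1)` of the remainder, with `τ` of order `Λ^(1/(p-1)) / K`,
stays below a multiple of `Λ`. -/
theorem card_mul_le_rateScale_rpow {p n D : ℝ} (hp2 : 2 < p) (hD : 1 ≤ D) (hDn : D ≤ n) :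
    n * D ≤ rateScale p n D ^ (p - 1) := by
  have hD0 : 0 < D := by linarith
  have hn0 : 0 < n := by linarith
  rw [rateScale, if_neg (not_le.2 hp2), Real.mul_rpow hn0.le (Real.rpow_nonneg hD0.le _),
    ← Real.rpow_mul hD0.le, thetaExp, if_neg (not_le.2 hp2)]
  have e : n ^ (p - 1) = n * n ^ (p - 2) := by
    rw [← Real.rpow_one_add' hn0.le (by linarith)]; ring_nf
  rw [e, mul_assoc]
  refine mul_le_mul_of_nonneg_left ?_ hn0.le
  rcases le_total p 3 with h3 | h3
  · rw [max_eq_left (div_nonneg (by linarith) (by linarith)), div_mul_cancel₀ _ (by linarith)]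
    calc D = D ^ (p - 2) * D ^ (3 - p) := by
          rw [← Real.rpow_add hD0]; norm_num
      _ ≤ _ := mul_le_mul_of_nonneg_right (Real.rpow_le_rpow hD0.le hDn (by linarith))
          (Real.rpow_nonneg hD0.le _)
  · rw [max_eq_right (div_nonpos_of_nonpos_of_nonneg (by linarith) (by linarith)), zero_mul,
      Real.rpow_zero, mul_one]
    calc D ≤ n := hDn
      _ = n ^ (1 : ℝ) := (Real.rpow_one n).symm
      _ ≤ _ := Real.rpow_le_rpow_of_exponent_le (by linarith) (by linarith)

/-- The total of `|∇f| ^ (p - 2)` over all edges is controlled by the flux. -/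
theorem sum_abs_rpow_sub_two_le {p : ℝ} (hp2 : 2 < p) (hG : G.Connected)
    (hn : 2 ≤ Fintype.card V) (f : V → ℝ) (hΛ : 0 < laplacianNorm G p f) :
    ∑ x, ∑ y, adjWeight G x y * |f y - f x| ^ (p - 2) ≤
      6 * rateScale p (Fintype.card V) (avgDegree G) *
        laplacianNorm G p f ^ ((p - 2) / (p - 1)) := by
  classical
  have hp : 1 < p := by linarith
  have hn' : (0 : ℝ) < Fintype.card V := by exact_mod_cast (by omega : 0 < Fintype.card V)
  have hD := one_le_avgDegree hG hn
  have hDn := sum_sum_adjWeight (G := G) (by omega)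
  have hband := sum_rpow_half_le hp f hΛ
  have hedge : ∀ x y, G.Adj x y → |f y - f x| ≤ laplacianNorm G p f ^ (1 / (p - 1)) :=
    fun x y h => abs_sub_le_of_adj hp f h.symm
  set n : ℝ := ((Fintype.card V : ℕ) : ℝ)
  set D := avgDegree G
  set Λ := laplacianNorm G p f with hΛdef
  have hD0 : 0 < D := by linarith
  have hsym : ∑ x, ∑ y, adjWeight G x y * |f y - f x| ^ (p - 2) =
      2 * ∑ x, ∑ y, (if f x < f y then adjWeight G x y * |f y - f x| ^ (p - 2) else 0) := by
    have h1 : ∀ x y, adjWeight G x y * |f y - f x| ^ (p - 2) =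
        (if f x < f y then adjWeight G x y * |f y - f x| ^ (p - 2) else 0) +
        (if f y < f x then adjWeight G y x * |f x - f y| ^ (p - 2) else 0) := by
      intro x y
      rcases lt_trichotomy (f x) (f y) with h | h | h
      · simp [h, not_lt.2 h.le]
      · rw [if_neg h.not_lt, if_neg h.not_gt, h, sub_self, abs_zero,
          Real.zero_rpow (by linarith : p - 2 ≠ 0), mul_zero, add_zero]
      · rw [adjWeight_comm G y x, abs_sub_comm (f x) (f y), if_neg (not_lt.2 h.le), if_pos h,
          zero_add]
    rw [Finset.sum_congr rfl fun x _ => Finset.sum_congr rfl fun y _ => h1 x y]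
    simp_rw [Finset.sum_add_distrib]
    rw [Finset.sum_comm (f := fun x y =>
      (if f y < f x then adjWeight G y x * |f x - f y| ^ (p - 2) else 0))]
    ring
  have hθ : rateScale p n D = n * D ^ thetaExp p := if_neg (not_le.2 hp2)
  suffices h : ∑ x, ∑ y, (if f x < f y then adjWeight G x y * |f y - f x| ^ (p - 2) else 0) ≤
      3 * (n * D ^ thetaExp p) * Λ ^ ((p - 2) / (p - 1)) by
    rw [hsym, hθ]; linarith
  have hΛe : 0 < Λ ^ ((p - 2) / (p - 1)) := Real.rpow_pos_of_pos hΛ _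
  have hpm : p - 1 ≠ 0 := by linarith
  rcases le_total p 3 with h3 | h3
  · have hθ' : thetaExp p = (3 - p) / (p - 1) := by
      rw [thetaExp, if_neg (not_le.2 hp2),
        max_eq_left (div_nonneg (by linarith) (by linarith))]
    set θ := thetaExp p with hθdef
    have hθ0 : 0 ≤ θ := by rw [hθ']; exact div_nonneg (by linarith) (by linarith)
    have hθ1 : 1 - θ = 2 * ((p - 2) / (p - 1)) := by rw [hθ']; field_simp; ring
    have hθ2 : 0 ≤ 1 - θ := by
      rw [hθ1]; exact mul_nonneg two_pos.le (div_nonneg (by linarith) (by linarith))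
    -- This constant balances the contribution `Z * n D` of exponent `0` with the bound `2 n √Λ` for
    -- exponent `(p - 1) / 2`.
    set Z := Λ ^ (1 / 2 : ℝ) / D with hZ
    have hZ0 : 0 < Z := div_pos (Real.rpow_pos_of_pos hΛ _) hD0
    have hZθ : 0 < Z ^ θ := Real.rpow_pos_of_pos hZ0 _
    -- Weighted AM-GM: `p - 2` is the interpolation of the exponents `0` and `(p - 1) / 2` with
    -- weights `θ` and `1 - θ`.
    have hpt : ∀ l : ℝ, 0 ≤ l →
        l ^ (p - 2) ≤ (θ * Z + (1 - θ) * l ^ ((p - 1) / 2)) / Z ^ θ := by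
      intro l hl
      have h := Real.geom_mean_le_arith_mean2_weighted hθ0 hθ2 hZ0.le
        (Real.rpow_nonneg hl ((p - 1) / 2)) (by ring)
      rw [← Real.rpow_mul hl, hθ1, show (p - 1) / 2 * (2 * ((p - 2) / (p - 1))) = p - 2 by
        field_simp, ← hθ1] at h
      rw [le_div_iff₀ hZθ]; linarith
    have hsum : ∑ x, ∑ y, (if f x < f y then adjWeight G x y * |f y - f x| ^ (p - 2) else 0) ≤
        (Z * (n * D) + 2 * n * Λ ^ (1 / 2 : ℝ)) / Z ^ θ := by
      rw [← hDn]
      refine le_trans (b := (Z * (∑ v, ∑ w, adjWeight G v w) + ∑ x, ∑ y,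
        (if f x < f y then adjWeight G x y * |f y - f x| ^ ((p - 1) / 2) else 0)) / Z ^ θ) ?_
        (by gcongr)
      simp_rw [Finset.mul_sum, ← Finset.sum_add_distrib, Finset.sum_div]
      refine Finset.sum_le_sum fun x _ => Finset.sum_le_sum fun y _ => ?_
      have hA := adjWeight_nonneg G x y
      split_ifs
      · have h1 := mul_le_mul_of_nonneg_left (hpt _ (abs_nonneg (f y - f x))) hA
        refine h1.trans ?_
        rw [← mul_div_assoc]
        refine div_le_div_of_nonneg_right ?_ hZθ.le
        have hl := Real.rpow_nonneg (abs_nonneg (f y - f x)) ((p - 1) / 2)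
        have h5 : θ * Z + (1 - θ) * |f y - f x| ^ ((p - 1) / 2) ≤
            Z + |f y - f x| ^ ((p - 1) / 2) := by
          have : 0 ≤ (1 - θ) * Z := mul_nonneg hθ2 hZ0.le
          have : 0 ≤ θ * |f y - f x| ^ ((p - 1) / 2) := mul_nonneg hθ0 hl
          linarith
        have := mul_le_mul_of_nonneg_left h5 hA
        linarith
      · have : 0 ≤ Z * adjWeight G x y := mul_nonneg hZ0.le hA
        rw [add_zero]; exact div_nonneg this hZθ.le
    refine hsum.trans (le_of_eq ?_)
    have e1 : Z * (n * D) + 2 * n * Λ ^ (1 / 2 : ℝ) = 3 * n * Λ ^ (1 / 2 : ℝ) := by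
      rw [hZ]; field_simp; ring
    have e2 : Z ^ θ = Λ ^ (1 / 2 * θ) / D ^ θ := by
      rw [hZ, Real.div_rpow (Real.rpow_nonneg hΛ.le _) hD0.le, ← Real.rpow_mul hΛ.le]
    have e3 : Λ ^ (1 / 2 : ℝ) = Λ ^ ((p - 2) / (p - 1)) * Λ ^ (1 / 2 * θ) := by
      rw [← Real.rpow_add hΛ]; congr 1; linarith
    have := Real.rpow_pos_of_pos hΛ (1 / 2 * θ)
    have := Real.rpow_pos_of_pos hD0 θ
    rw [e1, e2, e3]
    field_simp
  · have hθ' : thetaExp p = 0 := by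
      rw [thetaExp, if_neg (not_le.2 hp2),
        max_eq_right (div_nonpos_of_nonpos_of_nonneg (by linarith) (by linarith))]
    rw [hθ', Real.rpow_zero, mul_one]
    -- For `p ≥ 3` the exponent `p - 2` is at least `(p - 1) / 2`; the excess `(p - 3) / 2` is paid
    -- for with the maximal edge difference.
    set M := Λ ^ (1 / (p - 1)) with hM
    have hpt : ∀ x y, (if f x < f y then adjWeight G x y * |f y - f x| ^ (p - 2) else 0) ≤
        M ^ ((p - 3) / 2) *
          (if f x < f y then adjWeight G x y * |f y - f x| ^ ((p - 1) / 2) else 0) := by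
      intro x y
      split_ifs with hlt
      · by_cases hadj : G.Adj x y
        · have h0 : 0 < |f y - f x| := abs_pos.2 (by linarith)
          rw [adjWeight_of_adj G hadj, one_mul, one_mul,
            show p - 2 = (p - 3) / 2 + (p - 1) / 2 by ring, Real.rpow_add h0]
          exact mul_le_mul_of_nonneg_right
            (Real.rpow_le_rpow h0.le (hedge x y hadj) (by linarith)) (Real.rpow_nonneg h0.le _)
        · simp [adjWeight, hadj]
      · simp
    have hMpos : 0 ≤ M ^ ((p - 3) / 2) := Real.rpow_nonneg (Real.rpow_nonneg hΛ.le _) _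
    calc _ ≤ ∑ x, ∑ y, M ^ ((p - 3) / 2) *
          (if f x < f y then adjWeight G x y * |f y - f x| ^ ((p - 1) / 2) else 0) :=
          Finset.sum_le_sum fun x _ => Finset.sum_le_sum fun y _ => hpt x y
      _ = M ^ ((p - 3) / 2) * ∑ x, ∑ y,
          (if f x < f y then adjWeight G x y * |f y - f x| ^ ((p - 1) / 2) else 0) := by
          simp_rw [Finset.mul_sum]
      _ ≤ M ^ ((p - 3) / 2) * (2 * n * Λ ^ (1 / 2 : ℝ)) := mul_le_mul_of_nonneg_left hband hMpos
      _ = 2 * n * Λ ^ ((p - 2) / (p - 1)) := by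
          rw [hM, ← Real.rpow_mul hΛ.le]
          have : Λ ^ ((p - 2) / (p - 1)) = Λ ^ (1 / (p - 1) * ((p - 3) / 2)) * Λ ^ (1 / 2 : ℝ) := by
            rw [← Real.rpow_add hΛ]; congr 1; field_simp; ring
          rw [this]; ring
      _ ≤ _ := by nlinarith [mul_pos hn' hΛe]

theorem sum_energy_sub_ge_of_two_lt {p : ℝ} (hp2 : 2 < p) (hG : G.Connected)
    (hn : 2 ≤ Fintype.card V) (f : V → ℝ) :
    p / 2 * (1 / (14 * ((p - 1) * 2 ^ (p - 2)))) * energy G p f /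
        (Fintype.card V * rateScale p (Fintype.card V) (avgDegree G)) ≤
      ∑ v, (energy G p f - energy G p (updateAt G p f v)) := by
  have hp : 1 < p := by linarith
  have hn' : (0 : ℝ) < Fintype.card V := by exact_mod_cast (by omega : 0 < Fintype.card V)
  have hD := one_le_avgDegree hG hn
  have hDn := sum_sum_adjWeight (G := G) (by omega)
  have hDle := avgDegree_le_card (G := G) (by omega)
  have hE := energy_le_of_connected hp hG f
  have hK := rateScale_pos p hn' (by linarith : 0 < avgDegree G)
  set C₁ := (p - 1) * (2 : ℝ) ^ (p - 2) with hC₁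
  have hC₁1 : 1 ≤ C₁ := by
    have := Real.one_le_rpow (by norm_num : (1 : ℝ) ≤ 2) (by linarith : 0 ≤ p - 2)
    nlinarith
  -- Without flux the energy vanishes, and the trial displacement `0` suffices.
  rcases (laplacianNorm_nonneg G p f).eq_or_lt with h0 | hΛ
  · rw [← h0, mul_zero] at hE
    have hE0 : energy G p f = 0 := le_antisymm hE (energy_nonneg G p f)
    have h := le_sum_energy_sub hp hG hn f le_rfl (fun _ => 0) (fun a => by simp)
      (fun a => by simp)
    rw [hE0] at h ⊢
    simpa using h
  have hS := sum_abs_rpow_sub_two_le hp2 hG hn f hΛ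
  have hKp := card_mul_le_rateScale_rpow hp2 hD hDle
  set n : ℝ := ((Fintype.card V : ℕ) : ℝ)
  set D := avgDegree G
  set Λ := laplacianNorm G p f with hΛdef
  set K := rateScale p n D
  -- The two remainder terms will be at most `6 ε Λ` and `ε Λ`; times `C₁`, their sum `7 ε Λ` is to
  -- equal `Λ / 2`.
  set ε := 1 / (14 * C₁) with hε
  have hε0 : 0 < ε := by positivity
  have hε1 : ε ≤ 1 := by rw [hε, div_le_one (by positivity)]; linarith
  have hpm : p - 1 ≠ 0 := by linarith
  set τ := ε * Λ ^ (1 / (p - 1)) / K with hτ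
  have hΛq := Real.rpow_pos_of_pos hΛ (1 / (p - 1))
  have hτ0 : 0 ≤ τ := by positivity
  have hR : ∀ a b : ℝ, |b| ≤ |a| + τ → max |b| |a| ^ (p - 2) * τ ≤
      2 ^ (p - 2) * (|a| ^ (p - 2) * τ + τ ^ (p - 1)) := by
    intro a b hb
    have h1 : max |b| |a| ≤ 2 * max |a| τ := by
      refine max_le ?_ ?_
      · linarith [le_max_left |a| τ, le_max_right |a| τ]
      · linarith [le_max_left |a| τ, abs_nonneg a]
    have h2 : max |b| |a| ^ (p - 2) ≤ (2 * max |a| τ) ^ (p - 2) :=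
      Real.rpow_le_rpow ((abs_nonneg b).trans (le_max_left _ _)) h1 (by linarith)
    rw [Real.mul_rpow two_pos.le (hτ0.trans (le_max_right _ _))] at h2
    have h3 : (max |a| τ) ^ (p - 2) * τ ≤ |a| ^ (p - 2) * τ + τ ^ (p - 1) := by
      have e : τ ^ (p - 1) = τ ^ (p - 2) * τ := by
        rw [← Real.rpow_add_one' hτ0 (by linarith)]; ring_nf
      have := mul_nonneg (Real.rpow_nonneg (abs_nonneg a) (p - 2)) hτ0
      have := mul_nonneg (Real.rpow_nonneg hτ0 (p - 2)) hτ0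
      rcases max_choice |a| τ with h | h <;> rw [h, e] <;> linarith
    calc _ ≤ 2 ^ (p - 2) * (max |a| τ) ^ (p - 2) * τ := mul_le_mul_of_nonneg_right h2 hτ0
      _ = 2 ^ (p - 2) * ((max |a| τ) ^ (p - 2) * τ) := by ring
      _ ≤ _ := mul_le_mul_of_nonneg_left h3 (Real.rpow_nonneg two_pos.le _)
  have hp1 : 0 ≤ p - 1 := by linarith
  have h := le_sum_energy_sub hp hG hn f hτ0
    (fun a => C₁ * (|a| ^ (p - 2) * τ + τ ^ (p - 1)))
    (fun a => by
      have h1 := signedPow_sub_le_of_two_le hp2.le (by linarith : a - τ ≤ a)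
      have h2 := mul_le_mul_of_nonneg_left (hR a (a - τ) (by
        have := abs_sub a τ; rwa [abs_of_nonneg hτ0] at this)) hp1
      rw [max_comm, sub_sub_cancel] at h1
      rw [hC₁]; linarith)
    (fun a => by
      have h1 := signedPow_sub_le_of_two_le hp2.le (by linarith : a ≤ a + τ)
      have h2 := mul_le_mul_of_nonneg_left (hR a (a + τ) (by
        have := abs_add_le a τ; rwa [abs_of_nonneg hτ0] at this)) hp1
      rw [add_sub_cancel_left] at h1
      rw [hC₁]; linarith)
  have hsum : ∑ v, ∑ w, adjWeight G v w * (C₁ * (|f w - f v| ^ (p - 2) * τ + τ ^ (p - 1))) =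
      C₁ * ((∑ v, ∑ w, adjWeight G v w * |f w - f v| ^ (p - 2)) * τ + n * D * τ ^ (p - 1)) := by
    rw [← hDn]
    simp_rw [Finset.sum_mul, mul_add, Finset.mul_sum, ← Finset.sum_add_distrib]
    refine Finset.sum_congr rfl fun x _ => Finset.sum_congr rfl fun y _ => ?_
    ring
  rw [hsum] at h
  have hb1 : (∑ v, ∑ w, adjWeight G v w * |f w - f v| ^ (p - 2)) * τ ≤ 6 * ε * Λ := by
    refine (mul_le_mul_of_nonneg_right hS hτ0).trans (le_of_eq ?_)
    have : Λ = Λ ^ ((p - 2) / (p - 1)) * Λ ^ (1 / (p - 1)) := by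
      rw [← Real.rpow_add hΛ, ← add_div, show p - 2 + 1 = p - 1 by ring, div_self hpm,
        Real.rpow_one]
    rw [hτ]
    conv_rhs => rw [this]
    field_simp
  have hb2 : n * D * τ ^ (p - 1) ≤ ε * Λ := by
    have e : τ ^ (p - 1) = ε ^ (p - 1) * Λ / K ^ (p - 1) := by
      rw [hτ, Real.div_rpow (by positivity) hK.le, Real.mul_rpow hε0.le hΛq.le,
        ← Real.rpow_mul hΛ.le, one_div_mul_cancel hpm, Real.rpow_one]
    have hKpos := Real.rpow_pos_of_pos hK (p - 1)
    have h5 : ε ^ (p - 1) ≤ ε := by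
      calc ε ^ (p - 1) ≤ ε ^ (1 : ℝ) :=
            Real.rpow_le_rpow_of_exponent_ge hε0 hε1 (by linarith)
        _ = ε := Real.rpow_one ε
    rw [e, ← mul_div_assoc, div_le_iff₀ hKpos]
    calc n * D * (ε ^ (p - 1) * Λ) ≤ K ^ (p - 1) * (ε * Λ) := by gcongr
      _ = _ := by ring
  have hb3 : C₁ * ((∑ v, ∑ w, adjWeight G v w * |f w - f v| ^ (p - 2)) * τ +
      n * D * τ ^ (p - 1)) ≤ Λ / 2 := by
    calc _ ≤ C₁ * (6 * ε * Λ + ε * Λ) := mul_le_mul_of_nonneg_left (by linarith) (by linarith)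
      _ = _ := by rw [hε]; field_simp; ring
  have h6 : p * τ * (Λ / 2) ≤ ∑ v, (energy G p f - energy G p (updateAt G p f v)) := by
    refine le_trans ?_ h
    exact mul_le_mul_of_nonneg_left (by linarith) (mul_nonneg (by linarith) hτ0)
  refine le_trans ?_ h6
  rw [div_le_iff₀ (by positivity), hτ]
  have h4 : 0 ≤ p / 2 * ε := mul_nonneg (by linarith) hε0.le
  calc _ ≤ p / 2 * ε * (n * Λ ^ (1 / (p - 1)) * Λ) := mul_le_mul_of_nonneg_left hE h4
    _ = _ := by field_simp

/-- The constant of the one-step energy decrease. -/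
noncomputable def rateConst (p : ℝ) : ℝ :=
  if p ≤ 2 then p / 2 * (1 / 4) ^ (1 / (p - 1)) else p / 2 * (1 / (14 * ((p - 1) * 2 ^ (p - 2))))

theorem rateConst_pos {p : ℝ} (hp : 1 < p) : 0 < rateConst p := by
  unfold rateConst
  have : 0 < p - 1 := by linarith
  split_ifs
  · have := Real.rpow_pos_of_pos (by norm_num : (0 : ℝ) < 1 / 4) (1 / (p - 1))
    positivity
  · have := Real.rpow_pos_of_pos (two_pos : (0 : ℝ) < 2) (p - 2)
    positivity

/-- On average over the updated vertex, one update multiplies the energy by at most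
`1 - c * rateF`. -/
theorem sum_energy_updateAt_le {p : ℝ} (hp : 1 < p) (hG : G.Connected)
    (hn : 2 ≤ Fintype.card V) (f : V → ℝ) :
    (Fintype.card V : ℝ)⁻¹ * ∑ v, energy G p (updateAt G p f v) ≤
      (1 - rateConst p * rateF (Fintype.card V) p (avgDegree G)) * energy G p f := by
  have hn' : (0 : ℝ) < Fintype.card V := by exact_mod_cast (by omega : 0 < Fintype.card V)
  have hD : 0 < avgDegree G := by linarith [one_le_avgDegree hG hn]
  have hK := rateScale_pos p hn' hD
  have h : rateConst p * energy G p f /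
        (Fintype.card V * rateScale p (Fintype.card V) (avgDegree G)) ≤
      ∑ v, (energy G p f - energy G p (updateAt G p f v)) := by
    unfold rateConst
    split_ifs with h
    · exact sum_energy_sub_ge_of_le_two hp h hG hn f
    · exact sum_energy_sub_ge_of_two_lt (not_le.1 h) hG hn f
  rw [Finset.sum_sub_distrib, Finset.sum_const, Finset.card_univ, nsmul_eq_mul] at h
  rw [rateF_eq hp (by omega) hD, inv_mul_le_iff₀ hn']
  refine le_trans (by linarith) (le_of_eq (?_ : (Fintype.card V : ℝ) * energy G p f -
    rateConst p * energy G p f /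
        (Fintype.card V * rateScale p (Fintype.card V) (avgDegree G)) = _))
  field_simp

end OneStep

/-! ### Expected energy and expected consensus time -/

section Probability

variable {V : Type*} [Fintype V] (G : SimpleGraph V)

theorem opinion_congr (p : ℝ) (f₀ : V → ℝ) {v v' : ℕ → V} {t : ℕ} (h : ∀ s < t, v s = v' s) :
    opinion G p f₀ v t = opinion G p f₀ v' t := by
  induction t with
  | zero => rfl
  | succ t ih =>
    rw [opinion, opinion, ih fun s hs => h s (by omega), h t (by omega)]

/-- Every functional of the profile at time `t` is a function of the first `t` update vertices. -/
theorem exists_comp_eq_opinion {Ω : Type*} (hne : Nonempty V) (p : ℝ) (f₀ : V → ℝ) (v : ℕ → Ω → V) (t : ℕ)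
    (Φ : (V → ℝ) → ℝ) :
    ∃ F : ((Finset.range t) → V) → ℝ, ∀ ω,
      Φ (opinion G p f₀ (fun s => v s ω) t) = F fun i => v i ω := by
  obtain ⟨z⟩ := hne
  refine ⟨fun x => Φ (opinion G p f₀
    (fun s => if h : s ∈ Finset.range t then x ⟨s, h⟩ else z) t), fun ω => ?_⟩
  congr 1
  refine opinion_congr G p f₀ fun s hs => ?_
  simp [hs]

variable {G}

theorem osc_le_of_forall {f : V → ℝ} [Nonempty V] {B : ℝ} (h : ∀ u v, f u - f v ≤ B) :
    osc f ≤ B := by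
  obtain ⟨u, hu⟩ := exists_eq_ciSup_of_finite (f := f)
  obtain ⟨w, hw⟩ := exists_eq_ciInf_of_finite (f := f)
  rw [osc, ← hu, ← hw]
  exact h u w

theorem sub_le_osc (f : V → ℝ) (u v : V) : f u - f v ≤ osc f :=
  sub_le_sub (le_ciSup (Set.finite_range f).bddAbove u) (ciInf_le (Set.finite_range f).bddBelow v)

theorem osc_le_energy {p : ℝ} (hp : 1 < p) (hG : G.Connected) (f : V → ℝ) :
    osc f ≤ Fintype.card V * (2 * energy G p f) ^ (1 / p) := by
  have := hG.nonempty
  have hp0 : 0 < p := by linarith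
  have hE := energy_nonneg G p f
  refine osc_le_of_forall fun u v => (le_abs_self _).trans ?_
  refine abs_sub_le_card_mul hG f (Real.rpow_nonneg (by linarith) _) (fun x y hxy => ?_) u v
  have h1 : |f x - f y| ^ p ≤ 2 * energy G p f := by
    rw [two_mul_energy]
    have hnn : ∀ a b, 0 ≤ adjWeight G a b * |f a - f b| ^ p := fun a b =>
      mul_nonneg (adjWeight_nonneg _ _ _) (Real.rpow_nonneg (abs_nonneg _) _)
    have h2 := Finset.single_le_sum (fun b _ => hnn x b) (Finset.mem_univ y)
    rw [adjWeight_of_adj G hxy, one_mul] at h2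
    exact h2.trans (Finset.single_le_sum (f := fun a => ∑ b, adjWeight G a b * |f a - f b| ^ p)
      (fun a _ => Finset.sum_nonneg fun b _ => hnn a b) (Finset.mem_univ x))
  have h2 := Real.rpow_le_rpow (Real.rpow_nonneg (abs_nonneg _) _) h1
    (one_div_nonneg.2 hp0.le)
  rwa [← Real.rpow_mul (abs_nonneg _), mul_one_div_cancel hp0.ne', Real.rpow_one] at h2

theorem two_mul_energy_le {p : ℝ} (hp : 1 < p) {f : V → ℝ}
    (hf : ∀ x, f x ∈ Set.Icc (0 : ℝ) 1) : 2 * energy G p f ≤ (Fintype.card V : ℝ) ^ 2 := by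
  rw [two_mul_energy, pairEnergy]
  have h : ∀ x y, adjWeight G x y * |f x - f y| ^ p ≤ 1 := by
    intro x y
    have h1 : |f x - f y| ≤ 1 := by
      rw [abs_le]; constructor <;> linarith [(hf x).1, (hf x).2, (hf y).1, (hf y).2]
    have h2 := Real.rpow_le_one (abs_nonneg _) h1 (by linarith : 0 ≤ p)
    exact mul_le_one₀ (adjWeight_le_one _ _ _) (Real.rpow_nonneg (abs_nonneg _) _) h2
  have := Finset.sum_le_sum fun x (_ : x ∈ (Finset.univ : Finset V)) =>
      Finset.sum_le_sum fun y (_ : y ∈ (Finset.univ : Finset V)) => h x y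
  refine this.trans (le_of_eq ?_)
  simp; ring

/-- All summands before the first success from `t₀` on equal `1`; if there is no success, the series
is infinite. -/
theorem consensusTime_le_add_tsum (p : ℝ) (f₀ : V → ℝ) (v : ℕ → V) (ε : ℝ) (t₀ : ℕ) :
    (consensusTime G p f₀ v ε : ℝ≥0∞) ≤
      t₀ + ∑' s : ℕ, (if osc (opinion G p f₀ v (t₀ + s)) ≤ ε then 0 else 1) := by
  classical
  by_cases h : ∃ s, osc (opinion G p f₀ v (t₀ + s)) ≤ ε
  · have h1 : consensusTime G p f₀ v ε ≤ ((t₀ + Nat.find h : ℕ) : ℕ∞) :=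
      iInf₂_le (t₀ + Nat.find h) (Nat.find_spec h)
    have h2 : (consensusTime G p f₀ v ε : ℝ≥0∞) ≤ ((t₀ + Nat.find h : ℕ) : ℝ≥0∞) := by
      rw [← ENat.toENNReal_coe]; exact ENat.toENNReal_le.2 h1
    refine h2.trans ?_
    push_cast
    gcongr
    refine le_trans (le_of_eq ?_) (ENNReal.sum_le_tsum (Finset.range (Nat.find h)))
    rw [Finset.sum_congr rfl fun s hs => if_neg (Nat.find_min h (Finset.mem_range.1 hs))]
    simp
  · push Not at h
    have : ∀ s, (if osc (opinion G p f₀ v (t₀ + s)) ≤ ε then (0 : ℝ≥0∞) else 1) = 1 :=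
      fun s => if_neg (not_le.2 (h s))
    simp_rw [this]
    simp

variable (G)

variable [MeasurableSpace V] [MeasurableSingletonClass V]
  {Ω : Type*} [MeasurableSpace Ω] {μ : Measure Ω}

/-- `Φ` and the minimizer need no measurability: everything factors through a finite discrete space
of update sequences. -/
theorem measurable_opinion (hne : Nonempty V) (p : ℝ) (f₀ : V → ℝ) {v : ℕ → Ω → V}
    (hv : ∀ t, Measurable (v t)) (t : ℕ) (Φ : (V → ℝ) → ℝ) :
    Measurable fun ω => Φ (opinion G p f₀ (fun s => v s ω) t) := by
  obtain ⟨F, hF⟩ := exists_comp_eq_opinion G hne p f₀ v t Φ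
  simp_rw [hF]
  exact (Measurable.of_discrete (f := F)).comp (measurable_pi_lambda _ fun i => hv i)

variable [IsProbabilityMeasure μ]

theorem integrable_opinion (hne : Nonempty V) (p : ℝ) (f₀ : V → ℝ) {v : ℕ → Ω → V}
    (hv : ∀ t, Measurable (v t)) (t : ℕ) (Φ : (V → ℝ) → ℝ) :
    Integrable (fun ω => Φ (opinion G p f₀ (fun s => v s ω) t)) μ := by
  have hm := measurable_opinion G hne p f₀ hv t Φ
  obtain ⟨F, hF⟩ := exists_comp_eq_opinion G hne p f₀ v t Φ
  obtain ⟨C, hC⟩ := (Set.finite_range fun x => |F x|).bddAbove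
  refine Integrable.of_bound hm.aestronglyMeasurable C (Filter.Eventually.of_forall fun ω => ?_)
  rw [hF, Real.norm_eq_abs]
  exact hC ⟨_, rfl⟩

variable {G}

/-- The profile at time `t` depends only on the vertices `v s` with `s < t`, hence is independent of
`v t`; splitting according to the value of `v t` gives the average. -/
theorem integral_opinion_succ (hne : Nonempty V) (p : ℝ) (f₀ : V → ℝ) {v : ℕ → Ω → V}
    (hv : IsUniformSelection μ v) (t : ℕ) (Φ : (V → ℝ) → ℝ) :
    ∫ ω, Φ (opinion G p f₀ (fun s => v s ω) (t + 1)) ∂μ =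
      ∫ ω, (Fintype.card V : ℝ)⁻¹ *
        ∑ x, Φ (updateAt G p (opinion G p f₀ (fun s => v s ω) t) x) ∂μ := by
  classical
  have h1 : ∀ ω, Φ (opinion G p f₀ (fun s => v s ω) (t + 1)) =
      ∑ x, Set.indicator {ω | v t ω = x} (1 : Ω → ℝ) ω *
        Φ (updateAt G p (opinion G p f₀ (fun s => v s ω) t) x) := by
    intro ω
    rw [Finset.sum_eq_single (v t ω)]
    · simp [opinion]
    · intro x _ hx
      simp [hx.symm]
    · simp
  have hmeas : ∀ x, MeasurableSet {ω | v t ω = x} := fun x =>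
    hv.measurable t (measurableSet_singleton x)
  have hint : ∀ x, Integrable (fun ω =>
      Φ (updateAt G p (opinion G p f₀ (fun s => v s ω) t) x)) μ := fun x =>
    integrable_opinion G hne p f₀ hv.measurable t fun f => Φ (updateAt G p f x)
  have hind : ∀ x, IndepFun (Set.indicator {ω | v t ω = x} (1 : Ω → ℝ))
      (fun ω => Φ (updateAt G p (opinion G p f₀ (fun s => v s ω) t) x)) μ := by
    intro x
    obtain ⟨F, hF⟩ := exists_comp_eq_opinion G hne p f₀ v t fun f => Φ (updateAt G p f x)
    have hi := hv.indep.indepFun_finset {t} (Finset.range t) (by simp) hv.measurable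
    have hc := hi.comp
      (φ := fun a : (({t} : Finset ℕ) → V) => if a ⟨t, by simp⟩ = x then (1 : ℝ) else 0)
      (ψ := F) Measurable.of_discrete Measurable.of_discrete
    have e1 : Set.indicator {ω | v t ω = x} (1 : Ω → ℝ) =
        (fun a : (({t} : Finset ℕ) → V) => if a ⟨t, by simp⟩ = x then (1 : ℝ) else 0) ∘
          fun ω i => v i ω := by
      funext ω
      simp [Set.indicator_apply]
    rw [e1, funext hF]
    exact hc
  have hprod : ∀ x, ∫ ω, Set.indicator {ω | v t ω = x} (1 : Ω → ℝ) ω *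
      Φ (updateAt G p (opinion G p f₀ (fun s => v s ω) t) x) ∂μ =
      (Fintype.card V : ℝ)⁻¹ * ∫ ω, Φ (updateAt G p (opinion G p f₀ (fun s => v s ω) t) x) ∂μ := by
    intro x
    rw [(hind x).integral_fun_mul_eq_mul_integral
      (measurable_one.indicator (hmeas x)).aestronglyMeasurable (hint x).aestronglyMeasurable,
      integral_indicator_one (hmeas x), Measure.real, hv.uniform t x]
    simp
  simp_rw [h1]
  rw [integral_finsetSum _ fun x _ => ?_, integral_const_mul, integral_finsetSum _ fun x _ => hint x,
    Finset.mul_sum]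
  · exact Finset.sum_congr rfl fun x _ => hprod x
  · exact (hind x).integrable_mul ((integrable_const 1).indicator (hmeas x)) (hint x)

theorem rateF_pos {p : ℝ} (hp : 1 < p) {n : ℕ} (hn : 0 < n) {D : ℝ} (hD : 0 < D) :
    0 < rateF n p D := by
  rw [rateF_eq hp hn hD]
  have hn' : (0 : ℝ) < n := by exact_mod_cast hn
  have := rateScale_pos p hn' hD
  positivity

theorem rateF_le_one {p : ℝ} (hp : 1 < p) {n : ℕ} (hn : 0 < n) {D : ℝ} (hD : 1 ≤ D) :
    rateF n p D ≤ 1 := by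
  rw [rateF_eq hp hn (by linarith)]
  have hn' : (1 : ℝ) ≤ n := by exact_mod_cast hn
  have h1 := one_le_rateScale hp hn' hD
  rw [div_le_one (by positivity)]
  nlinarith [one_le_pow₀ hn' (n := 2)]

/-- A rate constant that is at most `1`. -/
noncomputable def decayConst (p : ℝ) : ℝ := min (rateConst p) 1

theorem decayConst_pos {p : ℝ} (hp : 1 < p) : 0 < decayConst p :=
  lt_min (rateConst_pos hp) one_pos

/-- Exponential decay of the expected energy. -/
theorem integral_energy_le {p : ℝ} (hp : 1 < p) (hG : G.Connected) (hn : 2 ≤ Fintype.card V)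
    (f₀ : V → ℝ) {v : ℕ → Ω → V} (hv : IsUniformSelection μ v) (t : ℕ) :
    ∫ ω, energy G p (opinion G p f₀ (fun s => v s ω) t) ∂μ ≤
      energy G p f₀ *
        Real.exp (-decayConst p * rateF (Fintype.card V) p (avgDegree G) * t) := by
  have hne : Nonempty V := hG.nonempty
  set F := rateF (Fintype.card V) p (avgDegree G) with hF
  have hF0 : 0 < F := rateF_pos hp (by omega) (by linarith [one_le_avgDegree hG hn])
  induction t with
  | zero => simp [opinion]
  | succ t ih =>
    rw [integral_opinion_succ hne p f₀ hv t (energy G p)]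
    have h1 : ∀ f : V → ℝ, (Fintype.card V : ℝ)⁻¹ * ∑ x, energy G p (updateAt G p f x) ≤
        Real.exp (-decayConst p * F) * energy G p f := by
      intro f
      refine (sum_energy_updateAt_le hp hG hn f).trans ?_
      refine mul_le_mul_of_nonneg_right ?_ (energy_nonneg G p f)
      have h2 := Real.one_sub_le_exp_neg (decayConst p * F)
      have h3 : decayConst p * F ≤ rateConst p * F :=
        mul_le_mul_of_nonneg_right (min_le_left _ _) hF0.le
      rw [neg_mul]; linarith
    calc _ ≤ ∫ ω, Real.exp (-decayConst p * F) *
          energy G p (opinion G p f₀ (fun s => v s ω) t) ∂μ :=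
          integral_mono
            (integrable_opinion G hne p f₀ hv.measurable t fun f =>
              (Fintype.card V : ℝ)⁻¹ * ∑ x, energy G p (updateAt G p f x))
            (integrable_opinion G hne p f₀ hv.measurable t fun f =>
              Real.exp (-decayConst p * F) * energy G p f) fun ω => h1 _
      _ = Real.exp (-decayConst p * F) *
          ∫ ω, energy G p (opinion G p f₀ (fun s => v s ω) t) ∂μ := integral_const_mul _ _
      _ ≤ Real.exp (-decayConst p * F) * (energy G p f₀ * Real.exp (-decayConst p * F * t)) :=
          mul_le_mul_of_nonneg_left ih (Real.exp_pos _).le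
      _ = _ := by
          rw [mul_left_comm, ← Real.exp_add]; push_cast; ring_nf

/-- Oscillation above `ε` forces `2 E ≥ (ε / n)^p`, and Markov's inequality applies. The factor `n²`
bounds twice the initial energy. -/
theorem measure_lt_osc_le {p : ℝ} (hp : 1 < p) (hG : G.Connected) (hn : 2 ≤ Fintype.card V)
    {f₀ : V → ℝ} (hf₀ : ∀ x, f₀ x ∈ Set.Icc (0 : ℝ) 1) {v : ℕ → Ω → V}
    (hv : IsUniformSelection μ v) {ε : ℝ} (hε : 0 < ε) (t : ℕ) :
    μ {ω | ¬ osc (opinion G p f₀ (fun s => v s ω) t) ≤ ε} ≤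
      ENNReal.ofReal ((Fintype.card V : ℝ) ^ 2 * (Fintype.card V / ε) ^ p *
        Real.exp (-(decayConst p * rateF (Fintype.card V) p (avgDegree G)) * t)) := by
  have hne : Nonempty V := hG.nonempty
  have hn' : (0 : ℝ) < Fintype.card V := by exact_mod_cast (by omega : 0 < Fintype.card V)
  have hI := integral_energy_le hp hG hn f₀ hv t
  have h2E := two_mul_energy_le (G := G) hp hf₀
  set n : ℝ := ((Fintype.card V : ℕ) : ℝ) with hndef
  have hp0 : 0 < p := by linarith
  have hpos : 0 < (ε / n) ^ p := Real.rpow_pos_of_pos (by positivity) _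
  have hsub : {ω | ¬ osc (opinion G p f₀ (fun s => v s ω) t) ≤ ε} ⊆
      {ω | (ε / n) ^ p ≤ 2 * energy G p (opinion G p f₀ (fun s => v s ω) t)} := by
    intro ω hω
    have h1 := osc_le_energy hp hG (opinion G p f₀ (fun s => v s ω) t)
    have h2 : ε / n ≤ (2 * energy G p (opinion G p f₀ (fun s => v s ω) t)) ^ (1 / p) := by
      rw [div_le_iff₀ hn', mul_comm]
      exact ((not_le.1 hω).trans_le h1).le
    have h3 := Real.rpow_le_rpow (by positivity) h2 hp0.le
    rwa [← Real.rpow_mul (by linarith [energy_nonneg G p (opinion G p f₀ (fun s => v s ω) t)]),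
      one_div_mul_cancel hp0.ne', Real.rpow_one] at h3
  refine (measure_mono hsub).trans ?_
  have hint := integrable_opinion (μ := μ) G hne p f₀ hv.measurable t fun f => 2 * energy G p f
  have hM := mul_meas_ge_le_integral_of_nonneg
    (Filter.Eventually.of_forall fun ω => by
      have := energy_nonneg G p (opinion G p f₀ (fun s => v s ω) t)
      simp only [Pi.zero_apply]; linarith) hint ((ε / n) ^ p)
  rw [integral_const_mul] at hM
  rw [← ENNReal.ofReal_toReal (measure_ne_top μ _)]
  refine ENNReal.ofReal_le_ofReal ?_
  have hM' : μ.real {ω | (ε / n) ^ p ≤ 2 * energy G p (opinion G p f₀ (fun s => v s ω) t)} ≤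
      (n / ε) ^ p * (n ^ 2 * Real.exp (-decayConst p *
        rateF (Fintype.card V) p (avgDegree G) * t)) := by
    have e : (n / ε) ^ p = 1 / (ε / n) ^ p := by
      rw [← inv_div, Real.inv_rpow (by positivity), one_div]
    rw [e, one_div, le_inv_mul_iff₀ hpos]
    refine hM.trans ?_
    have := mul_le_mul_of_nonneg_right h2E (Real.exp_pos (-decayConst p *
        rateF (Fintype.card V) p (avgDegree G) * t)).le
    linarith
  refine hM'.trans (le_of_eq ?_)
  rw [neg_mul (decayConst p)]; ring

/-- The expected consensus time. -/
theorem lintegral_consensusTime_le {p : ℝ} (hp : 1 < p) (hG : G.Connected)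
    (hn : 2 ≤ Fintype.card V) {f₀ : V → ℝ} (hf₀ : ∀ x, f₀ x ∈ Set.Icc (0 : ℝ) 1)
    {v : ℕ → Ω → V} (hv : IsUniformSelection μ v) {ε : ℝ} (hε : 0 < ε) (hε2 : ε ≤ 1 / 2) :
    ∫⁻ ω, (consensusTime G p f₀ (fun s => v s ω) ε : ℝ≥0∞) ∂μ ≤
      ENNReal.ofReal ((p + 5) / decayConst p * Real.log (Fintype.card V / ε) /
        rateF (Fintype.card V) p (avgDegree G)) := by
  have hne : Nonempty V := hG.nonempty
  have hn' : (2 : ℝ) ≤ Fintype.card V := by exact_mod_cast hn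
  have hD := one_le_avgDegree hG hn
  have hF0 := rateF_pos hp (by omega : 0 < Fintype.card V) (by linarith : 0 < avgDegree G)
  have hF1 := rateF_le_one hp (by omega : 0 < Fintype.card V) hD
  have hmeas := fun t => measure_lt_osc_le hp hG hn hf₀ hv hε t
  set n : ℝ := ((Fintype.card V : ℕ) : ℝ) with hndef
  set F := rateF (Fintype.card V) p (avgDegree G) with hF
  set c := decayConst p with hc
  have hc0 : 0 < c := decayConst_pos hp
  have hc1 : c ≤ 1 := min_le_right _ _
  set a := c * F with ha
  have ha0 : 0 < a := mul_pos hc0 hF0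
  have ha1 : a ≤ 1 := mul_le_one₀ hc1 hF0.le hF1
  set x := n / ε with hx
  have hx4 : 4 ≤ x := by rw [hx, le_div_iff₀ hε]; linarith
  have hnx : n ≤ x := by rw [hx, le_div_iff₀ hε]; nlinarith
  have hlog1 : 1 ≤ Real.log x := by
    rw [Real.le_log_iff_exp_le (by linarith)]
    linarith [Real.exp_one_lt_d9]
  set B := n ^ 2 * x ^ p with hB
  have hxp : 0 < x ^ p := Real.rpow_pos_of_pos (by linarith) _
  have hB0 : 0 < B := by positivity
  have hlogB : Real.log B ≤ (p + 2) * Real.log x := by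
    rw [hB, Real.log_mul (by positivity) hxp.ne', Real.log_pow, Real.log_rpow (by linarith)]
    have := Real.log_le_log (by linarith) hnx
    push_cast; linarith
  -- The prefactor `B = n² x^p` is at most `x^(p+2)`, so it is absorbed by time `t₀` and the tail
  -- beyond is geometric.
  set t₀ := ⌈(p + 2) * Real.log x / a⌉₊ with ht₀
  have ht₀' : (p + 2) * Real.log x ≤ a * t₀ := by
    have := Nat.le_ceil ((p + 2) * Real.log x / a)
    rw [div_le_iff₀ ha0] at this
    linarith
  have hexp : ∀ s : ℕ, B * Real.exp (-a * ((t₀ + s : ℕ) : ℝ)) ≤ Real.exp (-a) ^ s := by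
    intro s
    rw [← Real.exp_nat_mul, ← Real.exp_log hB0, ← Real.exp_add, Real.exp_le_exp]
    push_cast
    linarith
  have hr1 : Real.exp (-a) ≤ 1 - a / 2 := by
    have h1 := Real.add_one_le_exp a
    rw [Real.exp_neg, inv_le_iff_one_le_mul₀ (Real.exp_pos _)]
    nlinarith
  have hr2 : Real.exp (-a) < 1 := by linarith
  have hsum : ∑' s : ℕ, ENNReal.ofReal (Real.exp (-a) ^ s) ≤ ENNReal.ofReal (2 / a) := by
    rw [← ENNReal.ofReal_tsum_of_nonneg (fun s => pow_nonneg (Real.exp_pos _).le s)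
      (summable_geometric_of_lt_one (Real.exp_pos _).le hr2),
      tsum_geometric_of_lt_one (Real.exp_pos _).le hr2]
    refine ENNReal.ofReal_le_ofReal ?_
    rw [← one_div, div_le_div_iff₀ (by linarith) ha0]
    linarith
  have hset : ∀ s, MeasurableSet {ω | ¬ osc (opinion G p f₀ (fun s => v s ω) (t₀ + s)) ≤ ε} :=
    fun s => (measurableSet_le (measurable_opinion G hne p f₀ hv.measurable (t₀ + s) osc)
      measurable_const).compl
  calc _ ≤ ∫⁻ ω, ((t₀ : ℝ≥0∞) + ∑' s : ℕ,
        Set.indicator {ω | ¬ osc (opinion G p f₀ (fun s => v s ω) (t₀ + s)) ≤ ε} 1 ω) ∂μ := by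
        refine lintegral_mono fun ω => ?_
        refine (consensusTime_le_add_tsum p f₀ (fun s => v s ω) ε t₀).trans (le_of_eq ?_)
        congr 2
        funext s
        by_cases h : osc (opinion G p f₀ (fun s => v s ω) (t₀ + s)) ≤ ε <;> simp [Set.indicator_apply, h]
    _ = t₀ + ∑' s : ℕ, μ {ω | ¬ osc (opinion G p f₀ (fun s => v s ω) (t₀ + s)) ≤ ε} := by
        rw [lintegral_add_left measurable_const, lintegral_const, measure_univ, mul_one, lintegral_tsum]
        · congr 2
          funext s
          exact lintegral_indicator_one (hset s)
        · exact fun s => (measurable_one.indicator (hset s)).aemeasurable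
    _ ≤ t₀ + ∑' s : ℕ, ENNReal.ofReal (Real.exp (-a) ^ s) := by
        gcongr with s
        exact (hmeas (t₀ + s)).trans (ENNReal.ofReal_le_ofReal (hexp s))
    _ ≤ t₀ + ENNReal.ofReal (2 / a) := by gcongr
    _ = ENNReal.ofReal (t₀ + 2 / a) := by
        rw [ENNReal.ofReal_add (Nat.cast_nonneg _) (by positivity), ENNReal.ofReal_natCast]
    _ ≤ _ := by
        refine ENNReal.ofReal_le_ofReal ?_
        have h1 := (Nat.ceil_lt_add_one (a := (p + 2) * Real.log x / a)
          (div_nonneg (mul_nonneg (by linarith) (by linarith)) ha0.le)).le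
        -- `p + 5` splits into `p + 2` for `t₀`, `1` for the ceiling and `2` for the geometric
        -- series; the last two use `1 ≤ log x`.
        have h2 : (p + 5) / c * Real.log x / F =
            (p + 2) * Real.log x / a + (Real.log x / a + 2 * (Real.log x / a)) := by
          rw [ha]; field_simp; ring
        rw [h2]
        have h3 : 1 ≤ Real.log x / a := by rw [le_div_iff₀ ha0]; linarith
        have h4 : 2 / a ≤ 2 * (Real.log x / a) := by
          rw [← mul_div_assoc]; gcongr; linarith
        linarith

end Probability

/-! ### Order properties of the dynamics -/

section Dynamics

variable {V : Type*} [Fintype V] {G : SimpleGraph V}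

theorem argminValue_le_of_forall_le {p : ℝ} (hp : 1 < p) {f : V → ℝ} {v : V}
    (hv : ∃ w, G.Adj v w) {Y : ℝ} (hY : ∀ w, f w ≤ Y) : argminValue G p f v ≤ Y := by
  classical
  refine argminValue_le G hp f hv Y ?_
  refine Finset.sum_nonpos fun w _ => ?_
  rw [← signedPow_zero hp]
  exact signedPow_mono hp (by linarith [hY w])

theorem argminValue_one_sub {p : ℝ} (hp : 1 < p) (f : V → ℝ) {v : V} (hv : ∃ w, G.Adj v w) :
    argminValue G p (fun x => 1 - f x) v = 1 - argminValue G p f v := by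
  classical
  have hspec : ∀ z : ℝ, localEnergy G p f v (argminValue G p f v) ≤ localEnergy G p f v z :=
    Classical.epsilon_spec (exists_minimizer G hp f hv)
  have he : ∀ y, localEnergy G p (fun x => 1 - f x) v (1 - y) = localEnergy G p f v y := by
    intro y
    unfold localEnergy
    refine Finset.sum_congr rfl fun w _ => ?_
    rw [abs_sub_comm]; congr 2; ring
  refine ((isMinimizer_iff_eq_argminValue G hp _ hv _).1 fun z => ?_).symm
  rw [he, show z = 1 - (1 - z) by ring, he]
  exact hspec _

theorem updateAt_apply_self (p : ℝ) (f : V → ℝ) (v : V) :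
    updateAt G p f v v = argminValue G p f v := by
  simp [updateAt]

theorem updateAt_apply_of_ne (p : ℝ) (f : V → ℝ) {v u : V} (h : u ≠ v) :
    updateAt G p f v u = f u := by
  simp [updateAt, h]

theorem opinion_one_sub {p : ℝ} (hp : 1 < p) (hadj : ∀ v, ∃ w, G.Adj v w) (f₀ : V → ℝ)
    (v : ℕ → V) (t : ℕ) :
    opinion G p (fun x => 1 - f₀ x) v t = fun x => 1 - opinion G p f₀ v t x := by
  induction t with
  | zero => rfl
  | succ t ih =>
    funext x
    rw [opinion, opinion, ih]
    by_cases h : x = v t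
    · rw [h, updateAt_apply_self, updateAt_apply_self, argminValue_one_sub hp _ (hadj _)]
    · rw [updateAt_apply_of_ne p _ h, updateAt_apply_of_ne p _ h]

theorem opinion_le_one {p : ℝ} (hp : 1 < p) (hadj : ∀ v, ∃ w, G.Adj v w) {f₀ : V → ℝ}
    (hf₀ : ∀ x, f₀ x ≤ 1) (v : ℕ → V) (t : ℕ) (x : V) : opinion G p f₀ v t x ≤ 1 := by
  induction t generalizing x with
  | zero => exact hf₀ x
  | succ t ih =>
    rw [opinion]
    by_cases h : x = v t
    · rw [h, updateAt_apply_self]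
      exact argminValue_le_of_forall_le hp (hadj _) ih
    · rw [updateAt_apply_of_ne p _ h]; exact ih x

/-- A run of the dynamics stays below a run of any system of upper barriers that dominates every
single update; a potential of the barriers grows at most linearly if it does so in each step. -/
theorem exists_barrier {p : ℝ} {S : Type*} (Inv : S → Prop) (b : S → V → ℝ) (P : S → ℝ) (η : ℝ)
    (hp : 1 < p) (hadj : ∀ v, ∃ w, G.Adj v w)
    (hstep : ∀ s, Inv s → ∀ f : V → ℝ, (∀ u, f u ≤ b s u) → (∀ u, f u ≤ 1) → ∀ u,
      ∃ s', Inv s' ∧ (∀ x, b s x ≤ b s' x) ∧ argminValue G p f u ≤ b s' u ∧ P s' ≤ P s + η)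
    {s₀ : S} (hs₀ : Inv s₀) {f₀ : V → ℝ} (hf₀ : ∀ u, f₀ u ≤ b s₀ u) (hf₁ : ∀ u, f₀ u ≤ 1)
    (v : ℕ → V) (t : ℕ) :
    ∃ s, Inv s ∧ (∀ u, opinion G p f₀ v t u ≤ b s u) ∧ P s ≤ P s₀ + η * t := by
  induction t with
  | zero => exact ⟨s₀, hs₀, hf₀, by simp⟩
  | succ t ih =>
    obtain ⟨s, hs, hfs, hP⟩ := ih
    obtain ⟨s', hs', hmono, harg, hP'⟩ :=
      hstep s hs _ hfs (opinion_le_one hp hadj hf₁ v t) (v t)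
    refine ⟨s', hs', fun u => ?_, by push_cast; linarith⟩
    rw [opinion]
    by_cases h : u = v t
    · rw [h, updateAt_apply_self]; exact harg
    · rw [updateAt_apply_of_ne p _ h]; exact (hfs u).trans (hmono u)

end Dynamics

/-! ### Layered graphs -/

section NetWeight

variable {V : Type*} {K : ℕ} {lay : V → ℕ} {slow : Finset ℕ} {ω : ℕ → ℝ} {μ : ℝ}

/-- The network of barriers: a chain of layers `0, …, K` with conductances `ω`, and every vertex of
a slow layer attached with weight `μ` to the two adjacent layers. -/
def netWeight (K : ℕ) (lay : V → ℕ) (slow : Finset ℕ) (ω : ℕ → ℝ) (μ : ℝ) :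
    Fin (K + 1) ⊕ V → Fin (K + 1) ⊕ V → ℝ
  | .inl i, .inl j => if (i : ℕ) + 1 = j then ω i else if (j : ℕ) + 1 = i then ω j else 0
  | .inl i, .inr v => if lay v ∈ slow ∧ (lay v + 1 = i ∨ (i : ℕ) + 1 = lay v) then μ else 0
  | .inr v, .inl i => if lay v ∈ slow ∧ (lay v + 1 = i ∨ (i : ℕ) + 1 = lay v) then μ else 0
  | .inr _, .inr _ => 0

/-- The values of the barriers: `c` on the layers, `x` on the slow vertices. -/
def netVal (K : ℕ) (c : ℕ → ℝ) (x : V → ℝ) : Fin (K + 1) ⊕ V → ℝ :=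
  Sum.elim (fun i => c i) x

theorem netWeight_comm (a b : Fin (K + 1) ⊕ V) :
    netWeight K lay slow ω μ a b = netWeight K lay slow ω μ b a := by
  rcases a with i | v <;> rcases b with j | w <;> simp only [netWeight]
  by_cases h1 : (i : ℕ) + 1 = j
  · rw [if_pos h1, if_neg (by omega), if_pos h1]
  · by_cases h2 : (j : ℕ) + 1 = i
    · rw [if_neg h1, if_pos h2, if_pos h2]
    · simp [h1, h2]

theorem netWeight_self (a : Fin (K + 1) ⊕ V) : netWeight K lay slow ω μ a a = 0 := by
  rcases a with i | v <;> simp [netWeight]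

theorem netWeight_nonneg (hω : ∀ i, 0 ≤ ω i) (hμ : 0 ≤ μ) (a b : Fin (K + 1) ⊕ V) :
    0 ≤ netWeight K lay slow ω μ a b := by
  rcases a with i | v <;> rcases b with j | w <;> simp only [netWeight]
  · split_ifs <;> simp [hω]
  · split_ifs <;> simp [hμ]
  · split_ifs <;> simp [hμ]
  · exact le_rfl

theorem netVal_update_inl [DecidableEq V] (c : ℕ → ℝ) (x : V → ℝ) (i : Fin (K + 1)) (Y : ℝ) :
    netVal K (Function.update c i Y) x = Function.update (netVal K c x) (.inl i) Y := by
  funext a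
  rcases a with j | w
  · by_cases h : j = i
    · subst h; simp [netVal]
    · have h' : (j : ℕ) ≠ i := fun e => h (Fin.ext e)
      simp [netVal, h, h']
  · simp [netVal]

theorem netVal_update_inr [DecidableEq V] (c : ℕ → ℝ) (x : V → ℝ) (v : V) (Y : ℝ) :
    netVal K c (Function.update x v Y) = Function.update (netVal K c x) (.inr v) Y := by
  funext a
  rcases a with j | w
  · simp [netVal]
  · by_cases h : w = v
    · subst h; simp [netVal]
    · simp [netVal, h]

end NetWeight

section Layered

variable {V : Type*} [Fintype V]

/-- The set of vertices in the layer `l`. -/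
def layerSet (lay : V → ℕ) (l : ℕ) : Finset V := Finset.univ.filter fun v => lay v = l

theorem mem_layerSet {lay : V → ℕ} {l : ℕ} {v : V} : v ∈ layerSet lay l ↔ lay v = l := by
  simp [layerSet]

/-- The guard `1 ≤ i` excludes the truncated subtraction `0 - 1 = 0`. -/
theorem sum_ite_layer (lay : V → ℕ) (slow : Finset ℕ) (i : ℕ) (F : V → ℝ) :
    ∑ v, (if lay v ∈ slow ∧ (lay v + 1 = i ∨ i + 1 = lay v) then F v else 0) =
      (if i + 1 ∈ slow then ∑ v ∈ layerSet lay (i + 1), F v else 0) +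
      (if 1 ≤ i ∧ i - 1 ∈ slow then ∑ v ∈ layerSet lay (i - 1), F v else 0) := by
  have h : ∀ v, (if lay v ∈ slow ∧ (lay v + 1 = i ∨ i + 1 = lay v) then F v else 0) =
      (if lay v = i + 1 then (if i + 1 ∈ slow then F v else 0) else 0) +
      (if lay v = i - 1 then (if 1 ≤ i ∧ i - 1 ∈ slow then F v else 0) else 0) := by
    intro v
    by_cases h1 : lay v = i + 1
    · have h2 : lay v ≠ i - 1 := by omega
      rw [if_pos h1, if_neg h2, add_zero, h1]
      by_cases h3 : i + 1 ∈ slow <;> simp [h3]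
    · by_cases h2 : lay v = i - 1
      · rw [if_neg h1, if_pos h2, zero_add, h2]
        by_cases h3 : i - 1 ∈ slow
        · by_cases h4 : 1 ≤ i
          · rw [if_pos ⟨h3, by omega⟩, if_pos ⟨h4, h3⟩]
          · rw [if_neg (by rintro ⟨-, h | h⟩ <;> omega), if_neg (by tauto)]
        · rw [if_neg (by tauto), if_neg (by tauto)]
      · rw [if_neg h1, if_neg h2, if_neg (by rintro ⟨-, h | h⟩ <;> omega), add_zero]
  have h' : ∀ (l : ℕ) (Q : Prop) [Decidable Q],
      ∑ v, (if lay v = l then (if Q then F v else 0) else 0) =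
        if Q then ∑ v ∈ layerSet lay l, F v else 0 := by
    intro l Q _
    split_ifs <;> simp [layerSet, Finset.sum_filter]
  rw [Finset.sum_congr rfl fun v _ => h v, Finset.sum_add_distrib, h', h']

/-- Two vertices are adjacent if and only if their layers are consecutive. -/
def IsLayered (G : SimpleGraph V) (lay : V → ℕ) : Prop :=
  ∀ u v, G.Adj u v ↔ lay u + 1 = lay v ∨ lay v + 1 = lay u

theorem IsLayered.sum_neighborFinset {G : SimpleGraph V} {lay : V → ℕ} (h : IsLayered G lay)
    [DecidableRel G.Adj] (u : V) (F : V → ℝ) :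
    ∑ w ∈ G.neighborFinset u, F w =
      ∑ w ∈ layerSet lay (lay u + 1), F w +
      (if 1 ≤ lay u then ∑ w ∈ layerSet lay (lay u - 1), F w else 0) := by
  classical
  have h1 := sum_ite_layer lay {lay u + 1, lay u - 1} (lay u) F
  simp only [Finset.mem_insert, Finset.mem_singleton, true_or, or_true, and_true, if_true] at h1
  rw [← h1, ← Finset.sum_filter]
  refine Finset.sum_congr ?_ fun _ _ => rfl
  ext w
  simp only [SimpleGraph.mem_neighborFinset, h u w, Finset.mem_filter, Finset.mem_univ, true_and]
  constructor
  · rintro (h | h)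
    · exact ⟨Or.inl h.symm, Or.inr h⟩
    · exact ⟨Or.inr (by omega), Or.inl h⟩
  · rintro ⟨-, h | h⟩
    · exact Or.inr h
    · exact Or.inl h

section Net

variable {K : ℕ} {lay : V → ℕ} {slow : Finset ℕ} {ω : ℕ → ℝ} {μ : ℝ}

theorem sum_netWeight_inl (c : ℕ → ℝ) (x : V → ℝ) (F : ℝ → ℝ) (i : Fin (K + 1)) :
    ∑ y, netWeight K lay slow ω μ (.inl i) y * F (netVal K c x y) =
      (if (i : ℕ) < K then ω i * F (c (i + 1)) else 0) +
      (if 1 ≤ (i : ℕ) then ω (i - 1) * F (c (i - 1)) else 0) +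
      μ * ((if (i : ℕ) + 1 ∈ slow then ∑ v ∈ layerSet lay (i + 1), F (x v) else 0) +
        (if 1 ≤ (i : ℕ) ∧ (i : ℕ) - 1 ∈ slow then
          ∑ v ∈ layerSet lay (i - 1), F (x v) else 0)) := by
  rw [Fintype.sum_sum_type, ← sum_ite_layer lay slow i fun v => F (x v), Finset.mul_sum]
  congr 1
  · simp only [netWeight, netVal, Sum.elim_inl]
    rw [Fin.sum_univ_eq_sum_range (fun j => (if (i : ℕ) + 1 = j then ω i else
      if j + 1 = (i : ℕ) then ω j else 0) * F (c j)) (K + 1)]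
    have h : ∀ j, (if (i : ℕ) + 1 = j then ω i else if j + 1 = (i : ℕ) then ω j else 0) * F (c j) =
        (if (i : ℕ) + 1 = j then ω i * F (c (i + 1)) else 0) +
        (if (i : ℕ) - 1 = j then (if 1 ≤ (i : ℕ) then ω (i - 1) * F (c (i - 1)) else 0)
          else 0) := by
      intro j
      by_cases h1 : (i : ℕ) + 1 = j
      · rw [if_pos h1, if_pos h1, if_neg (by omega), h1, add_zero]
      · by_cases h2 : j + 1 = (i : ℕ)
        · rw [if_neg h1, if_pos h2, if_neg h1, if_pos (by omega), if_pos (by omega),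
            show (i : ℕ) - 1 = j by omega, zero_add]
        · rw [if_neg h1, if_neg h2, if_neg h1, zero_mul, zero_add]
          split_ifs
          · omega
          · rfl
          · rfl
    rw [Finset.sum_congr rfl fun j _ => h j, Finset.sum_add_distrib, Finset.sum_ite_eq,
      Finset.sum_ite_eq, if_pos (Finset.mem_range.2 (by omega) : (i : ℕ) - 1 ∈ Finset.range (K + 1))]
    simp
  · refine Finset.sum_congr rfl fun v _ => ?_
    simp only [netWeight, netVal, Sum.elim_inr]
    split_ifs <;> simp

theorem sum_netWeight_inr (c : ℕ → ℝ) (x : V → ℝ) (F : ℝ → ℝ) {v : V} (hv : lay v ∈ slow)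
    (hK : lay v < K) :
    ∑ y, netWeight K lay slow ω μ (.inr v) y * F (netVal K c x y) =
      μ * (F (c (lay v + 1)) + (if 1 ≤ lay v then F (c (lay v - 1)) else 0)) := by
  rw [Fintype.sum_sum_type]
  have h0 : ∑ w : V, netWeight K lay slow ω μ (.inr v) (.inr w) * F (netVal K c x (.inr w)) = 0 :=
    Finset.sum_eq_zero fun w _ => by simp [netWeight]
  rw [h0, add_zero]
  simp only [netWeight, netVal, Sum.elim_inl, hv, true_and]
  rw [Fin.sum_univ_eq_sum_range (fun j => (if lay v + 1 = j ∨ j + 1 = lay v then μ else 0) *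
    F (c j)) (K + 1)]
  have h : ∀ j, (if lay v + 1 = j ∨ j + 1 = lay v then μ else 0) * F (c j) =
      (if lay v + 1 = j then μ * F (c (lay v + 1)) else 0) +
      (if lay v - 1 = j then (if 1 ≤ lay v then μ * F (c (lay v - 1)) else 0) else 0) := by
    intro j
    by_cases h1 : lay v + 1 = j
    · rw [if_pos (Or.inl h1), if_pos h1, if_neg (by omega), h1, add_zero]
    · by_cases h2 : j + 1 = lay v
      · rw [if_pos (Or.inr h2), if_neg h1, if_pos (by omega), if_pos (by omega),
          show lay v - 1 = j by omega, zero_add]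
      · rw [if_neg (by tauto), if_neg h1, zero_mul, zero_add]
        split_ifs
        · omega
        · rfl
        · rfl
  rw [Finset.sum_congr rfl fun j _ => h j, Finset.sum_add_distrib, Finset.sum_ite_eq,
    Finset.sum_ite_eq, if_pos (Finset.mem_range.2 (by omega)),
    if_pos (Finset.mem_range.2 (by omega)), mul_add]
  split_ifs <;> simp

/-- The energy of the network of barriers. -/
noncomputable def netEnergy (K : ℕ) (lay : V → ℕ) (slow : Finset ℕ) (ω : ℕ → ℝ) (μ s : ℝ)
    (c : ℕ → ℝ) (x : V → ℝ) : ℝ :=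
  pairEnergy (netWeight K lay slow ω μ) s (netVal K c x)

theorem netEnergy_nonneg (hω : ∀ i, 0 ≤ ω i) (hμ : 0 ≤ μ) (s : ℝ) (c : ℕ → ℝ) (x : V → ℝ) :
    0 ≤ netEnergy K lay slow ω μ s c x :=
  pairEnergy_nonneg (netWeight_nonneg hω hμ) _ _

/-- The hypothesis `hY` says that the flow into the node `i`, held at the value `Y`, is nonnegative;
by convexity the energy does not increase while the node is raised to `Y`. -/
theorem netEnergy_raise_layer_le (hω : ∀ i, 0 ≤ ω i) (hμ : 0 ≤ μ) {s : ℝ} (hs : 1 < s)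
    (c : ℕ → ℝ) (x : V → ℝ) {i : ℕ} (hi : i < K) (Y : ℝ)
    (hY : 0 ≤ ω i * signedPow s (c (i + 1) - Y) +
      (if 1 ≤ i then ω (i - 1) * signedPow s (c (i - 1) - Y) else 0) +
      μ * ((if i + 1 ∈ slow then ∑ v ∈ layerSet lay (i + 1), signedPow s (x v - Y) else 0) +
        (if 1 ≤ i ∧ i - 1 ∈ slow then
          ∑ v ∈ layerSet lay (i - 1), signedPow s (x v - Y) else 0))) :
    netEnergy K lay slow ω μ s (Function.update c i (max (c i) Y)) x ≤
      netEnergy K lay slow ω μ s c x := by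
  classical
  rcases le_total Y (c i) with h | h
  · rw [max_eq_left h, Function.update_eq_self]
  · rw [max_eq_right h]
    have e := netVal_update_inl c x (⟨i, by omega⟩ : Fin (K + 1)) Y
    unfold netEnergy
    rw [show Function.update c i Y = Function.update c ((⟨i, by omega⟩ : Fin (K + 1)) : ℕ) Y
      from rfl, e]
    refine pairEnergy_update_le netWeight_comm netWeight_self hs _ _ _ ?_ ?_
      (netWeight_nonneg hω hμ)
    · simpa [netVal] using h
    · rw [sum_netWeight_inl c x (fun z => signedPow s (z - Y))]
      simpa [hi] using hY

theorem netEnergy_raise_vertex [DecidableEq V] {s : ℝ} (c : ℕ → ℝ) (x : V → ℝ) {v : V}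
    (hv : lay v ∈ slow) (hK : lay v < K) (Y : ℝ) :
    netEnergy K lay slow ω μ s c x - netEnergy K lay slow ω μ s c (Function.update x v Y) =
      2 * (μ * ((|c (lay v + 1) - x v| ^ s - |c (lay v + 1) - Y| ^ s) +
        (if 1 ≤ lay v then |c (lay v - 1) - x v| ^ s - |c (lay v - 1) - Y| ^ s else 0))) := by
  classical
  unfold netEnergy
  rw [netVal_update_inr, pairEnergy_update netWeight_comm netWeight_self,
    ← sum_netWeight_inr c x (fun z => |z - x v| ^ s - |z - Y| ^ s) hv hK]
  rfl

/-- The initial profile of the barriers: `0` up to layer `h`, then linear up to the value `1`. -/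
noncomputable def ramp (h L : ℕ) (l : ℕ) : ℝ := max 0 (min 1 (((l : ℝ) - h) / L))

theorem ramp_of_le {h L l : ℕ} (hl : l ≤ h) : ramp h L l = 0 := by
  refine max_eq_left ((min_le_right _ _).trans ?_)
  refine div_nonpos_of_nonpos_of_nonneg ?_ (Nat.cast_nonneg _)
  have : (l : ℝ) ≤ h := by exact_mod_cast hl
  linarith

theorem ramp_of_ge {h L l : ℕ} (hL : 0 < L) (hl : h + L ≤ l) : ramp h L l = 1 := by
  have hL' : (0 : ℝ) < L := by exact_mod_cast hL
  have h1 : (1 : ℝ) ≤ ((l : ℝ) - h) / L := by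
    rw [le_div_iff₀ hL']
    have : ((h + L : ℕ) : ℝ) ≤ l := by exact_mod_cast hl
    push_cast at this; linarith
  rw [ramp, min_eq_left h1, max_eq_right zero_le_one]

theorem ramp_mem_Icc (h L l : ℕ) : ramp h L l ∈ Set.Icc (0 : ℝ) 1 :=
  ⟨le_max_left _ _, max_le zero_le_one (min_le_left _ _)⟩

theorem abs_ramp_succ_sub_le {h L : ℕ} (l : ℕ) :
    |ramp h L (l + 1) - ramp h L l| ≤ 1 / L := by
  unfold ramp
  refine (abs_max_sub_max_le_max _ _ _ _).trans ?_
  rw [sub_self, abs_zero]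
  refine max_le (by positivity) ((abs_min_sub_min_le_max _ _ _ _).trans ?_)
  rw [sub_self, abs_zero]
  refine max_le (by positivity) (le_of_eq ?_)
  rw [← sub_div]
  push_cast
  rw [abs_of_nonneg]
  · ring
  · rw [show (l : ℝ) + 1 - h - (l - h) = 1 by ring]; positivity

theorem ramp_reflect {h L l : ℕ} (hL : 0 < L) (hl : l ≤ 2 * h + L) :
    1 - ramp h L l = ramp h L (2 * h + L - l) := by
  have hL' : (0 : ℝ) < L := by exact_mod_cast hL
  rcases le_total l h with h1 | h1
  · rw [ramp_of_le h1, ramp_of_ge hL (by omega), sub_zero]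
  · rcases le_total (h + L) l with h2 | h2
    · rw [ramp_of_ge hL h2, ramp_of_le (by omega), sub_self]
    · have e : ∀ m : ℕ, h ≤ m → m ≤ h + L → ramp h L m = ((m : ℝ) - h) / L := by
        intro m hm1 hm2
        have a1 : (h : ℝ) ≤ m := by exact_mod_cast hm1
        have a2 : (m : ℝ) ≤ h + L := by exact_mod_cast hm2
        rw [ramp, min_eq_right, max_eq_right]
        · exact div_nonneg (by linarith) hL'.le
        · rw [div_le_one hL']; linarith
      rw [e l h1 h2, e _ (by omega) (by omega), Nat.cast_sub hl]
      push_cast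
      field_simp
      ring

/-- All slow layers and their neighbours lie where the ramp is `0`, so only about `L` path edges
count, each with difference at most `1 / L`. -/
theorem netEnergy_ramp_le {s : ℝ} (hs : 1 < s) {h L : ℕ} (hL : 0 < L)
    (hK : K = h + L) (hslow : ∀ l ∈ slow, l < h) {w : ℝ} (hω : ∀ i, h ≤ i → ω i = w)
    (hw : 0 ≤ w) :
    netEnergy K lay slow ω μ s (ramp h L) (fun _ => 0) ≤ 4 * w * (L : ℝ) ^ (1 - s) := by
  have hL' : (0 : ℝ) < L := by exact_mod_cast hL
  have hs0 : s ≠ 0 := by linarith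
  have hrow : ∀ i : Fin (K + 1), ∑ y, netWeight K lay slow ω μ (.inl i) y *
      |ramp h L i - netVal K (ramp h L) (fun _ => 0) y| ^ s ≤
      if h ≤ (i : ℕ) then 2 * (w * (1 / L : ℝ) ^ s) else 0 := by
    intro i
    rw [sum_netWeight_inl _ _ (fun z => |ramp h L i - z| ^ s)]
    have hsl : ∀ l, l ∈ slow → ((i : ℕ) + 1 = l ∨ l + 1 = i) → ramp h L i = 0 := by
      intro l hl hil
      exact ramp_of_le (by have := hslow l hl; omega)
    have e1 : (if (i : ℕ) + 1 ∈ slow then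
        ∑ v ∈ layerSet lay (i + 1), |ramp h L i - 0| ^ s else 0) = 0 := by
      split_ifs with h1
      · rw [hsl _ h1 (Or.inl rfl)]; simp [Real.zero_rpow hs0]
      · rfl
    have e2 : (if 1 ≤ (i : ℕ) ∧ (i : ℕ) - 1 ∈ slow then
        ∑ v ∈ layerSet lay (i - 1), |ramp h L i - 0| ^ s else 0) = 0 := by
      split_ifs with h1
      · rw [hsl _ h1.2 (Or.inr (by omega))]; simp [Real.zero_rpow hs0]
      · rfl
    rw [e1, e2, add_zero, mul_zero, add_zero]
    have hpow : ∀ l, |ramp h L (l + 1) - ramp h L l| ^ s ≤ (1 / L : ℝ) ^ s := fun l =>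
      Real.rpow_le_rpow (abs_nonneg _) (abs_ramp_succ_sub_le l) (by linarith)
    have hnn : 0 ≤ w * (1 / L : ℝ) ^ s := mul_nonneg hw (Real.rpow_nonneg (by positivity) _)
    by_cases hi : h ≤ (i : ℕ)
    · rw [if_pos hi, two_mul]
      refine add_le_add ?_ ?_
      · split_ifs
        · rw [hω _ hi, abs_sub_comm]
          exact mul_le_mul_of_nonneg_left (hpow _) hw
        · exact hnn
      · split_ifs with h1
        · by_cases hi' : h ≤ (i : ℕ) - 1
          · rw [hω _ hi']
            have := hpow ((i : ℕ) - 1)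
            rw [Nat.sub_add_cancel h1] at this
            exact mul_le_mul_of_nonneg_left this hw
          · rw [ramp_of_le (by omega : (i : ℕ) ≤ h), ramp_of_le (by omega : (i : ℕ) - 1 ≤ h)]
            simpa [Real.zero_rpow hs0] using hnn
        · exact hnn
    · rw [if_neg hi, ramp_of_le (by omega : (i : ℕ) ≤ h), ramp_of_le (by omega : (i : ℕ) + 1 ≤ h),
        ramp_of_le (by omega : (i : ℕ) - 1 ≤ h)]
      simp [Real.zero_rpow hs0]
  have hrow' : ∀ v : V, ∑ y, netWeight K lay slow ω μ (.inr v) y *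
      |(0 : ℝ) - netVal K (ramp h L) (fun _ => 0) y| ^ s = 0 := by
    intro v
    by_cases hv : lay v ∈ slow
    · have := hslow _ hv
      rw [sum_netWeight_inr _ _ (fun z => |(0 : ℝ) - z| ^ s) hv (by omega), ramp_of_le (by omega),
        ramp_of_le (by omega)]
      simp [Real.zero_rpow hs0]
    · refine Finset.sum_eq_zero fun y _ => ?_
      rcases y with j | u <;> simp [netWeight, hv]
  unfold netEnergy pairEnergy
  rw [Fintype.sum_sum_type]
  have h0 : ∑ v : V, ∑ y, netWeight K lay slow ω μ (.inr v) y *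
      |netVal K (ramp h L) (fun _ => 0) (.inr v) - netVal K (ramp h L) (fun _ => 0) y| ^ s = 0 :=
    Finset.sum_eq_zero fun v _ => hrow' v
  rw [h0, add_zero]
  refine (Finset.sum_le_sum fun i _ => hrow i).trans ?_
  rw [Fin.sum_univ_eq_sum_range (fun i => if h ≤ i then 2 * (w * (1 / L : ℝ) ^ s) else 0) (K + 1),
    ← Finset.sum_filter, Finset.sum_const, nsmul_eq_mul]
  have hcard : ((Finset.range (K + 1)).filter (fun i => h ≤ i)).card = L + 1 := by
    have : (Finset.range (K + 1)).filter (fun i => h ≤ i) = Finset.Ico h (K + 1) := by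
      ext; simp; omega
    rw [this, Nat.card_Ico]; omega
  rw [hcard]
  have e : (1 / L : ℝ) ^ s = (L : ℝ) ^ (1 - s) / L := by
    rw [one_div, Real.inv_rpow hL'.le, Real.rpow_sub hL', Real.rpow_one]
    field_simp
  rw [e]
  have hp0 : 0 ≤ w * (L : ℝ) ^ (1 - s) := mul_nonneg hw (Real.rpow_nonneg hL'.le _)
  have h1 : ((L + 1 : ℕ) : ℝ) / L ≤ 2 := by
    rw [div_le_iff₀ hL']; push_cast
    have : (1 : ℝ) ≤ L := by exact_mod_cast hL
    linarith
  calc _ = ((L + 1 : ℕ) : ℝ) / L * (2 * (w * (L : ℝ) ^ (1 - s))) := by ring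
    _ ≤ 2 * (2 * (w * (L : ℝ) ^ (1 - s))) := by gcongr
    _ = _ := by ring

end Net

/-- Splits a rise `δ` of a slow barrier into a free allowance `η` and a part paid for by an energy
drop of order `δ^s`. -/
theorem le_add_rpow_mul {s η δ : ℝ} (hs : 1 < s) (hη : 0 < η) (hδ : 0 ≤ δ) :
    δ ≤ η + η ^ (1 - s) * δ ^ s := by
  rcases le_total δ η with h | h
  · have := mul_nonneg (Real.rpow_nonneg hη.le (1 - s)) (Real.rpow_nonneg hδ s)
    linarith
  · have hδ' : 0 < δ := by linarith
    have h1 : δ ^ (1 - s) ≤ η ^ (1 - s) :=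
      Real.rpow_le_rpow_of_nonpos hη h (by linarith)
    have h2 := mul_le_mul_of_nonneg_right h1 (Real.rpow_nonneg hδ s)
    rw [← Real.rpow_add hδ', sub_add_cancel, Real.rpow_one] at h2
    linarith

end Layered

theorem exists_sum_signedPow_eq_zero {p : ℝ} (hp : 1 < p) {ι : Type*} {s : Finset ι}
    (hs : s.Nonempty) (g : ι → ℝ) : ∃ Y, ∑ i ∈ s, signedPow p (g i - Y) = 0 := by
  refine mem_range_of_exists_le_of_exists_ge (f := fun Y => ∑ i ∈ s, signedPow p (g i - Y)) ?_
    ⟨s.sup' hs g, ?_⟩ ⟨s.inf' hs g, ?_⟩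
  · exact continuous_finsetSum _ fun i _ =>
      (continuous_signedPow hp).comp (continuous_const.sub continuous_id)
  · refine Finset.sum_nonpos fun i hi => ?_
    rw [← signedPow_zero hp]
    exact signedPow_mono hp (by linarith [Finset.le_sup' g hi])
  · refine Finset.sum_nonneg fun i hi => ?_
    exact signedPow_nonneg (by linarith [Finset.inf'_le g hi])

/-! ### Barriers and the slow graph for small `p` -/

section Barrier

variable {V : Type*}

/-- The upper barrier of a vertex: individual on the slow layers, common on the other layers. -/
def barrier (lay : V → ℕ) (slow : Finset ℕ) (s : (ℕ → ℝ) × (V → ℝ)) (u : V) : ℝ :=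
  if lay u ∈ slow then s.2 u else s.1 (lay u)

theorem barrier_of_mem {lay : V → ℕ} {slow : Finset ℕ} {u : V} (h : lay u ∈ slow)
    (s : (ℕ → ℝ) × (V → ℝ)) : barrier lay slow s u = s.2 u := if_pos h

theorem barrier_of_notMem {lay : V → ℕ} {slow : Finset ℕ} {u : V} (h : lay u ∉ slow)
    (s : (ℕ → ℝ) × (V → ℝ)) : barrier lay slow s u = s.1 (lay u) := if_neg h

theorem le_update_max {ι : Type*} [DecidableEq ι] (c : ι → ℝ) (i : ι) (Y : ℝ) (j : ι) :
    c j ≤ Function.update c i (max (c i) Y) j := by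
  by_cases h : j = i
  · subst h; simp
  · simp [h]

theorem barrier_mono (lay : V → ℕ) (slow : Finset ℕ) {s s' : (ℕ → ℝ) × (V → ℝ)}
    (h1 : ∀ l, s.1 l ≤ s'.1 l) (h2 : ∀ v, s.2 v ≤ s'.2 v) (u : V) :
    barrier lay slow s u ≤ barrier lay slow s' u := by
  unfold barrier
  split_ifs
  · exact h2 u
  · exact h1 _

variable [Fintype V]

theorem sum_layerSet_const {lay : V → ℕ} {l : ℕ} {F : V → ℝ} {a : ℝ}
    (h : ∀ v, lay v = l → F v = a) : ∑ v ∈ layerSet lay l, F v = (layerSet lay l).card * a := by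
  rw [Finset.sum_congr rfl fun v hv => h v (mem_layerSet.1 hv), Finset.sum_const, nsmul_eq_mul]

theorem argminValue_le_of_sum {G : SimpleGraph V} {lay : V → ℕ} (hlay : IsLayered G lay) {p : ℝ}
    (hp : 1 < p) (hadj : ∀ v, ∃ w, G.Adj v w) {f b : V → ℝ} (hf : ∀ u, f u ≤ b u) (u : V) (Y : ℝ)
    (hY : ∑ w ∈ layerSet lay (lay u + 1), signedPow p (b w - Y) +
      (if 1 ≤ lay u then ∑ w ∈ layerSet lay (lay u - 1), signedPow p (b w - Y) else 0) ≤ 0) :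
    argminValue G p f u ≤ Y := by
  classical
  refine argminValue_le G hp f (hadj u) Y ?_
  rw [← hlay.sum_neighborFinset u fun w => signedPow p (b w - Y)] at hY
  refine le_trans (Finset.sum_le_sum (g := fun w => signedPow p (b w - Y))
    fun w _ => signedPow_mono hp ?_) hY
  linarith [hf w]

/-- In a layered graph with `n` vertices in the layer `0`, `k` in the layer `1` and one in each of
the next layers, it takes long until all of the layer `0` has left the vicinity of `0`. -/
theorem le_time_of_le_two {p : ℝ} (hp : 1 < p) {G : SimpleGraph V} {lay : V → ℕ}
    (hlay : IsLayered G lay) (hadj : ∀ v, ∃ w, G.Adj v w) {n k L : ℕ} (hn : 0 < n) (hk : 0 < k)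
    (hL : 0 < L) (h0 : (layerSet lay 0).card = n) (h1 : (layerSet lay 1).card = k)
    (h2 : ∀ l, 2 ≤ l → l ≤ 2 + L → (layerSet lay l).card = 1) (v : ℕ → V) (T : ℕ)
    (hT : ∀ u, lay u = 0 → 1 / 4 ≤ opinion G p (fun u => ramp 2 L (lay u)) v T u) :
    (n : ℝ) * L / 8 * (k * n / 16 : ℝ) ^ (1 / (p - 1)) ≤ T := by
  classical
  have hn' : (0 : ℝ) < n := by exact_mod_cast hn
  have hk' : (0 : ℝ) < k := by exact_mod_cast hk
  have hL' : (0 : ℝ) < L := by exact_mod_cast hL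
  have hp1 : p - 1 ≠ 0 := by linarith
  set K := 2 + L with hK
  set q : ℝ := (k * n / 16 : ℝ) ^ (1 / (p - 1)) with hq
  have hbase : (0 : ℝ) < k * n / 16 := by positivity
  have hq0 : 0 < q := Real.rpow_pos_of_pos hbase _
  -- Chosen so that the initial term `A J` is at most `n / 8`, half of the final sum `n / 4` of the
  -- slow barriers.
  set η : ℝ := 1 / (q * L) with hη
  have hη0 : 0 < η := by positivity
  have hηp : η ^ (1 - p) = k * n / 16 * (L : ℝ) ^ (p - 1) := by
    rw [hη, one_div, Real.inv_rpow (by positivity), ← Real.rpow_neg (by positivity), neg_sub,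
      Real.mul_rpow hq0.le hL'.le, hq, ← Real.rpow_mul hbase.le, one_div_mul_cancel hp1,
      Real.rpow_one]
  -- Raising a slow vertex by `δ` to `c 1` lowers `J` by `2 k δ^p`, so `A` times the drop is
  -- `η^(1-p) δ^p`.
  set A : ℝ := η ^ (1 - p) / (2 * k) with hA
  have hA0 : 0 ≤ A := by positivity
  -- Layer `0` acts through its individual vertices, so its common node is cut off. The common node
  -- of layer `1` stands for `k` vertices, whence `k` times the balance equation of one of them; at
  -- layer `2` the weight `k` counts the neighbours below.
  set ω : ℕ → ℝ := fun i => if i = 0 then 0 else if i = 1 then k else 1 with hωdef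
  have hω : ∀ i, 0 ≤ ω i := by
    intro i; simp only [hωdef]; split_ifs <;> positivity
  set J : (ℕ → ℝ) × (V → ℝ) → ℝ := fun s => netEnergy K lay {0} ω k p s.1 s.2 with hJ
  set P : (ℕ → ℝ) × (V → ℝ) → ℝ := fun s => ∑ u ∈ layerSet lay 0, s.2 u + A * J s with hP
  set Inv : (ℕ → ℝ) × (V → ℝ) → Prop := fun s => ∀ l, K ≤ l → s.1 l = 1 with hInv
  have hmem : ∀ u, lay u ∈ ({0} : Finset ℕ) ↔ lay u = 0 := fun u => by simp
  have hstep : ∀ s, Inv s → ∀ f : V → ℝ, (∀ u, f u ≤ barrier lay {0} s u) → (∀ u, f u ≤ 1) →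
      ∀ u, ∃ s', Inv s' ∧ (∀ x, barrier lay {0} s x ≤ barrier lay {0} s' x) ∧
        argminValue G p f u ≤ barrier lay {0} s' u ∧ P s' ≤ P s + η := by
    rintro ⟨c, x⟩ hs f hf hf1 u
    rcases Nat.lt_or_ge (lay u) K with hu | hu
    swap
    · refine ⟨(c, x), hs, fun _ => le_rfl, ?_, by linarith⟩
      rw [barrier_of_notMem (by rw [hmem]; omega)]
      rw [show (c, x).1 (lay u) = 1 from hs _ hu]
      exact argminValue_le_of_forall_le hp (hadj u) hf1
    rcases Nat.eq_zero_or_pos (lay u) with hu0 | hu1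
    · have harg : argminValue G p f u ≤ c 1 := by
        refine argminValue_le_of_sum hlay hp hadj hf u _ ?_
        rw [hu0, if_neg (by omega), add_zero, zero_add]
        refine Finset.sum_nonpos fun w hw => ?_
        have hw1 := mem_layerSet.1 hw
        rw [barrier_of_notMem (by rw [hmem]; omega), hw1, sub_self, signedPow_zero hp]
      refine ⟨(c, Function.update x u (max (x u) (c 1))), hs,
        barrier_mono _ _ (fun _ => le_rfl) (le_update_max x u _), ?_, ?_⟩
      · rw [barrier_of_mem (by rw [hmem]; exact hu0)]
        simpa using Or.inr harg
      · rcases le_total (c 1) (x u) with h | h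
        · rw [max_eq_left h, Function.update_eq_self]; linarith
        · rw [max_eq_right h]
          have hdrop := netEnergy_raise_vertex (K := K) (slow := {0}) (ω := ω) (μ := k) (s := p)
            c x (by rw [hmem]; exact hu0) hu (c 1)
          rw [hu0, zero_add, if_neg (by omega), sub_self, abs_zero,
            Real.zero_rpow (by linarith), abs_of_nonneg (by linarith)] at hdrop
          have hsum : ∑ w ∈ layerSet lay 0, Function.update x u (c 1) w =
              ∑ w ∈ layerSet lay 0, x w + (c 1 - x u) := by
            have hu' : u ∈ layerSet lay 0 := mem_layerSet.2 hu0
            rw [Finset.sum_update_of_mem hu', Finset.sum_eq_add_sum_sdiff_singleton_of_mem hu' x]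
            ring
          have hkey := le_add_rpow_mul hp hη0 (by linarith : 0 ≤ c 1 - x u)
          simp only [hP, hJ]
          rw [hsum]
          have e : A * (2 * (k * ((c 1 - x u) ^ p - 0 + 0))) =
              η ^ (1 - p) * (c 1 - x u) ^ p := by
            rw [hA]; field_simp; ring
          have := congrArg (A * ·) hdrop
          simp only [mul_sub] at this e
          linarith
    · have hne : (Finset.univ.filter fun w => G.Adj u w).Nonempty := by
        obtain ⟨w, hw⟩ := hadj u
        exact ⟨w, by simpa using hw⟩
      -- `Y` is the exact balance point of the barriers. Its equation is that of the network, up to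
      -- the factor `k` at layer `1`, so raising the common barrier to `Y` does not increase `J`.
      obtain ⟨Y, hY⟩ := exists_sum_signedPow_eq_zero hp hne (barrier lay {0} (c, x))
      have hY' : ∑ w ∈ layerSet lay (lay u + 1), signedPow p (barrier lay {0} (c, x) w - Y) +
          ∑ w ∈ layerSet lay (lay u - 1), signedPow p (barrier lay {0} (c, x) w - Y) = 0 := by
        have := hlay.sum_neighborFinset u fun w => signedPow p (barrier lay {0} (c, x) w - Y)
        rw [if_pos (by omega)] at this
        rw [← this, ← hY]
        refine Finset.sum_congr ?_ fun _ _ => rfl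
        ext w; simp
      refine ⟨(Function.update c (lay u) (max (c (lay u)) Y), x), ?_,
        barrier_mono _ _ (le_update_max c _ _) (fun _ => le_rfl), ?_, ?_⟩
      · intro l hl
        simp only
        rw [Function.update_of_ne (by omega)]
        exact hs l hl
      · rw [barrier_of_notMem (by rw [hmem]; omega)]
        have : argminValue G p f u ≤ Y := by
          refine argminValue_le_of_sum hlay hp hadj hf u _ ?_
          rw [if_pos (by omega), hY']
        simpa using Or.inr this
      · have hle : J (Function.update c (lay u) (max (c (lay u)) Y), x) ≤ J (c, x) := by
          refine netEnergy_raise_layer_le hω hk'.le hp c x hu Y ?_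
          rw [sum_layerSet_const (a := signedPow p (c (lay u + 1) - Y))
            (fun w hw => by rw [barrier_of_notMem (by rw [hmem]; omega), hw]),
            h2 _ (by omega) (by omega)] at hY'
          rw [if_pos (by omega), if_neg (by simp), zero_add]
          rcases (by omega : lay u = 1 ∨ 2 ≤ lay u) with h | h
          · rw [h] at hY' ⊢
            rw [Finset.sum_congr rfl (g := fun w => signedPow p (x w - Y)) fun w hw => by
              rw [barrier_of_mem (by rw [hmem]; exact mem_layerSet.1 hw)]] at hY'
            simp only [hωdef]
            norm_num at hY' ⊢
            rw [← mul_add, hY', mul_zero]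
          · rw [sum_layerSet_const (a := signedPow p (c (lay u - 1) - Y))
              (fun w hw => by rw [barrier_of_notMem (by rw [hmem]; omega), hw])] at hY'
            rw [if_neg (by simp; omega), mul_zero, add_zero]
            simp only [hωdef]
            rw [if_neg (by omega), if_neg (by omega), if_neg (by omega)]
            rcases (by omega : lay u = 2 ∨ 3 ≤ lay u) with h' | h'
            · rw [h'] at hY' ⊢
              rw [show 2 - 1 = 1 from rfl, h1] at hY'
              norm_num at hY' ⊢
              exact hY'.ge
            · rw [h2 _ (by omega) (by omega)] at hY'
              rw [if_neg (by omega)]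
              norm_num at hY' ⊢
              exact hY'.ge
        simp only [hP]
        have := mul_le_mul_of_nonneg_left hle hA0
        linarith
  obtain ⟨s, -, hfs, hPs⟩ := exists_barrier Inv (barrier lay {0}) P η hp hadj hstep
    (s₀ := (ramp 2 L, fun _ => 0)) (fun l hl => ramp_of_ge hL hl)
    (f₀ := fun u => ramp 2 L (lay u)) (fun u => by
      unfold barrier
      split_ifs with h
      · rw [hmem] at h
        simp only
        rw [ramp_of_le (by omega)]
      · exact le_rfl) (fun u => (ramp_mem_Icc _ _ _).2) v T
  have hJ0 : J (ramp 2 L, fun _ => 0) ≤ 4 * 1 * (L : ℝ) ^ (1 - p) :=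
    netEnergy_ramp_le hp hL rfl (by simp) (fun i hi => by
      simp only [hωdef]; rw [if_neg (by omega), if_neg (by omega)]) zero_le_one
  have hsum : (n : ℝ) / 4 ≤ ∑ u ∈ layerSet lay 0, s.2 u := by
    have : ∑ u ∈ layerSet lay 0, (1 / 4 : ℝ) ≤ ∑ u ∈ layerSet lay 0, s.2 u := by
      refine Finset.sum_le_sum fun u hu => ?_
      have hu' := mem_layerSet.1 hu
      have := hfs u
      rw [barrier_of_mem (by rw [hmem]; exact hu')] at this
      exact (hT u hu').trans this
    rw [Finset.sum_const, h0, nsmul_eq_mul] at this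
    linarith
  have hJs : 0 ≤ A * J s := mul_nonneg hA0 (netEnergy_nonneg hω hk'.le _ _ _)
  have hAJ : A * J (ramp 2 L, fun _ => 0) ≤ n / 8 := by
    refine (mul_le_mul_of_nonneg_left hJ0 hA0).trans (le_of_eq ?_)
    have e : (L : ℝ) ^ (p - 1) * (L : ℝ) ^ (1 - p) = 1 := by
      rw [← Real.rpow_add hL', show p - 1 + (1 - p) = 0 by ring, Real.rpow_zero]
    have e' : k * n / 16 * (L : ℝ) ^ (p - 1) / (2 * k) * (4 * 1 * (L : ℝ) ^ (1 - p)) =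
        n / 8 * ((L : ℝ) ^ (p - 1) * (L : ℝ) ^ (1 - p)) := by
      field_simp; norm_num
    rw [hA, hηp, e', e, mul_one]
  simp only [hP] at hPs
  simp only [Finset.sum_const_zero, zero_add] at hPs
  have hfin : (n : ℝ) / 8 ≤ η * T := by linarith
  have : (n : ℝ) * L / 8 * q = n / 8 / η := by rw [hη]; field_simp
  rw [this, div_le_iff₀ hη0]
  linarith

end Barrier

/-! ### Averaging against lagging values for `2 ≤ p` -/

section Lag

variable {ι : Type*}

/-- If `|x| ≤ σ`, the power-mean inequality is applied to `half_rpow_le_signedPow_sub`; if `|x| ≥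
σ`, the bound `half_abs_rpow_mul_le_signedPow_sub` is linear in the lags, and only their mean
matters. -/
theorem card_mul_le_sum_signedPow_sub {p : ℝ} (hp : 2 ≤ p) {S : Finset ι} (hS : S.Nonempty)
    {s : ι → ℝ} (hs : ∀ i ∈ S, 0 ≤ s i) {σ : ℝ} (hσ : ∑ i ∈ S, s i = S.card * σ) (x : ℝ) :
    S.card * ((1 / 2 : ℝ) ^ (p - 1) * (max |x| σ) ^ (p - 2) * σ) ≤
      ∑ i ∈ S, (signedPow p x - signedPow p (x - s i)) := by
  have hc : (0 : ℝ) < S.card := by exact_mod_cast hS.card_pos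
  have hσ0 : 0 ≤ σ := by
    have := Finset.sum_nonneg hs
    rw [hσ] at this
    exact nonneg_of_mul_nonneg_right this hc
  rcases le_total |x| σ with h | h
  · rw [max_eq_right h]
    have e : (1 / 2 : ℝ) ^ (p - 1) * σ ^ (p - 2) * σ = (σ / 2) ^ (p - 1) := by
      rcases hσ0.eq_or_lt with h0 | h0
      · rw [← h0, mul_zero, zero_div, Real.zero_rpow (by linarith)]
      · rw [mul_assoc, ← Real.rpow_add_one h0.ne', show p - 2 + 1 = p - 1 by ring,
          ← Real.mul_rpow (by norm_num) hσ0]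
        congr 1; ring
    rw [e]
    have h1 : ∑ i ∈ S, (s i / 2) ^ (p - 1) ≤
        ∑ i ∈ S, (signedPow p x - signedPow p (x - s i)) :=
      Finset.sum_le_sum fun i hi => half_rpow_le_signedPow_sub hp (hs i hi) x
    have h2 := Real.rpow_sum_le_const_mul_sum_rpow_of_nonneg (s := S) (f := fun i => s i / 2)
      (p := p - 1) (by linarith) fun i hi => div_nonneg (hs i hi) two_pos.le
    rw [← Finset.sum_div, hσ, mul_div_assoc, Real.mul_rpow hc.le (by linarith),
      show p - 1 = (p - 1 - 1) + 1 by ring, Real.rpow_add_one hc.ne', mul_assoc,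
      add_sub_cancel_right] at h2
    have h3 := le_of_mul_le_mul_left h2 (Real.rpow_pos_of_pos hc _)
    rw [show p - 1 - 1 + 1 = p - 1 by ring] at h3
    exact h3.trans h1
  · rw [max_eq_left h]
    have h1 : ∑ i ∈ S, |x| ^ (p - 2) * s i / 2 ≤
        ∑ i ∈ S, (signedPow p x - signedPow p (x - s i)) :=
      Finset.sum_le_sum fun i hi => half_abs_rpow_mul_le_signedPow_sub hp (hs i hi) x
    rw [← Finset.sum_div, ← Finset.mul_sum, hσ] at h1
    refine le_trans ?_ h1
    have h2 : (1 / 2 : ℝ) ^ (p - 1) ≤ 1 / 2 := by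
      have := Real.rpow_le_rpow_of_exponent_ge (by norm_num : (0 : ℝ) < 1 / 2) (by norm_num)
        (by linarith : (1 : ℝ) ≤ p - 1)
      rwa [Real.rpow_one] at this
    have h3 : 0 ≤ (S.card : ℝ) * (|x| ^ (p - 2) * σ) := by positivity
    calc _ = (1 / 2 : ℝ) ^ (p - 1) * (S.card * (|x| ^ (p - 2) * σ)) := by ring
      _ ≤ 1 / 2 * (S.card * (|x| ^ (p - 2) * σ)) := mul_le_mul_of_nonneg_right h2 h3
      _ = _ := by ring

/-- The weight of the lagging values in the averages that dominate the minimizer. -/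
noncomputable def lagWeight (p : ℝ) : ℝ := (1 / 4 : ℝ) ^ (p - 1) / (p - 1)

theorem lagWeight_pos {p : ℝ} (hp : 1 < p) : 0 < lagWeight p :=
  div_pos (Real.rpow_pos_of_pos (by norm_num) _) (by linarith)

theorem lagWeight_le {p : ℝ} (hp : 2 ≤ p) : lagWeight p ≤ 1 / 4 := by
  have := Real.rpow_le_rpow_of_exponent_ge (by norm_num : (0 : ℝ) < 1 / 4) (by norm_num)
        (by linarith : (1 : ℝ) ≤ p - 1)
  rw [Real.rpow_one] at this
  rw [lagWeight, div_le_iff₀ (by linarith)]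
  linarith

/-- The derivative bound is matched with the gain in `card_mul_le_sum_signedPow_sub`; `lagWeight` is
the value with `(p - 1) 2^(p-2) * 2 * lagWeight p = (1/2)^(p-1)`. -/
theorem signedPow_sub_lag_le {p x σ η : ℝ} (hp : 2 ≤ p) (hη : 0 ≤ η)
    (hησ : η ≤ lagWeight p * σ) :
    signedPow p x - signedPow p (x - 2 * η) ≤
      (1 / 2 : ℝ) ^ (p - 1) * (max |x| σ) ^ (p - 2) * σ := by
  have hl := lagWeight_pos (by linarith : 1 < p)
  have hl4 := lagWeight_le hp
  have hσ0 : 0 ≤ σ := by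
    by_contra! h
    linarith [mul_neg_of_pos_of_neg hl h]
  have hm : 0 < p - 1 := by linarith
  set X := max |x| σ with hX
  have hX0 : 0 ≤ X := hσ0.trans (le_max_right _ _)
  have h1 := signedPow_sub_le_of_two_le hp (show x - 2 * η ≤ x by linarith)
  have h2 : max |x| |x - 2 * η| ≤ 2 * X := by
    have hx : |x| ≤ X := le_max_left _ _
    have hs : σ ≤ X := le_max_right _ _
    refine max_le (by linarith) ((abs_sub _ _).trans ?_)
    rw [abs_of_nonneg (by linarith : 0 ≤ 2 * η)]
    nlinarith
  have h3 : (max |x| |x - 2 * η|) ^ (p - 2) ≤ 2 ^ (p - 2) * X ^ (p - 2) := by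
    rw [← Real.mul_rpow two_pos.le hX0]
    exact Real.rpow_le_rpow ((abs_nonneg x).trans (le_max_left _ _)) h2 (by linarith)
  refine h1.trans ?_
  have e : (p - 1) * (2 ^ (p - 2) * X ^ (p - 2)) * (2 * (lagWeight p * σ)) =
      (1 / 2 : ℝ) ^ (p - 1) * X ^ (p - 2) * σ := by
    have e1 : (2 : ℝ) ^ (p - 2) * 2 = 2 ^ (p - 1) := by
      rw [← Real.rpow_add_one two_ne_zero]; ring_nf
    have e2 : (2 : ℝ) ^ (p - 1) * (1 / 4 : ℝ) ^ (p - 1) = (1 / 2 : ℝ) ^ (p - 1) := by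
      rw [← Real.mul_rpow two_pos.le (by norm_num)]; norm_num
    have e3 : (p - 1) * lagWeight p = (1 / 4 : ℝ) ^ (p - 1) := by
      rw [lagWeight]; field_simp
    calc _ = (2 ^ (p - 2) * 2) * ((p - 1) * lagWeight p) * X ^ (p - 2) * σ := by ring
      _ = _ := by rw [e1, e3, e2]
  rw [← e]
  have : 0 ≤ (2 : ℝ) ^ (p - 2) * X ^ (p - 2) := by positivity
  have hd : x - (x - 2 * η) ≤ 2 * (lagWeight p * σ) := by linarith
  have hd0 : 0 ≤ x - (x - 2 * η) := by linarith
  gcongr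

/-- Only the side with the larger mean lag is exploited; on the other one all values are replaced by
`β`. With `x = α - Y` and `2 η = lagWeight p * (σ + σ')` one has `β - Y = -(x - 2 η)` for this
halved `η ≤ lagWeight p * σ`. -/
theorem sum_signedPow_lag_le_aux {p : ℝ} (hp : 2 ≤ p) {S T : Finset ι} (hS : S.Nonempty)
    (hST : T.card = S.card) {g : ι → ℝ} {α β Y σ σ' : ℝ} (hα : ∀ i ∈ S, g i ≤ α)
    (hβ : ∀ i ∈ T, g i ≤ β) (hσS : ∑ i ∈ S, g i = S.card * (α - σ))
    (hσT : ∑ i ∈ T, g i = S.card * (β - σ')) (hσ : σ' ≤ σ)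
    (hY : 2 * Y = α + β - lagWeight p * (σ + σ')) :
    ∑ i ∈ S, signedPow p (g i - Y) + ∑ i ∈ T, signedPow p (g i - Y) ≤ 0 := by
  have hp1 : 1 < p := by linarith
  have hc : (0 : ℝ) < S.card := by exact_mod_cast hS.card_pos
  have hl := lagWeight_pos hp1
  have h1 : ∀ (U : Finset ι) (a τ : ℝ), U.card = S.card → (∀ i ∈ U, g i ≤ a) →
      ∑ i ∈ U, g i = S.card * (a - τ) → 0 ≤ τ := by
    intro U a τ hU ha hτ
    have := Finset.sum_le_sum ha
    rw [hτ, Finset.sum_const, nsmul_eq_mul, hU] at this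
    linarith [le_of_mul_le_mul_left this hc]
  have hσ0 := h1 S α σ rfl hα hσS
  have hσ0' := h1 T β σ' hST hβ hσT
  set x := α - Y with hx
  set η := lagWeight p * (σ + σ') / 2 with hη
  have hη0 : 0 ≤ η := by positivity
  have hησ : η ≤ lagWeight p * σ := by rw [hη]; nlinarith
  have hmain := card_mul_le_sum_signedPow_sub hp hS (s := fun i => α - g i) (σ := σ)
    (fun i hi => by linarith [hα i hi]) (by
      rw [Finset.sum_sub_distrib, hσS, Finset.sum_const, nsmul_eq_mul]; ring) x
  rw [Finset.sum_sub_distrib, Finset.sum_const, nsmul_eq_mul] at hmain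
  have e : ∀ i, x - (α - g i) = g i - Y := fun i => by rw [hx]; ring
  simp only [e] at hmain
  have hlag := mul_le_mul_of_nonneg_left (signedPow_sub_lag_le (x := x) hp hη0 hησ) hc.le
  have hT : ∑ i ∈ T, signedPow p (g i - Y) ≤ S.card * -signedPow p (x - 2 * η) := by
    rw [← signedPow_neg hp1, ← hST, ← nsmul_eq_mul]
    refine Finset.sum_le_card_nsmul _ _ _ fun i hi => signedPow_mono hp1 ?_
    have := hβ i hi
    rw [hx, hη]; linarith
  rw [mul_sub] at hlag
  linarith

/-- If the values on `S` and `T` lag behind `α` and `β`, then the mean in which the lags are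
discounted by `lagWeight p` dominates the minimizer of the local `ℓ^p` energy. -/
theorem sum_signedPow_lag_le {p : ℝ} (hp : 2 ≤ p) {S T : Finset ι} {k : ℕ} (hk : 0 < k)
    (hS : S.card = k) (hT : T.card = k) {g : ι → ℝ} {α β Y : ℝ} (hα : ∀ i ∈ S, g i ≤ α)
    (hβ : ∀ i ∈ T, g i ≤ β)
    (hY : 2 * k * Y = (1 - lagWeight p) * k * (α + β) +
      lagWeight p * (∑ i ∈ S, g i + ∑ i ∈ T, g i)) :
    ∑ i ∈ S, signedPow p (g i - Y) + ∑ i ∈ T, signedPow p (g i - Y) ≤ 0 := by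
  have hk' : (0 : ℝ) < k := by exact_mod_cast hk
  have hSn : S.Nonempty := Finset.card_pos.1 (by omega)
  have hTn : T.Nonempty := Finset.card_pos.1 (by omega)
  have eS : ∑ i ∈ S, g i = k * (α - (α - (∑ i ∈ S, g i) / k)) := by field_simp; ring
  have eT : ∑ i ∈ T, g i = k * (β - (β - (∑ i ∈ T, g i) / k)) := by field_simp; ring
  have hY' : 2 * Y = α + β -
      lagWeight p * ((α - (∑ i ∈ S, g i) / k) + (β - (∑ i ∈ T, g i) / k)) := by
    field_simp
    linear_combination hY
  rcases le_total (β - (∑ i ∈ T, g i) / k) (α - (∑ i ∈ S, g i) / k) with h | h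
  · exact sum_signedPow_lag_le_aux hp hSn (by rw [hS, hT]) hα hβ (by rwa [hS]) (by rwa [hS]) h hY'
  · rw [add_comm]
    refine sum_signedPow_lag_le_aux hp hTn (by rw [hS, hT]) hβ hα (by rwa [hT]) (by rwa [hT]) h ?_
    rw [hY']; ring

theorem sum_signedPow_lag_le_one_sided {p : ℝ} (hp : 2 ≤ p) {S : Finset ι} {k : ℕ} (hk : 0 < k)
    (hS : S.card = k) {g : ι → ℝ} {α Y : ℝ} (hα : ∀ i ∈ S, g i ≤ α)
    (hY : k * Y = (1 - lagWeight p) * k * α + lagWeight p * ∑ i ∈ S, g i) :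
    ∑ i ∈ S, signedPow p (g i - Y) ≤ 0 := by
  have := sum_signedPow_lag_le hp hk hS hS hα hα (Y := Y) (by linear_combination 2 * hY)
  linarith

end Lag

/-! ### Slow chains of complete bipartite pieces for `2 ≤ p` -/

section Chain

variable {V : Type*} [Fintype V]

/-- The odd numbers below `2 * r`. -/
def oddBelow (r : ℕ) : Finset ℕ := (Finset.range r).image fun j => 2 * j + 1

theorem mem_oddBelow {r l : ℕ} : l ∈ oddBelow r ↔ l % 2 = 1 ∧ l < 2 * r := by
  simp only [oddBelow, Finset.mem_image, Finset.mem_range]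
  constructor
  · rintro ⟨j, hj, rfl⟩; omega
  · rintro ⟨h1, h2⟩; exact ⟨l / 2, by omega, by omega⟩

theorem card_oddBelow (r : ℕ) : (oddBelow r).card = r := by
  rw [oddBelow, Finset.card_image_of_injective _ fun a b h => by simpa using h, Finset.card_range]

/-- The conductances of the chain of barriers. -/
noncomputable def chainWeight (r k : ℕ) (lam κ : ℝ) (i : ℕ) : ℝ :=
  if i < 2 * r then (1 - lam) * k else if i = 2 * r then k else if i = 2 * r + 1 then k / κ
    else k / κ ^ 2

/-- In a layered graph with `k` vertices in each of the layers below `2 * r + 2`, and one in each of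
the next layers, it takes long until all odd layers below `2 * r` have left the vicinity of `0`. -/
theorem le_time_of_two_le {p : ℝ} (hp : 2 ≤ p) {G : SimpleGraph V} {lay : V → ℕ}
    (hlay : IsLayered G lay) (hadj : ∀ v, ∃ w, G.Adj v w) {r k L : ℕ} (hr : 0 < r) (hk : 0 < k)
    (hL : 0 < L) (h1 : ∀ l, l < 2 * r + 2 → (layerSet lay l).card = k)
    (h2 : ∀ l, 2 * r + 2 ≤ l → l ≤ 2 * r + 2 + L → (layerSet lay l).card = 1)
    (v : ℕ → V) (T : ℕ)
    (hT : ∀ u, lay u < 2 * r → 1 / 4 ≤ opinion G p (fun u => ramp (2 * r + 2) L (lay u)) v T u) :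
    lagWeight p / 64 * ((r : ℝ) ^ 2 * L * k * ((k : ℝ) ^ (1 / (p - 1))) ^ 2) ≤ T := by
  classical
  have hp1 : 1 < p := by linarith
  have hr' : (0 : ℝ) < r := by exact_mod_cast hr
  have hk' : (0 : ℝ) < k := by exact_mod_cast hk
  have hL' : (0 : ℝ) < L := by exact_mod_cast hL
  set h := 2 * r + 2 with hh
  set K := h + L with hK
  set lam := lagWeight p with hlam
  have hl0 : 0 < lam := lagWeight_pos hp1
  have hl4 : lam ≤ 1 / 4 := lagWeight_le hp
  set κ : ℝ := (k : ℝ) ^ (1 / (p - 1)) with hκ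
  have hκ0 : 0 < κ := Real.rpow_pos_of_pos hk' _
  have hκp : κ ^ (p - 1) = k := by
    rw [hκ, ← Real.rpow_mul hk'.le, one_div_mul_cancel (by linarith), Real.rpow_one]
  -- Chosen so that the initial `A J` is at most `r k / 8`, half of what the `r k` slow barriers
  -- must finally sum to. A rise `δ` of a slow vertex lowers `J` by `4 lam δ²`, which determines `A`
  -- below.
  set η : ℝ := 8 / (κ ^ 2 * lam * L * r) with hη
  have hη0 : 0 < η := by positivity
  set A : ℝ := 1 / (4 * lam * η) with hA
  have hA0 : 0 ≤ A := by positivity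
  -- Each bond next to a slow layer has total weight `k`: `(1 - lam) k` through the common node and
  -- `lam` through each of the `k` individual vertices. At layers `2r+1` and `2r+2`, with `k`
  -- neighbours below and one above, the minimizer weighs the lower value `κ = k^(1/(p-1))` times as
  -- much, so the conductance drops by `κ` twice.
  set ω : ℕ → ℝ := chainWeight r k lam κ with hωdef
  have hω : ∀ i, 0 ≤ ω i := by
    intro i
    have : 0 ≤ 1 - lam := by linarith
    simp only [hωdef, chainWeight]; split_ifs <;> positivity
  have hω1 : ∀ i, i < 2 * r → ω i = (1 - lam) * k := fun i hi => if_pos hi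
  have hω2 : ω (2 * r) = k := by simp [hωdef, chainWeight]
  have hω3 : ω (2 * r + 1) = k / κ := by simp [hωdef, chainWeight]
  have hω4 : ∀ i, h ≤ i → ω i = k / κ ^ 2 := fun i hi => by
    simp only [hωdef, chainWeight]
    rw [if_neg (by omega), if_neg (by omega), if_neg (by omega)]
  set slow := oddBelow r with hslow
  have hmem : ∀ l, l ∈ slow ↔ l % 2 = 1 ∧ l < 2 * r := fun l => mem_oddBelow
  set J : (ℕ → ℝ) × (V → ℝ) → ℝ := fun s => netEnergy K lay slow ω lam 2 s.1 s.2 with hJ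
  set Sl : Finset V := Finset.univ.filter fun u => lay u ∈ slow with hSl
  set P : (ℕ → ℝ) × (V → ℝ) → ℝ := fun s => ∑ u ∈ Sl, s.2 u + A * J s with hP
  -- A slow layer also keeps a common value, which dominates its individual barriers; the
  -- differences are the lags in `sum_signedPow_lag_le`.
  set Inv : (ℕ → ℝ) × (V → ℝ) → Prop := fun s => (∀ l, K ≤ l → s.1 l = 1) ∧
    ∀ v, lay v ∈ slow → s.2 v ≤ s.1 (lay v) with hInv
  have hstep : ∀ s, Inv s → ∀ f : V → ℝ, (∀ u, f u ≤ barrier lay slow s u) → (∀ u, f u ≤ 1) →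
      ∀ u, ∃ s', Inv s' ∧ (∀ x, barrier lay slow s x ≤ barrier lay slow s' x) ∧
        argminValue G p f u ≤ barrier lay slow s' u ∧ P s' ≤ P s + η := by
    rintro ⟨c, x⟩ ⟨hs, hx⟩ f hf hf1 u
    simp only at hs hx
    rcases Nat.lt_or_ge (lay u) K with hu | hu
    swap
    · refine ⟨(c, x), ⟨hs, hx⟩, fun _ => le_rfl, ?_, by linarith⟩
      rw [barrier_of_notMem (by rw [hmem]; omega)]
      rw [show (c, x).1 (lay u) = 1 from hs _ hu]
      exact argminValue_le_of_forall_le hp1 (hadj u) hf1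
    set b := barrier lay slow (c, x) with hb
    have hbc : ∀ w, b w ≤ c (lay w) := by
      intro w
      by_cases hw : lay w ∈ slow
      · rw [hb, barrier_of_mem hw]; exact hx w hw
      · rw [hb, barrier_of_notMem hw]
    have hbs : ∀ l, l ∈ slow → ∀ Φ : ℝ → ℝ,
        ∑ w ∈ layerSet lay l, Φ (b w) = ∑ w ∈ layerSet lay l, Φ (x w) := fun l hl Φ =>
      Finset.sum_congr rfl fun w hw => by
        rw [hb, barrier_of_mem (by rw [mem_layerSet.1 hw]; exact hl)]
    have hbn : ∀ l, l ∉ slow → ∀ Φ : ℝ → ℝ,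
        ∑ w ∈ layerSet lay l, Φ (b w) = (layerSet lay l).card * Φ (c l) := fun l hl Φ =>
      sum_layerSet_const fun w hw => by rw [hb, barrier_of_notMem (by rw [hw]; exact hl), hw]
    have hInv' : ∀ Y, Inv (Function.update c (lay u) (max (c (lay u)) Y), x) := by
      refine fun Y => ⟨fun l hl => ?_, fun w hw => (hx w hw).trans (le_update_max c _ _ _)⟩
      simp only
      rw [Function.update_of_ne (by omega)]
      exact hs l hl
    have hraise : ∀ Y,
        ∑ w ∈ layerSet lay (lay u + 1), signedPow p (b w - Y) +
          (if 1 ≤ lay u then ∑ w ∈ layerSet lay (lay u - 1), signedPow p (b w - Y) else 0) ≤ 0 →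
        lay u ∉ slow →
        0 ≤ ω (lay u) * (c (lay u + 1) - Y) +
          (if 1 ≤ lay u then ω (lay u - 1) * (c (lay u - 1) - Y) else 0) +
          lam * ((if lay u + 1 ∈ slow then ∑ w ∈ layerSet lay (lay u + 1), (x w - Y) else 0) +
            (if 1 ≤ lay u ∧ lay u - 1 ∈ slow then
              ∑ w ∈ layerSet lay (lay u - 1), (x w - Y) else 0)) →
        ∃ s', Inv s' ∧ (∀ x_1, b x_1 ≤ barrier lay slow s' x_1) ∧
          argminValue G p f u ≤ barrier lay slow s' u ∧ P s' ≤ P (c, x) + η := by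
      intro Y hY hns hrow
      refine ⟨(Function.update c (lay u) (max (c (lay u)) Y), x), hInv' Y,
        barrier_mono _ _ (le_update_max c _ _) (fun _ => le_rfl), ?_, ?_⟩
      · rw [barrier_of_notMem hns]
        simpa using Or.inr (argminValue_le_of_sum hlay hp1 hadj hf u Y hY)
      · have hle : J (Function.update c (lay u) (max (c (lay u)) Y), x) ≤ J (c, x) := by
          refine netEnergy_raise_layer_le hω hl0.le one_lt_two c x hu Y ?_
          simpa only [signedPow_two] using hrow
        simp only [hP]
        have := mul_le_mul_of_nonneg_left hle hA0
        linarith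
    rcases (by omega : (lay u % 2 = 1 ∧ lay u < 2 * r) ∨ lay u = 0 ∨
      (lay u % 2 = 0 ∧ 1 ≤ lay u ∧ lay u ≤ 2 * r) ∨ lay u = 2 * r + 1 ∨ lay u = h ∨ h < lay u)
      with hc | hc | hc | hc | hc | hc
    · have hsl : lay u ∈ slow := (hmem _).2 hc
      -- Both neighbouring layers have `k` vertices with common barriers, so the midpoint is exact
      -- for every `p`. The common node is raised first, at no energy cost; raising the individual
      -- vertex then releases the energy that pays for it.
      set Y := (c (lay u + 1) + c (lay u - 1)) / 2 with hYdef
      have harg : argminValue G p f u ≤ Y := by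
        refine argminValue_le_of_sum hlay hp1 hadj hf u Y ?_
        rw [if_pos (by omega), hbn _ (by rw [hmem]; omega) fun z => signedPow p (z - Y),
          hbn _ (by rw [hmem]; omega) fun z => signedPow p (z - Y), h1 _ (by omega),
          h1 _ (by omega), show c (lay u - 1) - Y = -(c (lay u + 1) - Y) by rw [hYdef]; ring,
          signedPow_neg hp1]
        linarith
      set c' := Function.update c (lay u) (max (c (lay u)) Y) with hc'
      have hle : J (c', x) ≤ J (c, x) := by
        refine netEnergy_raise_layer_le hω hl0.le one_lt_two c x hu Y ?_
        simp only [signedPow_two]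
        rw [if_pos (by omega), if_neg (by rw [hmem]; omega), if_neg (by rw [hmem]; omega),
          hω1 _ hc.2, hω1 _ (by omega), hYdef]
        apply le_of_eq; ring
      have hcp : c' (lay u + 1) = c (lay u + 1) := Function.update_of_ne (by omega) _ _
      have hcm : c' (lay u - 1) = c (lay u - 1) := Function.update_of_ne (by omega) _ _
      have hdrop := netEnergy_raise_vertex (K := K) (slow := slow) (ω := ω) (μ := lam) (s := 2)
            c' x hsl hu (max (x u) Y)
      refine ⟨(c', Function.update x u (max (x u) Y)), ⟨(hInv' Y).1, ?_⟩,
        barrier_mono _ _ (le_update_max c _ _) (le_update_max x u _), ?_, ?_⟩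
      · intro w hw
        simp only
        by_cases hwu : w = u
        · subst hwu
          rw [Function.update_self, hc', Function.update_self]
          exact max_le_max_right _ (hx _ hw)
        · rw [Function.update_of_ne hwu]
          exact (hInv' Y).2 w hw
      · rw [barrier_of_mem hsl]
        simpa using Or.inr harg
      · have hsum : ∑ w ∈ Sl, Function.update x u (max (x u) Y) w =
            ∑ w ∈ Sl, x w + (max (x u) Y - x u) := by
          have hu' : u ∈ Sl := by simpa [hSl] using hsl
          rw [Finset.sum_update_of_mem hu', Finset.sum_eq_add_sum_sdiff_singleton_of_mem hu' x]
          ring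
        have hle' := mul_le_mul_of_nonneg_left hle hA0
        simp only [hP]
        rw [hsum]
        rcases le_total Y (x u) with hY | hY
        · rw [max_eq_left hY, Function.update_eq_self]
          linarith
        · rw [max_eq_right hY] at hdrop ⊢
          rw [hcp, hcm, if_pos (by omega)] at hdrop
          simp only [Real.rpow_two, sq_abs] at hdrop
          have hkey := le_add_rpow_mul one_lt_two hη0 (by linarith : 0 ≤ Y - x u)
          rw [show (1 : ℝ) - 2 = -1 by norm_num, Real.rpow_neg_one, Real.rpow_two] at hkey
          have e : J (c', x) - J (c', Function.update x u Y) = 4 * lam * (Y - x u) ^ 2 := by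
            simp only [hJ]
            rw [hdrop, hYdef]; ring
          have e2 : A * (4 * lam * (Y - x u) ^ 2) = η⁻¹ * (Y - x u) ^ 2 := by
            rw [hA]; field_simp
          rw [← e, mul_sub] at e2
          linarith
    · have hsl : 0 + 1 ∈ slow := by rw [hmem]; omega
      obtain ⟨Y, hY⟩ : ∃ Y : ℝ, k * Y = (1 - lam) * k * c 1 + lam * ∑ w ∈ layerSet lay 1, b w :=
        ⟨_, mul_div_cancel₀ _ hk'.ne'⟩
      refine hraise Y ?_ (by rw [hmem]; omega) ?_
      · rw [hc, if_neg (by omega), add_zero]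
        exact sum_signedPow_lag_le_one_sided hp hk (h1 _ (by omega))
          (fun w hw => by have := hbc w; rwa [mem_layerSet.1 hw] at this) hY
      · rw [hc, if_neg (by omega), if_pos hsl, if_neg (by omega), hω1 _ (by omega),
          Finset.sum_sub_distrib, Finset.sum_const, h1 _ (by omega), nsmul_eq_mul]
        rw [hbs 1 hsl fun z => z] at hY
        apply le_of_eq
        simp only [zero_add]
        linear_combination hY
    -- Even layers: `Y` is the average in which the lags have weight `lam`. It dominates the
    -- nonlinear minimizer and is the balance point of the quadratic network. At layer `2r` the
    -- upper neighbour has no lag.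
    · obtain ⟨Y, hY⟩ : ∃ Y : ℝ, 2 * k * Y = (1 - lam) * k * (c (lay u + 1) + c (lay u - 1)) +
          lam * (∑ w ∈ layerSet lay (lay u + 1), b w + ∑ w ∈ layerSet lay (lay u - 1), b w) :=
        ⟨_, mul_div_cancel₀ _ (by positivity)⟩
      refine hraise Y ?_ (by rw [hmem]; omega) ?_
      · rw [if_pos (by omega)]
        exact sum_signedPow_lag_le hp hk (h1 _ (by omega)) (h1 _ (by omega))
          (fun w hw => by have := hbc w; rwa [mem_layerSet.1 hw] at this)
          (fun w hw => by have := hbc w; rwa [mem_layerSet.1 hw] at this) hY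
      · have hsl : lay u - 1 ∈ slow := by rw [hmem]; omega
        rw [if_pos (by omega), if_pos (show 1 ≤ lay u ∧ lay u - 1 ∈ slow from ⟨by omega, hsl⟩),
          hω1 (lay u - 1) (by omega)]
        have hsub : ∀ l, l ∈ slow → ∑ w ∈ layerSet lay l, (x w - Y) =
            ∑ w ∈ layerSet lay l, x w - k * Y := by
          intro l hl
          have := (hmem l).1 hl
          rw [Finset.sum_sub_distrib, Finset.sum_const, h1 _ (by omega), nsmul_eq_mul]
        rw [hsub _ hsl]
        rw [hbs _ hsl fun z => z] at hY
        apply le_of_eq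
        rcases hc.2.2.eq_or_lt with hc2 | hc2
        · rw [if_neg (by rw [hmem]; omega), hc2, hω2]
          rw [hbn _ (by rw [hmem]; omega) fun z => z, h1 _ (by omega), hc2] at hY
          linear_combination hY
        · have hsl' : lay u + 1 ∈ slow := by rw [hmem]; omega
          rw [if_pos hsl', hω1 _ hc2, hsub _ hsl']
          rw [hbs _ hsl' fun z => z] at hY
          linear_combination hY
    all_goals
      have hs1 : lay u + 1 ∉ slow := by rw [hmem]; omega
      have hs2 : lay u - 1 ∉ slow := by rw [hmem]; omega
    -- The layers above `h`, an ordinary path, are treated first; the two junction layers `2r+1` and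
    -- `h` share the argument after that.
    rotate_left 2
    · refine hraise ((c (lay u + 1) + c (lay u - 1)) / 2) ?_ (by rw [hmem]; omega) ?_
      · rw [if_pos (by omega), hbn _ hs1 fun z => signedPow p (z - _),
          hbn _ hs2 fun z => signedPow p (z - _), h2 _ (by omega) (by omega),
          h2 _ (by omega) (by omega), show c (lay u - 1) - (c (lay u + 1) + c (lay u - 1)) / 2 =
            -(c (lay u + 1) - (c (lay u + 1) + c (lay u - 1)) / 2) by ring, signedPow_neg hp1]
        linarith
      · rw [if_pos (by omega), if_neg hs1, if_neg (fun hq => hs2 hq.2), hω4 _ (by omega),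
          hω4 _ (by omega)]
        apply le_of_eq; ring
    all_goals
      obtain ⟨Y, hY⟩ : ∃ Y : ℝ, (1 + κ) * Y = c (lay u + 1) + κ * c (lay u - 1) :=
        ⟨_, mul_div_cancel₀ _ (by positivity)⟩
      -- As `κ^(p-1) = k`, this linear relation is the nonlinear balance of one neighbour above
      -- against `k` neighbours below.
      have hY' : c (lay u + 1) - Y = κ * -(c (lay u - 1) - Y) := by linear_combination -hY
      refine hraise Y ?_ (by rw [hmem]; omega) ?_
      · rw [if_pos (by omega), hbn _ hs1 fun z => signedPow p (z - _),
          hbn _ hs2 fun z => signedPow p (z - _), h2 _ (by omega) (by omega), h1 _ (by omega),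
          hY', signedPow_mul hp1 hκ0.le, hκp, signedPow_neg hp1, Nat.cast_one]
        linarith
      · rw [if_pos (by omega), if_neg hs1, if_neg (fun hq => hs2 hq.2), hY']
        apply le_of_eq
        first
          | (rw [hc, Nat.add_sub_cancel, hω2, hω3]; field_simp; ring)
          | (rw [hc, hω4 _ le_rfl, show h - 1 = 2 * r + 1 by omega, hω3]; field_simp; ring)
  obtain ⟨s, -, hfs, hPs⟩ := exists_barrier Inv (barrier lay slow) P η hp1 hadj hstep
    (s₀ := (ramp h L, fun _ => 0)) ⟨fun l hl => ramp_of_ge hL hl, fun w _ => (ramp_mem_Icc _ _ _).1⟩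
    (f₀ := fun u => ramp h L (lay u)) (fun u => by
      unfold barrier
      split_ifs with hq
      · rw [hmem] at hq
        simp only
        rw [ramp_of_le (by omega)]
      · exact le_rfl) (fun u => (ramp_mem_Icc _ _ _).2) v T
  have hJ0 : J (ramp h L, fun _ => 0) ≤ 4 * (k / κ ^ 2) * (L : ℝ) ^ (1 - 2 : ℝ) :=
    netEnergy_ramp_le one_lt_two hL rfl (fun l hl => by rw [hmem] at hl; omega) hω4
      (by positivity)
  rw [show (1 : ℝ) - 2 = -1 by norm_num, Real.rpow_neg_one] at hJ0
  have hcard : Sl.card = r * k := by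
    have : Sl.card = ∑ l ∈ slow, (Sl.filter fun u => lay u = l).card :=
      Finset.card_eq_sum_card_fiberwise fun u hu => by simpa [hSl] using hu
    rw [this, Finset.sum_congr rfl (g := fun _ => k), Finset.sum_const, card_oddBelow, smul_eq_mul]
    intro l hl
    have hl' := (hmem l).1 hl
    rw [← h1 l (by omega)]
    congr 1
    ext u
    simp only [hSl, layerSet, Finset.mem_filter, Finset.mem_univ, true_and]
    constructor
    · exact fun hq => hq.2
    · rintro rfl; exact ⟨hl, rfl⟩
  have hsum : (r * k : ℝ) / 4 ≤ ∑ u ∈ Sl, s.2 u := by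
    have : ∑ u ∈ Sl, (1 / 4 : ℝ) ≤ ∑ u ∈ Sl, s.2 u := by
      refine Finset.sum_le_sum fun u hu => ?_
      have hu' : lay u ∈ slow := by simpa [hSl] using hu
      have := hfs u
      rw [barrier_of_mem hu'] at this
      exact (hT u ((hmem _).1 hu').2).trans this
    rw [Finset.sum_const, hcard, nsmul_eq_mul] at this
    push_cast at this
    linarith
  have hJs : 0 ≤ A * J s := mul_nonneg hA0 (netEnergy_nonneg hω hl0.le _ _ _)
  have hAJ : A * J (ramp h L, fun _ => 0) ≤ r * k / 8 := by
    refine (mul_le_mul_of_nonneg_left hJ0 hA0).trans (le_of_eq ?_)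
    rw [hA, hη]
    field_simp
  simp only [hP] at hPs
  simp only [Finset.sum_const_zero, zero_add] at hPs
  have hfin : (r * k : ℝ) / 8 ≤ η * T := by linarith
  have : lam / 64 * ((r : ℝ) ^ 2 * L * k * κ ^ 2) = r * k / 8 / η := by
    rw [hη]; field_simp; norm_num
  rw [this, div_le_iff₀ hη0]
  linarith

end Chain

/-! ### Graphs with prescribed layers -/

section Construction

theorem exists_layers (w : ℕ → ℕ) (R : ℕ) :
    ∃ lay : Fin (∑ l ∈ Finset.range (R + 1), w l) → ℕ, (∀ v, lay v ≤ R) ∧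
      ∀ l ≤ R, (layerSet lay l).card = w l := by
  have hcard : Fintype.card (Σ l : Fin (R + 1), Fin (w l)) = ∑ l ∈ Finset.range (R + 1), w l := by
    rw [Fintype.card_sigma, ← Fin.sum_univ_eq_sum_range]
    simp
  set E := Fintype.equivFinOfCardEq hcard
  refine ⟨fun v => (E.symm v).1, fun v => Nat.lt_succ_iff.1 (E.symm v).1.2, fun l hl => ?_⟩
  have hl' : l < R + 1 := by omega
  rw [← Fintype.card_fin (w l), ← Finset.card_univ]
  refine (Finset.card_bij (fun i _ => E ⟨⟨l, hl'⟩, i⟩) (fun i _ => ?_) (fun i _ j _ hij => ?_)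
    fun v hv => ?_).symm
  · rw [mem_layerSet, Equiv.symm_apply_apply]
  · simpa using hij
  · rw [mem_layerSet] at hv
    generalize hx : E.symm v = x at hv
    obtain ⟨⟨a, ha⟩, i⟩ := x
    simp only at hv
    subst hv
    exact ⟨i, Finset.mem_univ _, by rw [← hx, Equiv.apply_symm_apply]⟩

variable {V : Type*}

/-- The graph in which two vertices are adjacent if their layers are consecutive. -/
def layeredGraph (lay : V → ℕ) : SimpleGraph V where
  Adj u v := lay u + 1 = lay v ∨ lay v + 1 = lay u
  symm := ⟨fun _ _ h => h.symm⟩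
  loopless := ⟨fun u h => by omega⟩

theorem layeredGraph_connected {lay : V → ℕ} {R : ℕ} (hR : 1 ≤ R) (hlay : ∀ v, lay v ≤ R)
    (hne : ∀ l ≤ R, ∃ v, lay v = l) : (layeredGraph lay).Connected := by
  obtain ⟨v₀, h₀⟩ := hne 0 (by omega)
  have hadj : ∀ u v, lay u + 1 = lay v ∨ lay v + 1 = lay u → (layeredGraph lay).Reachable u v :=
    fun u v h => SimpleGraph.Adj.reachable h
  have h1 : ∀ l v, lay v = l + 1 → (layeredGraph lay).Reachable v₀ v := by
    intro l
    induction l with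
    | zero => exact fun v hv => hadj _ _ (by omega)
    | succ l ih =>
      intro v hv
      obtain ⟨w, hw⟩ := hne (l + 1) (by have := hlay v; omega)
      exact (ih w hw).trans (hadj _ _ (by omega))
  have h2 : ∀ v, (layeredGraph lay).Reachable v₀ v := by
    intro v
    rcases Nat.eq_zero_or_pos (lay v) with h | h
    · obtain ⟨w, hw⟩ := hne 1 hR
      exact (h1 0 w hw).trans (hadj _ _ (by omega))
    · exact h1 (lay v - 1) v (by omega)
  exact (SimpleGraph.connected_iff_exists_forall_reachable _).2 ⟨v₀, h2⟩

theorem isLayered_layeredGraph [Fintype V] (lay : V → ℕ) : IsLayered (layeredGraph lay) lay :=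
  fun _ _ => Iff.rfl

/-- Every edge is charged to its upper endpoint, except that edges between layers `0` and `1` are
charged to the endpoint in layer `0`. Each vertex then pays for at most one layer of size at most
`k`, so the layers `0` and `R` may be arbitrarily large. -/
theorem avgDegree_le_of_isLayered [Fintype V] {G : SimpleGraph V} {lay : V → ℕ}
    (h : IsLayered G lay) {R k : ℕ} (hR : 2 ≤ R) (hlay : ∀ v, lay v ≤ R)
    (hk : ∀ l, 1 ≤ l → l < R → (layerSet lay l).card ≤ k) (hV : 0 < Fintype.card V) :
    avgDegree G ≤ 2 * k := by
  classical
  have hV' : (0 : ℝ) < Fintype.card V := by exact_mod_cast hV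
  set N₁ : V → V → ℝ := fun v w => if lay w + 1 = lay v ∧ lay w = 0 then 1 else 0 with hN₁
  set N₂ : V → V → ℝ := fun v w => if lay w + 1 = lay v ∧ 1 ≤ lay w then 1 else 0 with hN₂
  have hadj : ∀ u v, adjWeight G u v = N₁ u v + N₁ v u + (N₂ u v + N₂ v u) := by
    intro u v
    simp only [adjWeight, h u v, hN₁, hN₂]
    by_cases h1 : lay u + 1 = lay v
    · rw [if_pos (Or.inl h1), if_neg (by omega)]
      rcases Nat.eq_zero_or_pos (lay u) with h2 | h2
      · rw [if_pos ⟨h1, h2⟩, if_neg (by omega), if_neg (by omega)]; norm_num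
      · rw [if_neg (by omega), if_neg (by omega), if_pos ⟨h1, h2⟩]; norm_num
    · by_cases h1' : lay v + 1 = lay u
      · rw [if_pos (Or.inr h1')]
        rcases Nat.eq_zero_or_pos (lay v) with h2 | h2
        · rw [if_pos ⟨h1', h2⟩, if_neg (by omega), if_neg (by omega), if_neg (by omega)]; norm_num
        · rw [if_neg (by omega), if_neg (by omega), if_pos ⟨h1', h2⟩, if_neg (by omega)]
          norm_num
      · rw [if_neg (by omega), if_neg (by omega), if_neg (by omega), if_neg (by omega),
          if_neg (by omega)]
        norm_num
  have hrow : ∀ v, ∑ w, (N₁ w v + N₂ v w) ≤ k := by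
    intro v
    obtain ⟨l, hl1, hl2, hl⟩ : ∃ l, 1 ≤ l ∧ l < R ∧
        ∀ w, N₁ w v + N₂ v w ≤ if lay w = l then 1 else 0 := by
      have hv := hlay v
      rcases (by omega : lay v = 0 ∨ lay v = 1 ∨ 2 ≤ lay v) with h0 | h0 | h0
      · refine ⟨1, le_rfl, by omega, fun w => ?_⟩
        simp only [hN₁, hN₂]
        rw [if_neg (show ¬(lay w + 1 = lay v ∧ 1 ≤ lay w) by omega), add_zero]
        split_ifs <;> first | omega | norm_num
      · refine ⟨1, le_rfl, by omega, fun w => ?_⟩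
        simp only [hN₁, hN₂]
        rw [if_neg (by omega), if_neg (by omega)]
        split_ifs <;> norm_num
      · refine ⟨lay v - 1, by omega, by omega, fun w => ?_⟩
        simp only [hN₁, hN₂]
        rw [if_neg (by omega), zero_add]
        split_ifs <;> first | omega | norm_num
    refine (Finset.sum_le_sum fun w _ => hl w).trans ?_
    rw [← Finset.sum_filter, Finset.sum_const, nsmul_eq_mul, mul_one]
    exact_mod_cast hk l hl1 hl2
  have htot := sum_sum_adjWeight (G := G) hV
  have e : ∑ u, ∑ v, adjWeight G u v = 2 * ∑ v, ∑ w, (N₁ w v + N₂ v w) := by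
    simp only [hadj, Finset.sum_add_distrib]
    rw [Finset.sum_comm (f := fun u v => N₁ u v), Finset.sum_comm (f := fun u v => N₂ v u)]
    ring
  have hle : ∑ v, ∑ w, (N₁ w v + N₂ v w) ≤ Fintype.card V * k := by
    refine (Finset.sum_le_sum fun v _ => hrow v).trans (le_of_eq ?_)
    rw [Finset.sum_const, nsmul_eq_mul, Finset.card_univ]
  refine le_of_mul_le_mul_left ?_ hV'
  rw [← htot, e]
  linarith

end Construction

/-! ### From escape times to consensus times by reflection -/

theorem ofReal_le_consensusTime {V : Type*} [Fintype V] {G : SimpleGraph V} {p : ℝ} {f₀ : V → ℝ}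
    {v : ℕ → V} {ε B : ℝ} (h : ∀ t : ℕ, osc (opinion G p f₀ v t) ≤ ε → B ≤ t) :
    ENNReal.ofReal B ≤ (consensusTime G p f₀ v ε : ℝ≥0∞) := by
  have h1 : ((⌈B⌉₊ : ℕ) : ℕ∞) ≤ consensusTime G p f₀ v ε :=
    le_iInf₂ fun t ht => Nat.cast_le.2 (Nat.ceil_le.2 (h t ht))
  calc ENNReal.ofReal B ≤ ENNReal.ofReal (⌈B⌉₊ : ℝ) := ENNReal.ofReal_le_ofReal (Nat.le_ceil B)
    _ = (((⌈B⌉₊ : ℕ) : ℕ∞) : ℝ≥0∞) := by simp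
    _ ≤ _ := ENat.toENNReal_le.2 h1

/-- If some value is below `1/4`, all values are below `3/4`, and `1 - f` is the run started from
the reflected ramp. -/
theorem osc_ramp_le_half {V : Type*} [Fintype V] {G : SimpleGraph V} {p : ℝ} (hp : 1 < p)
    (hadj : ∀ v, ∃ w, G.Adj v w) {lay : V → ℕ} {h L : ℕ} (hL : 0 < L)
    (hlay : ∀ v, lay v ≤ 2 * h + L) (v : ℕ → V) (t : ℕ)
    (ht : osc (opinion G p (fun u => ramp h L (lay u)) v t) ≤ 1 / 2) :
    (∀ u, 1 / 4 ≤ opinion G p (fun u => ramp h L (lay u)) v t u) ∨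
      ∀ u, 1 / 4 ≤ opinion G p (fun u => ramp h L (2 * h + L - lay u)) v t u := by
  by_cases hq : ∀ u, 1 / 4 ≤ opinion G p (fun u => ramp h L (lay u)) v t u
  · exact Or.inl hq
  · push Not at hq
    obtain ⟨u₀, hu₀⟩ := hq
    refine Or.inr fun u => ?_
    have e : (fun u => ramp h L (2 * h + L - lay u)) = fun u => 1 - ramp h L (lay u) :=
      funext fun u => (ramp_reflect hL (hlay u)).symm
    rw [e, opinion_one_sub hp hadj]
    have := (sub_le_osc (opinion G p (fun u => ramp h L (lay u)) v t) u u₀).trans ht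
    simp only
    linarith

theorem sum_min_reflect_le {u : ℕ → ℕ} {h L : ℕ} (hu : ∀ l, h ≤ l → u l = 1) :
    ∑ l ∈ Finset.range (2 * h + L + 1), u (min l (2 * h + L - l)) ≤
      2 * ∑ l ∈ Finset.range h, u l + 2 * h + L + 1 := by
  set R := 2 * h + L with hR
  have h1 : ∀ l ∈ Finset.range (R + 1), u (min l (R - l)) ≤
      (if l < h then u l else 0) + (if R + 1 - 1 - l < h then u (R + 1 - 1 - l) else 0) + 1 := by
    intro l hl
    rw [Finset.mem_range] at hl
    rw [Nat.add_sub_cancel]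
    rcases (by omega : l < h ∨ R - l < h ∨ (h ≤ l ∧ h ≤ R - l)) with hc | hc | hc
    · rw [if_pos hc, min_eq_left (by omega)]; omega
    · rw [if_pos hc, min_eq_right (by omega)]; omega
    · rw [hu _ (le_min hc.1 hc.2)]; omega
  refine (Finset.sum_le_sum h1).trans ?_
  rw [Finset.sum_add_distrib, Finset.sum_add_distrib,
    Finset.sum_range_reflect (fun l => if l < h then u l else 0) (R + 1), ← Finset.sum_filter,
    show (Finset.range (R + 1)).filter (fun l => l < h) = Finset.range h by
      ext l; simp only [Finset.mem_filter, Finset.mem_range]; omega]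
  simp
  omega

/-- A lower bound `B` for the time that a ramp needs to flatten out on layered graphs with layers
of sizes `u` on either side of a path yields a graph with slow consensus. -/
theorem exists_graph_le_consensusTime {p : ℝ} (hp : 1 < p) {u : ℕ → ℕ} {h L k : ℕ} (hh : 2 ≤ h)
    (hL : 0 < L) (hu0 : ∀ l, 0 < u l) (hu : ∀ l, h ≤ l → u l = 1) (hk : ∀ l, 1 ≤ l → u l ≤ k)
    {B : ℝ}
    (hB : ∀ (m : ℕ) (G : SimpleGraph (Fin m)) (lay : Fin m → ℕ), IsLayered G lay →
      (∀ v, ∃ w, G.Adj v w) → (∀ l < h, (layerSet lay l).card = u l) →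
      (∀ l, h ≤ l → l ≤ h + L → (layerSet lay l).card = 1) →
      ∀ (v : ℕ → Fin m) (T : ℕ), (∀ x, 1 / 4 ≤ opinion G p (fun x => ramp h L (lay x)) v T x) →
      B ≤ T) :
    ∃ (m : ℕ) (G : SimpleGraph (Fin m)) (f₀ : Fin m → ℝ),
      m ≤ 2 * ∑ l ∈ Finset.range h, u l + 2 * h + L + 1 ∧ G.Connected ∧ avgDegree G ≤ 2 * k ∧
      (∀ x, f₀ x ∈ Set.Icc (0 : ℝ) 1) ∧
      ∀ v : ℕ → Fin m, ENNReal.ofReal B ≤ (consensusTime G p f₀ v (1 / 2) : ℝ≥0∞) := by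
  set R := 2 * h + L with hR
  obtain ⟨lay, hle, hcard⟩ := exists_layers (fun l => u (min l (R - l))) R
  have hne : ∀ l ≤ R, ∃ v, lay v = l := by
    intro l hl
    obtain ⟨v, hv⟩ := Finset.card_pos.1 ((hcard l hl).symm ▸ hu0 _)
    exact ⟨v, mem_layerSet.1 hv⟩
  have hadj : ∀ v, ∃ w, (layeredGraph lay).Adj v w := by
    intro v
    rcases Nat.eq_zero_or_pos (lay v) with h0 | h0
    · obtain ⟨w, hw⟩ := hne 1 (by omega)
      exact ⟨w, Or.inl (by omega)⟩
    · obtain ⟨w, hw⟩ := hne (lay v - 1) (by have := hle v; omega)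
      exact ⟨w, Or.inr (by omega)⟩
  obtain ⟨v₀, -⟩ := hne 0 (by omega)
  refine ⟨_, layeredGraph lay, fun x => ramp h L (lay x), sum_min_reflect_le hu,
    layeredGraph_connected (by omega) hle hne,
    avgDegree_le_of_isLayered (isLayered_layeredGraph lay) (by omega) hle (fun l h1 h2 => ?_)
      (Fintype.card_pos_iff.2 ⟨v₀⟩), fun x => ramp_mem_Icc _ _ _, fun v => ?_⟩
  · rw [hcard l h2.le]
    exact hk _ (le_min h1 (by omega))
  · refine ofReal_le_consensusTime fun t ht => ?_
    -- The graph is the same in both cases; in the second one `hB` is applied to the reversed layer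
    -- function `R - lay`.
    rcases osc_ramp_le_half hp hadj hL hle v t ht with hq | hq
    · refine hB _ _ lay (isLayered_layeredGraph lay) hadj (fun l hl => ?_) (fun l h1 h2 => ?_) v t hq
      · rw [hcard l (by omega), min_eq_left (by omega)]
      · rw [hcard l (by omega), hu _ (le_min h1 (by omega))]
    · have hset : ∀ l ≤ R, layerSet (fun x => R - lay x) l = layerSet lay (R - l) := by
        intro l hl
        ext x
        have := hle x
        simp only [mem_layerSet]
        omega
      refine hB _ _ (fun x => R - lay x) (fun x y => ?_) hadj (fun l hl => ?_) (fun l h1 h2 => ?_)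
        v t hq
      · have := hle x
        have := hle y
        change (lay x + 1 = lay y ∨ lay y + 1 = lay x) ↔
          (R - lay x + 1 = R - lay y ∨ R - lay y + 1 = R - lay x)
        omega
      · rw [hset l (by omega), hcard _ (by omega), min_eq_right (by omega)]
        congr 1; omega
      · rw [hset l (by omega), hcard _ (by omega), hu _ (le_min (by omega) (by omega))]

/-! ### The choice of the parameters -/

/-- The witness is `⌈D / 64⌉`, small enough to leave room for the other layers; for `D ≤ 64` it is
`1`, and `2 ≤ D` is just what is needed. -/
theorem exists_width {N : ℕ} {D : ℝ} (hD : 2 ≤ D) (hDN : D ≤ N) :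
    ∃ k : ℕ, 0 < k ∧ (2 * k : ℝ) ≤ D ∧ D / 64 ≤ k ∧ 64 * k ≤ N + 64 := by
  refine ⟨⌈D / 64⌉₊, Nat.ceil_pos.2 (by linarith), ?_, Nat.le_ceil _, ?_⟩
  · rcases le_total D 64 with h | h
    · have : ⌈D / 64⌉₊ ≤ 1 := Nat.ceil_le.2 (by rw [Nat.cast_one]; linarith)
      have : ((⌈D / 64⌉₊ : ℕ) : ℝ) ≤ 1 := by exact_mod_cast this
      linarith
    · have := Nat.ceil_lt_add_one (show 0 ≤ D / 64 by linarith)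
      linarith
  · have := Nat.ceil_lt_add_one (show 0 ≤ D / 64 by linarith)
    have h2 : ((64 * ⌈D / 64⌉₊ : ℕ) : ℝ) ≤ ((N + 64 : ℕ) : ℝ) := by push_cast; linarith
    exact_mod_cast h2

theorem div_two_mul_le_floor {N a : ℕ} (ha : 0 < a) (h : a ≤ N) :
    (N : ℝ) / (2 * a) ≤ ((N / a : ℕ) : ℝ) := by
  have ha' : (0 : ℝ) < a := by exact_mod_cast ha
  have h1 : 0 < N / a := Nat.div_pos h ha
  have h2 := Nat.div_add_mod N a
  have h3 := Nat.mod_lt N ha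
  rw [div_le_iff₀ (by positivity)]
  have h4 : a ≤ a * (N / a) := Nat.le_mul_of_pos_right a h1
  have h5 : N ≤ N / a * (2 * a) := by
    have : N / a * (2 * a) = 2 * (a * (N / a)) := by ring
    omega
  exact_mod_cast h5

theorem exists_slow_graph_of_le_two {p : ℝ} (hp : 1 < p) (hp2 : p ≤ 2) {N : ℕ} (hN : 64 ≤ N)
    {D : ℝ} (hD : 2 ≤ D) (hDN : D ≤ N) :
    ∃ (m : ℕ) (G : SimpleGraph (Fin m)) (f₀ : Fin m → ℝ),
      m ≤ N ∧ G.Connected ∧ avgDegree G ≤ D ∧ (∀ x, f₀ x ∈ Set.Icc (0 : ℝ) 1) ∧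
      ∀ v : ℕ → Fin m,
        ENNReal.ofReal (1 / 1024 * (1 / 16384 : ℝ) ^ (1 / (p - 1)) / rateF N p D) ≤
          (consensusTime G p f₀ v (1 / 2) : ℝ≥0∞) := by
  obtain ⟨k, hk0, hkD, hDk, hkN⟩ := exists_width hD hDN
  have hN' : (0 : ℝ) < N := by exact_mod_cast (by omega : 0 < N)
  have hk' : (0 : ℝ) < k := by exact_mod_cast hk0
  -- With `n` and `L` of order `N` and `k` of order `D`, the bound `n L (k n)^(1/(p-1))` has order
  -- `N² (N D)^(1/(p-1))`.
  set n := N / 8 with hn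
  set L := N / 4 with hL
  have hn1 : (N : ℝ) / (2 * (8 : ℕ)) ≤ n := div_two_mul_le_floor (by norm_num) (by omega)
  have hL1 : (N : ℝ) / (2 * (4 : ℕ)) ≤ L := div_two_mul_le_floor (by norm_num) (by omega)
  norm_num at hn1 hL1
  obtain ⟨m, G, f₀, hm, hG, hdeg, hf₀, ht⟩ := exists_graph_le_consensusTime hp
    (u := fun l => if l = 0 then n else if l = 1 then k else 1) (h := 2) (L := L) (k := k)
    (B := (n : ℝ) * L / 8 * (k * n / 16 : ℝ) ^ (1 / (p - 1))) le_rfl (by omega)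
    (fun l => by split_ifs <;> omega) (fun l hl => by rw [if_neg (by omega), if_neg (by omega)])
    (fun l hl => by rw [if_neg (by omega)]; split_ifs <;> omega)
    (fun m G lay hlay hadj hc1 hc2 v T hT =>
      le_time_of_le_two hp hlay hadj (by omega) hk0 (by omega) (by simpa using hc1 0 (by omega))
        (by simpa using hc1 1 (by omega)) hc2 v T fun u _ => hT u)
  refine ⟨m, G, f₀, hm.trans ?_, hG, hdeg.trans hkD, hf₀, fun v =>
    (ENNReal.ofReal_le_ofReal ?_).trans (ht v)⟩
  · simp only [Finset.sum_range_succ, Finset.sum_range_zero]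
    norm_num
    omega
  · rw [rateF_eq hp (by omega) (by linarith), rateScale, if_pos hp2, div_div_eq_mul_div, div_one]
    have hq : 0 ≤ 1 / (p - 1) := one_div_nonneg.2 (by linarith)
    have h1 : (N : ℝ) ^ 2 / 1024 ≤ n * L / 8 := by
      have : (N / 16 : ℝ) * (N / 8) ≤ n * L := mul_le_mul hn1 hL1 (by positivity) (by positivity)
      linarith
    have h2 : (1 / 16384 : ℝ) * (N * D) ≤ k * n / 16 := by
      have : D / 64 * (N / 16) ≤ k * n := mul_le_mul hDk hn1 (by positivity) (by positivity)
      linarith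
    have hND : 0 ≤ (1 / 16384 : ℝ) * (N * D) := by positivity
    calc _ = (N : ℝ) ^ 2 / 1024 * ((1 / 16384 : ℝ) * (N * D)) ^ (1 / (p - 1)) := by
          rw [Real.mul_rpow (x := 1 / 16384) (by norm_num) (by positivity)]; ring
      _ ≤ _ := by
          refine mul_le_mul h1 (Real.rpow_le_rpow hND h2 hq) (Real.rpow_nonneg hND _)
            (by positivity)

/-- With `L` of order `N` and `r` of order `N / k`, the bound `r² L k κ²` has order `N³
k^((3-p)/(p-1))`. For `p ≤ 3` the width `k` is taken of order `D`; for `p ≥ 3` the exponent is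
nonpositive and `k = 1`, a path, is used. -/
theorem exists_slow_graph_of_two_lt {p : ℝ} (hp : 2 < p) {N : ℕ} (hN : 64 ≤ N)
    {D : ℝ} (hD : 2 ≤ D) (hDN : D ≤ N) :
    ∃ (m : ℕ) (G : SimpleGraph (Fin m)) (f₀ : Fin m → ℝ),
      m ≤ N ∧ G.Connected ∧ avgDegree G ≤ D ∧ (∀ x, f₀ x ∈ Set.Icc (0 : ℝ) 1) ∧
      ∀ v : ℕ → Fin m,
        ENNReal.ofReal (lagWeight p / 33554432 / rateF N p D) ≤
          (consensusTime G p f₀ v (1 / 2) : ℝ≥0∞) := by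
  have hp1 : 1 < p := by linarith
  have hN' : (0 : ℝ) < N := by exact_mod_cast (by omega : 0 < N)
  have hθ : thetaExp p = max ((3 - p) / (p - 1)) 0 := if_neg (not_le.2 hp)
  obtain ⟨k, hk0, hkD, hDk, hkN⟩ : ∃ k : ℕ, 0 < k ∧ (2 * k : ℝ) ≤ D ∧
      D ^ thetaExp p / 64 * k ≤ ((k : ℝ) ^ (1 / (p - 1))) ^ 2 ∧ 64 * k ≤ N + 64 := by
    rcases le_total p 3 with h3 | h3
    · obtain ⟨k, hk0, hkD, hDk, hkN⟩ := exists_width hD hDN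
      have hk' : (0 : ℝ) < k := by exact_mod_cast hk0
      refine ⟨k, hk0, hkD, ?_, hkN⟩
      have h0 : 0 ≤ (3 - p) / (p - 1) := div_nonneg (by linarith) (by linarith)
      have h1 : (3 - p) / (p - 1) ≤ 1 := by rw [div_le_one (by linarith)]; linarith
      rw [max_eq_left h0] at hθ
      have e : ((k : ℝ) ^ (1 / (p - 1))) ^ 2 = (k : ℝ) ^ thetaExp p * k := by
        rw [← Real.rpow_add_one hk'.ne', ← Real.rpow_natCast, ← Real.rpow_mul hk'.le, hθ]
        congr 1
        have : p - 1 ≠ 0 := by linarith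
        field_simp
        push_cast; ring
      rw [e]
      refine mul_le_mul_of_nonneg_right ?_ hk'.le
      have h2 : (D / 64) ^ thetaExp p ≤ (k : ℝ) ^ thetaExp p :=
        Real.rpow_le_rpow (by linarith) hDk (by rw [hθ]; exact h0)
      have h3 : (64 : ℝ) ^ thetaExp p ≤ 64 := by
        have := Real.rpow_le_rpow_of_exponent_le (by norm_num : (1 : ℝ) ≤ 64) (hθ ▸ h1)
        rwa [Real.rpow_one] at this
      rw [Real.div_rpow (by linarith) (by norm_num)] at h2
      refine le_trans ?_ h2
      exact div_le_div_of_nonneg_left (Real.rpow_nonneg (by linarith) _)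
        (Real.rpow_pos_of_pos (by norm_num) _) h3
    · refine ⟨1, one_pos, by norm_num; linarith, ?_, by omega⟩
      rw [max_eq_right (div_nonpos_of_nonpos_of_nonneg (by linarith) (by linarith))] at hθ
      rw [hθ]
      norm_num
  have hk' : (0 : ℝ) < k := by exact_mod_cast hk0
  set L := N / 4 with hL
  set r := N / (16 * k) with hr
  have hL1 : (N : ℝ) / (2 * (4 : ℕ)) ≤ L := div_two_mul_le_floor (by norm_num) (by omega)
  have hr1 : (N : ℝ) / (2 * (16 * k : ℕ)) ≤ r := div_two_mul_le_floor (by omega) (by omega)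
  have hr0 : 0 < r := Nat.div_pos (by omega) (by omega)
  have hrk : 16 * (k * r) ≤ N := by
    have := Nat.mul_div_le N (16 * k)
    rw [← hr] at this
    linarith
  norm_num at hL1
  push_cast at hr1
  obtain ⟨m, G, f₀, hm, hG, hdeg, hf₀, ht⟩ := exists_graph_le_consensusTime hp1
    (u := fun l => if l < 2 * r + 2 then k else 1) (h := 2 * r + 2) (L := L) (k := k)
    (B := lagWeight p / 64 * ((r : ℝ) ^ 2 * L * k * ((k : ℝ) ^ (1 / (p - 1))) ^ 2))
    (by omega) (by omega) (fun l => by split_ifs <;> omega)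
    (fun l hl => by rw [if_neg (by omega)]) (fun l hl => by split_ifs <;> omega)
    (fun m G lay hlay hadj hc1 hc2 v T hT =>
      le_time_of_two_le hp.le hlay hadj hr0 hk0 (by omega)
        (fun l hl => by rw [hc1 l hl, if_pos hl]) hc2 v T fun u _ => hT u)
  refine ⟨m, G, f₀, hm.trans ?_, hG, hdeg.trans hkD, hf₀, fun v =>
    (ENNReal.ofReal_le_ofReal ?_).trans (ht v)⟩
  · rw [Finset.sum_congr rfl (g := fun _ => k) fun l hl => if_pos (Finset.mem_range.1 hl),
      Finset.sum_const, Finset.card_range, smul_eq_mul]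
    have : r ≤ k * r := Nat.le_mul_of_pos_left r hk0
    have e : (2 * r + 2) * k = 2 * (k * r) + 2 * k := by ring
    omega
  · rw [rateF_eq hp1 (by omega) (by linarith), rateScale, if_neg (not_le.2 hp),
      div_div_eq_mul_div, div_one]
    have hDθ : 0 ≤ D ^ thetaExp p := Real.rpow_nonneg (by linarith) _
    have hl := (lagWeight_pos hp1).le
    have h1 : (N / (2 * (16 * k)) : ℝ) ^ 2 ≤ (r : ℝ) ^ 2 := by gcongr
    calc _ = lagWeight p / 64 * ((N / (2 * (16 * k)) : ℝ) ^ 2 * (N / 8) * k *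
          (D ^ thetaExp p / 64 * k)) := by field_simp; ring
      _ ≤ _ := by gcongr

end LpConsensus

theorem mainTheorem1 (p : ℝ) (hp : 1 < p) :
    (∃ c C : ℝ, 0 < c ∧ 0 < C ∧
      ∀ (V : Type*) [Fintype V] [MeasurableSpace V] [MeasurableSingletonClass V]
        (G : SimpleGraph V), G.Connected → 2 ≤ Fintype.card V →
      ∀ f₀ : V → ℝ, (∀ x, f₀ x ∈ Set.Icc (0 : ℝ) 1) →
      ∀ (Ω : Type*) [MeasurableSpace Ω] (μ : Measure Ω) [IsProbabilityMeasure μ]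
        (v : ℕ → Ω → V), IsUniformSelection μ v →
        (∀ t : ℕ,
          Integrable (fun ω => energy G p (opinion G p f₀ (fun s => v s ω) t)) μ ∧
          ∫ ω, energy G p (opinion G p f₀ (fun s => v s ω) t) ∂μ ≤
            energy G p f₀ * Real.exp (-c * rateF (Fintype.card V) p (avgDegree G) * t)) ∧
        (∀ ε : ℝ, 0 < ε → ε ≤ 1 / 2 →
          ∫⁻ ω, (consensusTime G p f₀ (fun s => v s ω) ε : ℝ≥0∞) ∂μ ≤
            ENNReal.ofReal (C * Real.log (Fintype.card V / ε) /
              rateF (Fintype.card V) p (avgDegree G)))) ∧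
    (∃ c' : ℝ, 0 < c' ∧ ∃ N₀ : ℕ, ∀ N : ℕ, N₀ ≤ N → ∀ D : ℝ, 2 ≤ D → D ≤ N →
      ∃ (m : ℕ) (G : SimpleGraph (Fin m)) (f₀ : Fin m → ℝ),
        m ≤ N ∧ G.Connected ∧ avgDegree G ≤ D ∧ (∀ x, f₀ x ∈ Set.Icc (0 : ℝ) 1) ∧
        ∀ v : ℕ → Fin m,
          ENNReal.ofReal (c' / rateF N p D) ≤ (consensusTime G p f₀ v (1 / 2) : ℝ≥0∞)) := by
  refine ⟨⟨decayConst p, (p + 5) / decayConst p, decayConst_pos hp,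
    div_pos (by linarith) (decayConst_pos hp), ?_⟩, ?_⟩
  · intro V _ _ _ G hG hn f₀ hf₀ Ω _ μ _ v hv
    exact ⟨fun t => ⟨integrable_opinion G hG.nonempty p f₀ hv.measurable t (energy G p),
      integral_energy_le hp hG hn f₀ hv t⟩,
      fun ε hε hε2 => lintegral_consensusTime_le hp hG hn hf₀ hv hε hε2⟩
  · rcases le_or_gt p 2 with hp2 | hp2
    · exact ⟨1 / 1024 * (1 / 16384 : ℝ) ^ (1 / (p - 1)), by positivity, 64,
        fun N hN D hD hDN => exists_slow_graph_of_le_two hp hp2 hN hD hDN⟩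
    · exact ⟨lagWeight p / 33554432, div_pos (lagWeight_pos hp) (by norm_num), 64,
        fun N hN D hD hDN => exists_slow_graph_of_two_lt hp2 hN hD hDN⟩
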